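/- Let $V$ be a Euclidean vector space of dimension $n\ge 1$ with unit sphere $S(V)$. For a convex body (nonempty compact convex set) $K\subset V$ let $N(K)\subset V\times S(V)$ be its normal cycle, i.e. the set of pairs $(x,u)$ with $x\in K$ and $u$ an outer unit normal of $K$ at $x$, regarded as an oriented $(n-1)$-dimensional Lipschitz submanifold, and let $\pi_2:V\times S(V)\to S(V)$ be the projection. A smooth area measure on $V$ is a map $\Psi$ assigning to each convex body $K$ the signed Borel measure $\Psi(K,A)=\int_{N(K)\cap\pi_2^{-1}(A)}\omega$ on $S(V)$, where $\omega$ is a fixed smooth differential $(n-1)$-form on $V\times S(V)$ which is invariant under translations of $V$. Its centroid map is $C(\Psi)(K)=\int_{S(V)}u\,d\Psi(K,u)\in V$. Let $\omega_d$ be the volume of the $d$-dimensional Euclidean unit ball and $\mathcal H^d$ the $d$-dimensional Hausdorff measure. For a face $F$ of a polytope $P$ let $N(F,P)$ be the normal cone of $P$ at $F$ and $\bar F$ the linear subspace parallel to the affine span of $F$; let $\mathcal F_k(P)$ be the set of $k$-dimensional faces of $P$. A smooth area measure $\Psi$ is called angular if there are numbers $c_\Psi(E)$, one for each linear subspace $E$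 of $V$, such that for every polytope $P$ and every Borel set $A\subset S(V)$ $$\Psi(P,A)=\sum_{k=0}^{n-1}\sum_{F\in\mathcal F_k(P)}c_\Psi(\bar F)\,\frac{\mathcal H^{n-1-k}(N(F,P)\cap A)}{(n-k)\,\omega_{n-k}}\,\mathrm{vol}_k(F).$$ Let $S_0,\dots,S_{n-1}$ be the classical area measures, i.e. the coefficients in the local Steiner formula: for every convex body $K$, every Borel set $A\subset S(V)$ and every $\varepsilon>0$, the set of points $y$ with $0<d(y,K)\le\varepsilon$ for which the unit vector pointing from the nearest point of $K$ to $y$ lies in $A$ has volume $\frac1n\sum_{k=0}^{n-1}\varepsilon^{n-k}\binom nk S_k(K,A)$. Define $\Delta_k$ by $n\,\omega_{n-k}\,\Delta_k=\binom nk S_k$. Theorem. Suppose that $\Psi$ is an angular smooth area measure on $V$. Then $C(\Psi)=0$ (that is, $C(\Psi)(K)=0$ for every convex body $K$) if and only if $\Psi$ is a linear combination of $\Delta_0,\dots,\Delta_{n-1}$. -/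

import Mathlib

noncomputable section

open MeasureTheory Metric Module Set
open scoped ContDiff Manifold RealInnerProductSpace

namespace AreaMeasures

variable {V : Type*} [NormedAddCommGroup V] [InnerProductSpace ℝ V]

/-! ### Metric projection and normal bundle of a convex body -/

/-- The metric projection of `V` onto the convex body `K`: the point of `K` nearest to `y`
(unique, because `K` is compact and convex). -/
def footPoint (K : ConvexBody V) (y : V) : V :=
  (K.isCompact.exists_infDist_eq_dist K.nonempty y).choose

theorem footPoint_mem (K : ConvexBody V) (y : V) : footPoint K y ∈ (K : Set V) :=
  (K.isCompact.exists_infDist_eq_dist K.nonempty y).choose_spec.1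

theorem infDist_eq_norm (K : ConvexBody V) (y : V) :
    infDist y (K : Set V) = ‖y - footPoint K y‖ := by
  rw [← dist_eq_norm]
  exact (K.isCompact.exists_infDist_eq_dist K.nonempty y).choose_spec.2

/-- For `y ∉ K`: the unit vector pointing from the nearest point of `K` to `y`. -/
def outerNormal (K : ConvexBody V) (y : V) : V :=
  (infDist y (K : Set V))⁻¹ • (y - footPoint K y)

theorem outerNormal_mem_sphere (K : ConvexBody V) {y : V} (hy : 0 < infDist y (K : Set V)) :
    outerNormal K y ∈ sphere (0 : V) 1 := by
  rw [mem_sphere_zero_iff_norm, outerNormal, norm_smul, ← infDist_eq_norm, norm_inv,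
    Real.norm_of_nonneg hy.le, inv_mul_cancel₀ hy.ne']

/-- The set `N(K) ⊆ V × S(V)` of all pairs `(x, u)` such that `u` is an outer unit normal of `K`
at the point `x` of `K`. -/
def normalBundle (K : ConvexBody V) : Set (V × sphere (0 : V) 1) :=
  {p | p.1 ∈ (K : Set V) ∧ ∀ z ∈ (K : Set V), ⟪z - p.1, (p.2 : V)⟫ ≤ 0}

/-- The shell `{y | 1 < d(y, K) < 2}`. -/
def shell (K : ConvexBody V) : Set V :=
  {y | 1 < infDist y (K : Set V) ∧ infDist y (K : Set V) < 2}

/-- The map `y ↦ (x, u)` from the shell to `N(K)`, where `x` is the nearest point of `y` in `K`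
and `u` the direction from `x` to `y`. -/
def shellToBundle (K : ConvexBody V) (y : shell K) : V × sphere (0 : V) 1 :=
  (footPoint K y.1, ⟨outerNormal K y.1, outerNormal_mem_sphere K (one_pos.trans y.2.1)⟩)

theorem footPoint_inner_le (K : ConvexBody V) (y : V) {z : V} (hz : z ∈ (K : Set V)) :
    ⟪y - footPoint K y, z - footPoint K y⟫ ≤ 0 := by
  have h := infDist_eq_norm K y
  have hne : Nonempty (K : Set V) := K.nonempty.to_subtype
  refine (norm_eq_iInf_iff_real_inner_le_zero K.convex (footPoint_mem K y)).1 ?_ z hz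
  rw [← h, infDist_eq_iInf]
  simp_rw [dist_eq_norm]

theorem footPoint_eq (K : ConvexBody V) {x v : V} (hx : x ∈ (K : Set V))
    (hv : ∀ z ∈ (K : Set V), ⟪z - x, v⟫ ≤ 0) : footPoint K (x + v) = x := by
  have h1 := footPoint_inner_le K (x + v) hx
  have h2 := hv _ (footPoint_mem K (x + v))
  set p := footPoint K (x + v)
  have h3 : ⟪p - x, p - x⟫ ≤ 0 := by
    have e : x + v - p = v - (p - x) := by abel
    have e2 : x - p = -(p - x) := by abel
    rw [e, e2, inner_neg_right, inner_sub_left, real_inner_comm] at h1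
    linarith
  exact sub_eq_zero.1 (real_inner_self_nonpos.1 h3)

/-- The map `(x, u, t) ↦ x + t u` is a bijection from `N(K) × (1, 2)` onto the shell, with inverse
`y ↦ (x, u, d(y, K))`. -/
theorem bijOn_shell (K : ConvexBody V) :
    BijOn (fun q : (V × sphere (0 : V) 1) × ℝ => q.1.1 + q.2 • (q.1.2 : V))
      (normalBundle K ×ˢ Ioo 1 2) (shell K) := by
  have key : ∀ q ∈ normalBundle K ×ˢ Ioo (1 : ℝ) 2,
      footPoint K (q.1.1 + q.2 • (q.1.2 : V)) = q.1.1 ∧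
      infDist (q.1.1 + q.2 • (q.1.2 : V)) (K : Set V) = q.2 := by
    rintro ⟨⟨x, u⟩, t⟩ ⟨⟨hx, hu⟩, ht⟩
    have ht0 : (0 : ℝ) ≤ t := by linarith [ht.1]
    have hf : footPoint K (x + t • (u : V)) = x := footPoint_eq K hx fun z hz => by
      rw [inner_smul_right]
      exact mul_nonpos_of_nonneg_of_nonpos ht0 (hu z hz)
    refine ⟨hf, ?_⟩
    simp only
    rw [infDist_eq_norm, hf, add_sub_cancel_left, norm_smul, norm_eq_of_mem_sphere, mul_one,
      Real.norm_of_nonneg ht0]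
  refine ⟨fun q hq => ?_, fun q hq r hr h => ?_, fun y hy => ?_⟩
  · exact ⟨(key q hq).2.symm ▸ hq.2.1, (key q hq).2.symm ▸ hq.2.2⟩
  · have h' : q.1.1 + q.2 • (q.1.2 : V) = r.1.1 + r.2 • (r.1.2 : V) := h
    have e1 : q.1.1 = r.1.1 := by rw [← (key q hq).1, ← (key r hr).1, h']
    have e2 : q.2 = r.2 := by rw [← (key q hq).2, ← (key r hr).2, h']
    have hq2 : q.2 ≠ 0 := by linarith [hq.2.1] |> fun h : (0 : ℝ) < q.2 => h.ne'
    rw [← e1, ← e2] at h'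
    have e3 : (q.1.2 : V) = r.1.2 := smul_right_injective V hq2 (add_left_cancel h')
    exact Prod.ext (Prod.ext e1 (Subtype.ext e3)) e2
  · have h0 : 0 < infDist y (K : Set V) := one_pos.trans hy.1
    refine ⟨(shellToBundle K ⟨y, hy⟩, infDist y (K : Set V)),
      ⟨⟨footPoint_mem K y, fun z hz => ?_⟩, hy⟩, ?_⟩
    · simp only [shellToBundle, outerNormal]
      rw [inner_smul_right, real_inner_comm]
      exact mul_nonpos_of_nonneg_of_nonpos (inv_nonneg.2 h0.le) (footPoint_inner_le K y hz)
    · simp only [shellToBundle, outerNormal]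
      rw [smul_inv_smul₀ h0.ne', add_sub_cancel]

/-! ### Integration over the normal cycle and smooth area measures -/

section Smooth

variable [FiniteDimensional ℝ V]

/-- An orthonormal basis of `V`, which fixes an orientation of `V`. Reversing the orientation
replaces integration of a form `η` over the normal cycle by integration of `-η`; the space of
smooth area measures does not depend on the choice. -/
def frame (V : Type*) [NormedAddCommGroup V] [InnerProductSpace ℝ V] [FiniteDimensional ℝ V]
    (m : ℕ) [hm : Fact (finrank ℝ V = m + 1)] : OrthonormalBasis (Fin (m + 1)) ℝ V :=
  (stdOrthonormalBasis ℝ V).reindex (finCongr hm.out)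

/-- A translation-invariant smooth differential `m`-form on the sphere bundle `SV = V × S(V)`,
where `dim V = m + 1`. By translation invariance its value at `(x, u)` depends only on `u`. That
value is an alternating form on the tangent space `V × u^⊥`, here given by an alternating form on
`V × V` that depends smoothly on `u` and of which only the restriction to `V × u^⊥` is ever used;
every smooth family of forms on the spaces `V × u^⊥` has such an extension, by orthogonal
projection. -/
structure InvariantForm (V : Type*) [NormedAddCommGroup V] [InnerProductSpace ℝ V]
    [FiniteDimensional ℝ V] (m : ℕ) [Fact (finrank ℝ V = m + 1)] where
  /-- the value of the form at the points `(x, u)` -/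
  toFun : sphere (0 : V) 1 → (V × V) [⋀^Fin m]→L[ℝ] ℝ
  smooth : ContMDiff (𝓡 m) 𝓘(ℝ, (V × V) [⋀^Fin m]→L[ℝ] ℝ) ∞ toFun

variable {m : ℕ} [Fact (finrank ℝ V = m + 1)]

/-- The density with respect to Lebesgue measure of the `(m + 1)`-form `dt ∧ Φ^* η` on the shell,
where `t = d(y, K)`, so that `dt = ⟪u, ·⟫`, and `Φ(y) = (x, u)` is the Lipschitz map
`shellToBundle`; that is, the value
`∑ i, (-1)^i dt(b i) η_u(DΦ(b 0), …, omit DΦ(b i), …, DΦ(b m))`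
of this form on an orthonormal basis `b` of `V`. By Rademacher's theorem the derivative exists
almost everywhere. -/
def shellDensity (η : InvariantForm V m) (K : ConvexBody V) (y : shell K) : ℝ :=
  ∑ i : Fin (m + 1), (-1) ^ (i : ℕ) * ⟪outerNormal K y.1, frame V m i⟫ *
    η.toFun (shellToBundle K y).2 fun j =>
      fderiv ℝ (fun z => (footPoint K z, outerNormal K z)) y.1 (frame V m (i.succAbove j))

variable [MeasurableSpace V] [BorelSpace V]

/-- The signed Borel measure `B ↦ ∫_{N(K) ∩ B} η` on `V × S(V)` given by integration of `η` over
the normal cycle of `K`. Here `N(K)` is an oriented Lipschitz manifold, the map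
`(x, u, t) ↦ x + t u` is a locally bi-Lipschitz parametrization of the shell by `N(K) × (1, 2)`, and
`∫_{N(K) ∩ B} η = ∫_{(N(K) ∩ B) × (1, 2)} dt ∧ η` is computed as a Lebesgue integral over the
corresponding part of the shell. -/
def normalCycle (η : InvariantForm V m) (K : ConvexBody V) :
    SignedMeasure (V × sphere (0 : V) 1) :=
  (((volume : Measure V).comap ((↑) : shell K → V)).withDensityᵥ (shellDensity η K)).map (shellToBundle K)

/-- A smooth area measure, as a map from convex bodies to signed Borel measures on the unit sphere:
`Ψ(K, A) = ∫_{N(K) ∩ π₂⁻¹(A)} η` for a translation-invariant smooth form `η`. -/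
def IsSmoothAreaMeasure (m : ℕ) [Fact (finrank ℝ V = m + 1)]
    (Ψ : ConvexBody V → SignedMeasure (sphere (0 : V) 1)) : Prop :=
  ∃ η : InvariantForm V m, ∀ (K : ConvexBody V) (A : Set (sphere (0 : V) 1)), MeasurableSet A →
    Ψ K A = normalCycle η K (Prod.snd ⁻¹' A)

end Smooth

/-- The centroid map `C(Ψ)(K) = ∫ u dΨ(K, u)`. -/
def centroidMap [MeasurableSpace V] (Ψ : ConvexBody V → SignedMeasure (sphere (0 : V) 1))
    (K : ConvexBody V) : V :=
  ∫ᵛ u, (u : V) ∂<•(Ψ K)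

/-! ### Classical area measures -/

/-- The volume `ω_d = π^(d/2) / Γ(d/2 + 1)` of the unit ball of dimension `d`. -/
def unitBallVolume (d : ℕ) : ℝ :=
  Real.pi ^ ((d : ℝ) / 2) / Real.Gamma ((d : ℝ) / 2 + 1)

/-- The local parallel set of all `y` with `0 < d(y, K) ≤ ε` for which the direction from the
nearest point of `K` to `y` belongs to `A`. -/
def localParallelSet (K : ConvexBody V) (ε : ℝ) (A : Set (sphere (0 : V) 1)) : Set V :=
  {y | 0 < infDist y (K : Set V) ∧ infDist y (K : Set V) ≤ ε ∧
    outerNormal K y ∈ ((↑) '' A : Set V)}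

section Classical

variable [FiniteDimensional ℝ V] [MeasurableSpace V] [BorelSpace V]

/-- The local Steiner formula, `n = dim V`: for all `ε > 0` and all Borel sets `A`, the local
parallel set has volume `(1/n) ∑_{k<n} ε^(n-k) (n choose k) S_k(A)`. Since the coefficients of a
polynomial are unique, there is at most one such family `S_0, …, S_(n-1)`. -/
def LocalSteinerFormula (K : ConvexBody V)
    (S : Fin (finrank ℝ V) → SignedMeasure (sphere (0 : V) 1)) : Prop :=
  ∀ ε : ℝ, 0 < ε → ∀ A : Set (sphere (0 : V) 1), MeasurableSet A →
    volume.real (localParallelSet K ε A) =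
      (1 / (finrank ℝ V : ℝ)) * ∑ k : Fin (finrank ℝ V),
        ε ^ (finrank ℝ V - (k : ℕ)) * ((finrank ℝ V).choose k : ℝ) * S k A

/-- The classical area measures `S_k(K)`: the coefficients in the local Steiner formula of `K`. -/
def classicalAreaMeasure (k : Fin (finrank ℝ V)) (K : ConvexBody V) :
    SignedMeasure (sphere (0 : V) 1) :=
  Classical.epsilon (LocalSteinerFormula K) k

/-- The renormalized area measures `Δ_k`, defined by `n ω_{n-k} Δ_k = (n choose k) S_k`. -/
def Δ (k : Fin (finrank ℝ V)) (K : ConvexBody V) : SignedMeasure (sphere (0 : V) 1) :=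
  (((finrank ℝ V).choose k : ℝ) / ((finrank ℝ V : ℝ) * unitBallVolume (finrank ℝ V - (k : ℕ)))) •
    classicalAreaMeasure k K

end Classical

/-! ### Polytopes and angular area measures -/

/-- A polytope: the convex hull of a finite set (nonempty, as `P` is a convex body). -/
def IsPolytope (P : ConvexBody V) : Prop :=
  ∃ s : Set V, s.Finite ∧ (P : Set V) = convexHull ℝ s

/-- The linear subspace parallel to the affine span of `F`. -/
def directionSpace (F : Set V) : Submodule ℝ V := (affineSpan ℝ F).direction

/-- The set of `k`-dimensional faces of the polytope `P` (including `P` itself if `dim P = k`). -/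
def faces (P : ConvexBody V) (k : ℕ) : Set (Set V) :=
  {F | IsExposed ℝ (P : Set V) F ∧ F.Nonempty ∧ finrank ℝ (directionSpace F) = k}

/-- The normal cone `N(F, P)` of `P` at its face `F`. -/
def normalCone (F : Set V) (P : ConvexBody V) : Set V :=
  {v | ∀ x ∈ F, ∀ z ∈ (P : Set V), ⟪z - x, v⟫ ≤ 0}

/-- `Ψ` is angular: there are numbers `c(E)`, one for each linear subspace `E` of `V`, such that
for every polytope `P` and every Borel set `A`, with `n = dim V`,
`Ψ(P, A) = ∑_{k<n} ∑_F c(F̄) H^{n-1-k}(N(F, P) ∩ A) / ((n-k) ω_{n-k}) vol_k(F)`,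
where `F` runs through the `k`-dimensional faces of `P`. -/
def IsAngular [MeasurableSpace V] [BorelSpace V]
    (Ψ : ConvexBody V → SignedMeasure (sphere (0 : V) 1)) : Prop :=
  ∃ c : Submodule ℝ V → ℝ, ∀ P : ConvexBody V, IsPolytope P →
    ∀ A : Set (sphere (0 : V) 1), MeasurableSet A →
      Ψ P A = ∑ k ∈ Finset.range (finrank ℝ V), ∑ᶠ F ∈ faces P k,
        c (directionSpace F) *
          ((μHE[finrank ℝ V - 1 - k] : Measure (sphere (0 : V) 1)).real
              {u | (u : V) ∈ normalCone F P ∧ u ∈ A} /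
            (((finrank ℝ V - k : ℕ) : ℝ) * unitBallVolume (finrank ℝ V - k))) *
          (μHE[k] : Measure V).real F

end AreaMeasures

end

/-!
Both implications describe smooth area measures by means of the metric projection of `V` onto a
convex body `K`. It is `1`-Lipschitz, hence differentiable almost everywhere; its derivative `L` is
symmetric, kills the outer normal, and has eigenvalues `l j ∈ [0, 1]` on the orthogonal complement
of the outer normal (`exists_eigenframe`).

*Linear combinations of the `Δ k` have vanishing centroid.* Scaling the distance from `K` by a
factor `s` maps a local parallel set onto another one, and its derivative `L + s (1 - L)` has
determinant `s ∏ j, (l j + s (1 - l j))`. Expanding in powers of `s` and using the area formula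
gives a local Steiner formula whose coefficients are integrals of functions of `L`
(`localSteinerFormula_curvatureMeasure`); as the coefficients of a polynomial are unique, the
measures `Δ k` are the curvature measures up to normalization (`Δ_eq`). The outer normal is the
gradient of the distance `d`, so its integral over the parallel set of radius `ε` is, up to sign,
the integral of the gradient of the compactly supported function `max 0 (ε - d)`, that is, zero
(`setIntegral_inner_outerNormal`). Comparing coefficients in `ε` shows that every curvature measure
has centroid zero (`integral_curvatureMeasure`).

*An angular smooth area measure `Ψ` with vanishing centroid is a linear combination of the `Δ k`.*
First, the coefficients `c E` depend on `dim E` only (`exists_coeff_eq`), by induction on the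
dimension. It suffices to exchange one spanning vector, that is, to compare the two subspaces
`D + ℝ a` and `D + ℝ b` with unit vectors `a`, `b` orthogonal to `D`. Take a polytope spanned by
`0`, `a`, `b` and points of `D`, and consider the component of its centroid along `a - b`
(`coeff_eq_of_centroidMap_eq_zero`). The reflection that exchanges `a` and `b` preserves the
polytope, so faces of smaller dimension, whose coefficients are already known to be equal, cancel
each other, and the polytope itself, whose linear span contains `a - b`, contributes nothing. In
dimension `dim D + 1`, after subtracting `c (D + ℝ b)` from all coefficients, only
the face in `D + ℝ a` is left. Its normal cone is half of the orthogonal complement of `D + ℝ a`,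
so that its own contribution is not zero, and the coefficients of `D + ℝ a` and `D + ℝ b` agree.

Second, the value of the form `η` of `Ψ` on a tangent space of a normal cycle expands into a
combination of the values on the tangent spaces `E × (E + ℝ u)ᗮ`, where `E` is spanned by
eigenvectors of `L` (`shellDensity_eq_sum`). These values, the flat densities of `η`, are seen on
polytopes of lower dimension. For a polytope `P ⊆ E` and a linear isometry `T`, the measures of `P`
and of `T P` correspond to each other, because the coefficients depend on the dimension only.
Letting `T` move a pair `(E, u)` to any other pair `(E', u')` with `dim E' = dim E` shows that the
flat densities depend on `dim E` only (`flatDensity_le_of_coeff_eq`). Then the density of `η` over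
every normal cycle is a combination of curvature densities with constant coefficients, and `Ψ` is a
combination of the `Δ k` (`mem_span_Δ_of_flatDensity_eq`).
-/

noncomputable section

open MeasureTheory Metric Module Set Filter Topology
open scoped ContDiff Manifold RealInnerProductSpace NNReal ENNReal

namespace AreaMeasures

variable {V : Type*} [NormedAddCommGroup V] [InnerProductSpace ℝ V]

/-! ### The metric projection onto a convex body -/

/-- Firm nonexpansiveness of the metric projection. -/
theorem norm_footPoint_sub_sq_le (K : ConvexBody V) (x y : V) :
    ‖footPoint K x - footPoint K y‖ ^ 2 ≤ ⟪footPoint K x - footPoint K y, x - y⟫ := by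
  have h1 := footPoint_inner_le K x (footPoint_mem K y)
  have h2 := footPoint_inner_le K y (footPoint_mem K x)
  rw [← real_inner_self_eq_norm_sq]
  set p := footPoint K x
  set q := footPoint K y
  have e1 : ⟪x - p, q - p⟫ = ⟪p - q, p - q⟫ - ⟪p - q, x - q⟫ := by
    rw [← inner_sub_right, ← neg_sub p q, inner_neg_right, real_inner_comm, ← inner_neg_right]
    congr 1
    abel
  have e2 : ⟪y - q, p - q⟫ = ⟪p - q, y - q⟫ := real_inner_comm _ _
  have e3 : ⟪p - q, x - y⟫ = ⟪p - q, x - q⟫ - ⟪p - q, y - q⟫ := by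
    rw [← inner_sub_right]
    congr 1
    abel
  linarith

theorem norm_footPoint_sub_le (K : ConvexBody V) (x y : V) :
    ‖footPoint K x - footPoint K y‖ ≤ ‖x - y‖ := by
  have h := (norm_footPoint_sub_sq_le K x y).trans (real_inner_le_norm _ _)
  rw [pow_two] at h
  by_contra! hlt
  have : 0 < ‖footPoint K x - footPoint K y‖ := (norm_nonneg _).trans_lt hlt
  exact absurd (le_of_mul_le_mul_left h this) (not_le.2 hlt)

theorem lipschitzWith_footPoint (K : ConvexBody V) : LipschitzWith 1 (footPoint K) :=
  LipschitzWith.of_dist_le_mul fun x y => by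
    simpa [dist_eq_norm] using norm_footPoint_sub_le K x y

theorem infDist_le_norm (K : ConvexBody V) (y : V) {z : V} (hz : z ∈ (K : Set V)) :
    infDist y (K : Set V) ≤ ‖y - z‖ := by
  rw [← dist_eq_norm]
  exact infDist_le_dist_of_mem hz

theorem eq_footPoint (K : ConvexBody V) {y x : V} (hx : x ∈ (K : Set V))
    (h : ∀ z ∈ (K : Set V), ⟪z - x, y - x⟫ ≤ 0) : footPoint K y = x := by
  simpa using footPoint_eq K hx h

theorem infDist_smul_outerNormal (K : ConvexBody V) {y : V} (hy : 0 < infDist y (K : Set V)) :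
    infDist y (K : Set V) • outerNormal K y = y - footPoint K y := by
  rw [outerNormal, smul_inv_smul₀ hy.ne']

theorem norm_outerNormal (K : ConvexBody V) {y : V} (hy : 0 < infDist y (K : Set V)) :
    ‖outerNormal K y‖ = 1 := by
  simpa using outerNormal_mem_sphere K hy

theorem footPoint_ray (K : ConvexBody V) (y : V) {s : ℝ} (hs : 0 ≤ s) :
    footPoint K (footPoint K y + s • (y - footPoint K y)) = footPoint K y :=
  footPoint_eq K (footPoint_mem K y) fun z hz => by
    rw [inner_smul_right, real_inner_comm]
    exact mul_nonpos_of_nonneg_of_nonpos hs (footPoint_inner_le K y hz)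

theorem infDist_ray (K : ConvexBody V) (y : V) {s : ℝ} (hs : 0 ≤ s) :
    infDist (footPoint K y + s • (y - footPoint K y)) (K : Set V) = s * infDist y (K : Set V) := by
  rw [infDist_eq_norm, footPoint_ray K y hs, add_sub_cancel_left, norm_smul,
    Real.norm_of_nonneg hs, infDist_eq_norm]

theorem outerNormal_ray (K : ConvexBody V) (y : V) {s : ℝ} (hs : 0 < s) :
    outerNormal K (footPoint K y + s • (y - footPoint K y)) = outerNormal K y := by
  rw [outerNormal, footPoint_ray K y hs.le, infDist_ray K y hs.le, add_sub_cancel_left, smul_smul,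
    mul_inv, outerNormal]
  congr 1
  field_simp

/-- Half of the squared distance from a convex body is differentiable, and its gradient at `y` is
the vector from the nearest point to `y`. -/
theorem hasFDerivAt_half_sq_infDist (K : ConvexBody V) (y : V) :
    HasFDerivAt (fun z => infDist z (K : Set V) ^ 2 / 2) (innerSL ℝ (y - footPoint K y)) y := by
  rw [hasFDerivAt_iff_isLittleO_nhds_zero]
  have key : ∀ h : V, ‖infDist (y + h) (K : Set V) ^ 2 / 2 - infDist y (K : Set V) ^ 2 / 2
      - innerSL ℝ (y - footPoint K y) h‖ ≤ 2 * ‖h‖ ^ 2 := by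
    intro h
    have a1 := infDist_le_norm K (y + h) (footPoint_mem K y)
    have a2 := infDist_le_norm K y (footPoint_mem K (y + h))
    have b1 := pow_le_pow_left₀ infDist_nonneg a1 2
    have b2 := pow_le_pow_left₀ infDist_nonneg a2 2
    have e1 := infDist_eq_norm K y
    have e2 := infDist_eq_norm K (y + h)
    have c := norm_footPoint_sub_le K (y + h) y
    set p := footPoint K y
    set q := footPoint K (y + h)
    have f1 : ‖y + h - p‖ ^ 2 = ‖y - p‖ ^ 2 + 2 * ⟪y - p, h⟫ + ‖h‖ ^ 2 := by
      rw [← norm_add_sq_real]; congr 2; abel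
    have f2 : ‖y - q‖ ^ 2 = ‖y + h - q‖ ^ 2 - 2 * ⟪y + h - q, h⟫ + ‖h‖ ^ 2 := by
      rw [← norm_sub_sq_real]; congr 2; abel
    have f3 : ⟪y + h - q, h⟫ = ⟪y - p, h⟫ + ‖h‖ ^ 2 - ⟪q - p, h⟫ := by
      rw [← real_inner_self_eq_norm_sq, ← inner_add_left, ← inner_sub_left]; congr 1; abel
    have f4 : ⟪q - p, h⟫ ≤ ‖h‖ ^ 2 := by
      refine (real_inner_le_norm _ _).trans ?_
      rw [add_sub_cancel_left] at c
      nlinarith [norm_nonneg h]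
    rw [innerSL_apply_apply, Real.norm_eq_abs, abs_le]
    rw [e2] at b1
    rw [e1] at b2
    rw [e1, e2]
    constructor <;> nlinarith [sq_nonneg ‖h‖]
  refine Asymptotics.IsBigO.trans_isLittleO (g := fun h : V => ‖h‖ ^ 2) ?_ ?_
  · exact Asymptotics.IsBigO.of_bound 2 (Eventually.of_forall fun h => by simpa using key h)
  · simpa using (Asymptotics.isLittleO_norm_pow_id (E' := V) one_lt_two)

theorem hasFDerivAt_infDist (K : ConvexBody V) {y : V} (hy : 0 < infDist y (K : Set V)) :
    HasFDerivAt (fun z => infDist z (K : Set V)) (innerSL ℝ (outerNormal K y)) y := by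
  have h1 := ((hasFDerivAt_half_sq_infDist K y).const_mul 2).sqrt
    (by positivity : (2 : ℝ) * (infDist y (K : Set V) ^ 2 / 2) ≠ 0)
  have e : ∀ z, √(2 * (infDist z (K : Set V) ^ 2 / 2)) = infDist z (K : Set V) := fun z => by
    rw [mul_div_cancel₀ _ two_ne_zero, Real.sqrt_sq infDist_nonneg]
  simp only [e] at h1
  convert h1 using 1
  ext w
  simp only [outerNormal, innerSL_apply_apply, smul_apply, inner_smul_left,
    smul_eq_mul]
  simp
  field_simp

theorem hasFDerivAt_outerNormal (K : ConvexBody V) {y : V} (hy : 0 < infDist y (K : Set V))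
    {L : V →L[ℝ] V} (hL : HasFDerivAt (footPoint K) L y) :
    HasFDerivAt (outerNormal K) ((infDist y (K : Set V))⁻¹ • (ContinuousLinearMap.id ℝ V - L -
      (innerSL ℝ (outerNormal K y)).smulRight (outerNormal K y))) y := by
  have h1 := ((hasDerivAt_inv hy.ne').comp_hasFDerivAt y (hasFDerivAt_infDist K hy)).smul
    ((hasFDerivAt_id y).sub hL)
  refine h1.congr_fderiv ?_
  ext w
  simp only [Pi.sub_apply, id, ← infDist_smul_outerNormal K hy, Function.comp_apply, add_apply,
    smul_apply, sub_apply, ContinuousLinearMap.smulRight_apply, ContinuousLinearMap.id_apply,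
    innerSL_apply_apply, smul_sub, smul_smul, smul_eq_mul]
  rw [sub_eq_add_neg (_ - _), ← neg_smul]
  congr 2
  field_simp

section Derivative

variable {K : ConvexBody V} {y : V} {L : V →L[ℝ] V}

/-- The derivative `L` of the metric projection is symmetric, since `1 - L` is the second
derivative of half of the squared distance. -/
theorem inner_fderiv_footPoint_comm (hL : HasFDerivAt (footPoint K) L y) (v w : V) :
    ⟪L v, w⟫ = ⟪v, L w⟫ := by
  have h := second_derivative_symmetric (f := fun z => infDist z (K : Set V) ^ 2 / 2)
    (f' := fun z => innerSL ℝ (z - footPoint K z)) (x := y)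
    (f'' := (innerSL ℝ).comp (ContinuousLinearMap.id ℝ V - L))
    (hasFDerivAt_half_sq_infDist K)
    ((innerSL ℝ (E := V)).hasFDerivAt.comp y ((hasFDerivAt_id y).sub hL)) v w
  simp only [ContinuousLinearMap.comp_apply, sub_apply, innerSL_apply_apply,
    ContinuousLinearMap.id_apply, inner_sub_left] at h
  rw [real_inner_comm v w, real_inner_comm v (L w)] at *
  linarith

/-- The infinitesimal form of firm nonexpansiveness. On eigenvectors it says that the eigenvalues of
`L` lie in `[0, 1]`. -/
theorem norm_fderiv_footPoint_sq_le (hL : HasFDerivAt (footPoint K) L y) (w : V) :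
    ‖L w‖ ^ 2 ≤ ⟪L w, w⟫ := by
  have h1 : Tendsto (fun t : ℝ => t⁻¹ • (footPoint K (y + t • w) - footPoint K y)) (𝓝[≠] 0)
      (𝓝 (L w)) := (hL.hasLineDerivAt w).tendsto_slope_zero
  refine le_of_tendsto_of_tendsto (h1.norm.pow 2) (h1.inner tendsto_const_nhds) ?_
  filter_upwards [self_mem_nhdsWithin] with t ht
  have h := norm_footPoint_sub_sq_le K (y + t • w) y
  rw [add_sub_cancel_left, inner_smul_right] at h
  rw [norm_smul, mul_pow, inner_smul_left]
  have ht' : t ≠ 0 := ht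
  simp only [norm_inv, Real.norm_eq_abs, inv_pow, sq_abs, conj_trivial]
  rw [inv_mul_le_iff₀ (by positivity)]
  rwa [pow_two t, mul_assoc, mul_inv_cancel_left₀ ht']

/-- The metric projection is constant along the outer rays. -/
theorem fderiv_footPoint_outerNormal (hL : HasFDerivAt (footPoint K) L y) :
    L (outerNormal K y) = 0 := by
  have h1 := (hL.hasLineDerivAt (y - footPoint K y))
  have h2 : HasLineDerivAt ℝ (footPoint K) 0 y (y - footPoint K y) := by
    refine (hasDerivAt_const (0 : ℝ) (footPoint K y)).congr_of_eventuallyEq ?_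
    filter_upwards [Ioi_mem_nhds (show (-1 : ℝ) < 0 by norm_num)] with t ht
    have := footPoint_ray K y (s := 1 + t) (by have : -1 < t := ht; linarith)
    rwa [add_smul, one_smul, ← add_assoc, add_sub_cancel] at this
  have h3 := h1.unique h2
  rw [outerNormal, map_smul, h3, smul_zero]

end Derivative

/-! ### Invariant forms and frames of eigenvectors -/

section Form

variable {m : ℕ} [Fact (finrank ℝ V = m + 1)]

theorem hasFDerivAt_footPoint_prod_outerNormal {K : ConvexBody V} {y : V}
    (hy : 0 < infDist y (K : Set V)) {L : V →L[ℝ] V} (hL : HasFDerivAt (footPoint K) L y) :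
    HasFDerivAt (fun z => (footPoint K z, outerNormal K z)) (L.prod ((infDist y (K : Set V))⁻¹ •
      (ContinuousLinearMap.id ℝ V - L -
        (innerSL ℝ (outerNormal K y)).smulRight (outerNormal K y)))) y :=
  hL.prodMk (hasFDerivAt_outerNormal K hy hL)

theorem exists_orthonormalBasis_coe_eq {v : Fin (m + 1) → V} (hv : Orthonormal ℝ v) :
    ∃ b : OrthonormalBasis (Fin (m + 1)) ℝ V, ⇑b = v := by
  have hc : Fintype.card (Fin (m + 1)) = finrank ℝ V := by
    rw [Fintype.card_fin, Fact.out (p := finrank ℝ V = m + 1)]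
  have h := hv.linearIndependent.span_eq_top_of_card_eq_finrank hc
  exact ⟨OrthonormalBasis.mk hv h.ge, OrthonormalBasis.coe_mk hv h.ge⟩

theorem exists_orthonormalBasis_cons {u : V} (hu : ‖u‖ = 1) {e : Fin m → V} (he : Orthonormal ℝ e)
    (hue : ∀ j, ⟪u, e j⟫ = 0) :
    ∃ b : OrthonormalBasis (Fin (m + 1)) ℝ V, b 0 = u ∧ ∀ j : Fin m, b j.succ = e j := by
  have : Orthonormal ℝ (Fin.cons u e : Fin (m + 1) → V) := by
    rw [orthonormal_iff_ite] at he ⊢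
    intro i j
    refine Fin.cases ?_ (fun i => ?_) i <;> refine Fin.cases ?_ (fun j => ?_) j
    · simp [hu]
    · simp [hue, (Fin.succ_ne_zero j).symm]
    · simp [real_inner_comm, hue]
    · simpa using he i j
  obtain ⟨b, hb⟩ := exists_orthonormalBasis_coe_eq this
  exact ⟨b, by simp [hb], fun j => by simp [hb]⟩

variable [FiniteDimensional ℝ V]

/-- At a point of differentiability of the metric projection, the outer normal and suitable
eigenvectors of the derivative form an orthonormal basis; all eigenvalues lie in `[0, 1]`. -/
theorem exists_eigenframe {K : ConvexBody V} {y : V} (hy : 0 < infDist y (K : Set V))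
    {L : V →L[ℝ] V} (hL : HasFDerivAt (footPoint K) L y) :
    ∃ (b : OrthonormalBasis (Fin (m + 1)) ℝ V) (l : Fin m → ℝ), b 0 = outerNormal K y ∧
      (∀ j, L (b j.succ) = l j • b j.succ) ∧ ∀ j, 0 ≤ l j ∧ l j ≤ 1 := by
  set u := outerNormal K y
  have hu : ‖u‖ = 1 := norm_outerNormal K hy
  have hu0 : u ≠ 0 := by rintro h; simp [h] at hu
  have hf : finrank ℝ (ℝ ∙ u)ᗮ = m := Submodule.finrank_orthogonal_span_singleton (n := m) hu0
  have hinv : ∀ x ∈ (ℝ ∙ u)ᗮ, (L : V →ₗ[ℝ] V) x ∈ (ℝ ∙ u)ᗮ := by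
    intro x _
    rw [Submodule.mem_orthogonal_singleton_iff_inner_left]
    change ⟪L x, u⟫ = 0
    rw [inner_fderiv_footPoint_comm hL, fderiv_footPoint_outerNormal hL, inner_zero_right]
  set T := (L : V →ₗ[ℝ] V).restrict hinv
  have hT : T.IsSymmetric := fun x z => inner_fderiv_footPoint_comm hL (x : V) (z : V)
  set e := hT.eigenvectorBasis hf
  obtain ⟨b, hb0, hb⟩ := exists_orthonormalBasis_cons (m := m) hu
    (e := fun j => (e j : V)) (e.orthonormal.comp_linearIsometry (ℝ ∙ u)ᗮ.subtypeₗᵢ)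
    (fun j => Submodule.mem_orthogonal_singleton_iff_inner_right.1 (e j).2)
  have heig : ∀ j, L (b j.succ) = hT.eigenvalues hf j • b j.succ := by
    intro j
    have := congrArg (Subtype.val) (hT.apply_eigenvectorBasis hf j)
    rw [hb]
    exact this
  refine ⟨b, hT.eigenvalues hf, hb0, heig, fun j => ?_⟩
  have h := norm_fderiv_footPoint_sq_le hL (b j.succ)
  rw [heig, norm_smul, inner_smul_left, b.norm_eq_one, real_inner_self_eq_norm_sq, b.norm_eq_one,
    Real.norm_eq_abs] at h
  simp only [mul_one, sq_abs, one_pow, conj_trivial] at h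
  constructor <;> nlinarith

/-- The value on the orthonormal basis `frame V m` of the `(m + 1)`-form `⟪u, ·⟫ ∧ L^* η_u`. -/
def formDensity (η : InvariantForm V m) (u : sphere (0 : V) 1) (L : V →L[ℝ] V × V) : ℝ :=
  ∑ i : Fin (m + 1), (-1) ^ (i : ℕ) * ⟪(u : V), frame V m i⟫ *
    η.toFun u fun j => L (frame V m (i.succAbove j))

/-- An alternating form of top degree is determined by its value on one basis. On a basis that
starts with `u` only one summand of `formDensity` is left, since `⟪u, ·⟫` kills the other basis
vectors. -/
theorem formDensity_eq_det_mul (η : InvariantForm V m) {u : sphere (0 : V) 1}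
    (L : V →L[ℝ] V × V) (b : OrthonormalBasis (Fin (m + 1)) ℝ V) (hb : b 0 = u) :
    formDensity η u L = b.toBasis.det (frame V m) * η.toFun u fun j => L (b j.succ) := by
  set f : V →ₗ[ℝ] V [⋀^Fin m]→ₗ[ℝ] ℝ := (innerₗ V (u : V)).smulRight
    ((η.toFun u).toAlternatingMap.compLinearMap (L : V →ₗ[ℝ] V × V)) with hf
  have key : ∀ v : Fin (m + 1) → V, AlternatingMap.alternatizeUncurryFin f v =
      ∑ i : Fin (m + 1), (-1) ^ (i : ℕ) * ⟪(u : V), v i⟫ *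
        η.toFun u fun j => L (v (i.succAbove j)) := by
    intro v
    rw [AlternatingMap.alternatizeUncurryFin_apply]
    refine Finset.sum_congr rfl fun i _ => ?_
    simp [hf, mul_assoc]
    exact Or.inl rfl
  have h1 := congrArg (fun g => g (frame V m))
    ((AlternatingMap.alternatizeUncurryFin f).eq_smul_basis_det b.toBasis)
  simp only [AlternatingMap.smul_apply, smul_eq_mul] at h1
  rw [formDensity, ← key, h1, key, mul_comm]
  congr 1
  rw [Fin.sum_univ_succ, Finset.sum_eq_zero]
  · simp [← hb, b.norm_eq_one]
  · intro i _
    simp [← hb, b.inner_eq_zero (Fin.succ_ne_zero i).symm]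

/-- The density of the form `η` over the part of a normal cycle with normal `u` whose tangent space
is `E × (E + ℝ u)ᗮ`, as for a polytope with a face parallel to `E`. -/
def flatDensity (η : InvariantForm V m) (E : Submodule ℝ V) (u : sphere (0 : V) 1) : ℝ :=
  formDensity η u (E.starProjection.prod (ContinuousLinearMap.id ℝ V - E.starProjection -
    (innerSL ℝ (u : V)).smulRight (u : V)))

theorem flatDensity_span_eq (η : InvariantForm V m) {u : sphere (0 : V) 1}
    (b : OrthonormalBasis (Fin (m + 1)) ℝ V) (hb : b 0 = u) (I : Finset (Fin m)) :
    flatDensity η (Submodule.span ℝ ((fun j : Fin m => b j.succ) '' I)) u =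
      b.toBasis.det (frame V m) *
        η.toFun u fun j => if j ∈ I then (b j.succ, 0) else (0, b j.succ) := by
  rw [flatDensity, formDensity_eq_det_mul η _ b hb]
  congr 2
  funext j
  have h0 : ⟪(u : V), b j.succ⟫ = 0 := by
    rw [← hb, b.inner_eq_zero (Fin.succ_ne_zero j).symm]
  split_ifs with hj
  · have : (Submodule.span ℝ ((fun j : Fin m => b j.succ) '' I)).starProjection (b j.succ) =
        b j.succ := Submodule.starProjection_eq_self_iff.2
          (Submodule.subset_span ⟨j, hj, rfl⟩)
    simp [this, h0]
  · have : (Submodule.span ℝ ((fun j : Fin m => b j.succ) '' I)).starProjection (b j.succ) = 0 := by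
      rw [Submodule.starProjection_apply_eq_zero_iff, Submodule.mem_orthogonal]
      intro x hx
      induction hx using Submodule.span_induction with
      | mem x hx =>
        obtain ⟨i, hi, rfl⟩ := hx
        exact b.inner_eq_zero fun h => hj (Fin.succ_injective _ h ▸ hi)
      | zero => simp
      | add x z _ _ hx hz => rw [inner_add_left, hx, hz, add_zero]
      | smul c x _ hx => rw [inner_smul_left, hx, mul_zero]
    simp [this, h0]

/-- Multilinear expansion of the density when `L` is diagonal in both components. -/
theorem formDensity_eq_sum (η : InvariantForm V m) {u : sphere (0 : V) 1} (L : V →L[ℝ] V × V)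
    (b : OrthonormalBasis (Fin (m + 1)) ℝ V) (hb : b 0 = u) (l r : Fin m → ℝ)
    (hL : ∀ j : Fin m, L (b j.succ) = (l j • b j.succ, r j • b j.succ)) :
    formDensity η u L = ∑ I : Finset (Fin m), (∏ j ∈ I, l j) * (∏ j ∈ Iᶜ, r j) *
      flatDensity η (Submodule.span ℝ ((fun j : Fin m => b j.succ) '' I)) u := by
  rw [formDensity_eq_det_mul η _ b hb]
  have e1 : (fun j : Fin m => L (b j.succ)) = (fun j => l j • ((b j.succ, 0) : V × V)) +
      fun j => r j • ((0, b j.succ) : V × V) := by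
    funext j
    simp [hL]
  have e2 := (η.toFun u).toMultilinearMap.map_add_univ (fun j => l j • ((b j.succ, 0) : V × V))
      (fun j => r j • ((0, b j.succ) : V × V))
  rw [e1]
  change _ * (η.toFun u).toMultilinearMap _ = _
  rw [e2, Finset.mul_sum]
  refine Finset.sum_congr rfl fun I _ => ?_
  have e3 : I.piecewise (fun j => l j • ((b j.succ, 0) : V × V))
      (fun j => r j • ((0, b j.succ) : V × V)) = fun j => (if j ∈ I then l j else r j) •
        (if j ∈ I then ((b j.succ, 0) : V × V) else (0, b j.succ)) := by
    funext j
    by_cases hj : j ∈ I <;> simp [hj]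
  rw [e3, MultilinearMap.map_smul_univ, flatDensity_span_eq η b hb, Finset.prod_ite]
  have e4 : (Finset.univ.filter fun j => j ∈ I) = I := by ext; simp
  have e5 : (Finset.univ.filter fun j => j ∉ I) = Iᶜ := by ext; simp
  rw [e4, e5, smul_eq_mul]
  change _ * (_ * η.toFun u _) = _
  ring

theorem shellDensity_eq_formDensity (η : InvariantForm V m) (K : ConvexBody V) (y : shell K) :
    shellDensity η K y = formDensity η (shellToBundle K y).2
      (fderiv ℝ (fun z => (footPoint K z, outerNormal K z)) y) := rfl

/-- The density of `η` over the shell, in terms of the eigenvalues `l` of the derivative of the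
metric projection: the derivative of the outer normal has the eigenvalues `(1 - l j) / d`. -/
theorem shellDensity_eq_sum (η : InvariantForm V m) {K : ConvexBody V} (y : shell K)
    {L : V →L[ℝ] V} (hL : HasFDerivAt (footPoint K) L y)
    (b : OrthonormalBasis (Fin (m + 1)) ℝ V) (l : Fin m → ℝ) (hb : b 0 = outerNormal K y)
    (hl : ∀ j, L (b j.succ) = l j • b j.succ) :
    shellDensity η K y = ∑ I : Finset (Fin m), (∏ j ∈ I, l j) *
      (∏ j ∈ Iᶜ, (infDist (y : V) (K : Set V))⁻¹ * (1 - l j)) *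
      flatDensity η (Submodule.span ℝ ((fun j : Fin m => b j.succ) '' I))
        (shellToBundle K y).2 := by
  have hy : 0 < infDist (y : V) (K : Set V) := one_pos.trans y.2.1
  rw [shellDensity_eq_formDensity, (hasFDerivAt_footPoint_prod_outerNormal hy hL).fderiv]
  refine formDensity_eq_sum η _ b hb l _ fun j => ?_
  have h0 : ⟪outerNormal K y, b j.succ⟫ = 0 := by
    rw [← hb, b.inner_eq_zero (Fin.succ_ne_zero j).symm]
  simp [hl, h0, sub_smul, mul_smul, smul_sub]

end Form

/-! ### Determinant expansion and curvature densities -/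

/-- Comparison of the coefficients of two polynomials that agree on the positive reals. -/
theorem eq_of_forall_sum_pow_mul_eq {N : ℕ} {a b : ℕ → ℝ}
    (h : ∀ s : ℝ, 0 < s → ∑ k ∈ Finset.range (N + 1), s ^ (N - k) * a k =
      ∑ k ∈ Finset.range (N + 1), s ^ (N - k) * b k) {k : ℕ} (hk : k ≤ N) : a k = b k := by
  set P : (ℕ → ℝ) → Polynomial ℝ := fun c => ∑ k ∈ Finset.range (N + 1),
    Polynomial.monomial (N - k) (c k) with hP
  have hcoeff : ∀ c : ℕ → ℝ, (P c).coeff (N - k) = c k := by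
    intro c
    simp only [hP, Polynomial.finsetSum_coeff, Polynomial.coeff_monomial]
    rw [Finset.sum_eq_single k]
    · simp
    · intro j hj hjk
      rw [if_neg]
      have := Finset.mem_range.1 hj
      omega
    · intro hk'
      exact absurd (Finset.mem_range.2 (by omega)) hk'
  have heq : P a = P b := by
    refine Polynomial.eq_of_infinite_eval_eq _ _ ((Ioi_infinite (0 : ℝ)).mono fun s hs => ?_)
    simpa [hP, Polynomial.eval_finsetSum, mul_comm] using h s hs
  rw [← hcoeff a, heq, hcoeff]

theorem det_add_smul_eq_prod {m : ℕ} {L : V →L[ℝ] V} (b : OrthonormalBasis (Fin (m + 1)) ℝ V)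
    (l : Fin m → ℝ) (h0 : L (b 0) = 0) (hl : ∀ j, L (b j.succ) = l j • b j.succ) (s : ℝ) :
    LinearMap.det ((L + s • (ContinuousLinearMap.id ℝ V - L) : V →L[ℝ] V) : V →ₗ[ℝ] V) =
      s * ∏ j, (l j + s * (1 - l j)) := by
  rw [← LinearMap.det_toMatrix b.toBasis]
  have e1 : LinearMap.toMatrix b.toBasis b.toBasis
      ((L + s • (ContinuousLinearMap.id ℝ V - L) : V →L[ℝ] V) : V →ₗ[ℝ] V) =
      Matrix.diagonal (Fin.cons s fun j => l j + s * (1 - l j)) := by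
    ext i j
    rw [LinearMap.toMatrix_apply, Matrix.diagonal_apply]
    have hb := orthonormal_iff_ite.1 b.orthonormal
    simp only [OrthonormalBasis.coe_toBasis, ContinuousLinearMap.coe_coe, add_apply, smul_apply,
      sub_apply, ContinuousLinearMap.id_apply, OrthonormalBasis.coe_toBasis_repr_apply,
      OrthonormalBasis.repr_apply_apply]
    refine Fin.cases ?_ (fun j => ?_) j
    · simp only [h0, inner_add_right, inner_smul_right, inner_sub_right, hb, inner_zero_right]
      split_ifs with hij
      · rw [hij]; simp
      · simp
    · simp only [hl, inner_add_right, inner_smul_right, inner_sub_right, hb]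
      split_ifs with hij
      · rw [hij]; simp
      · simp
  rw [e1, Matrix.det_diagonal, Fin.prod_univ_succ]
  simp

section Curvature

variable [FiniteDimensional ℝ V] {m : ℕ} [Fact (finrank ℝ V = m + 1)]

/-- The rows of the matrix of an endomorphism in the basis `frame V m`. -/
def frameRow (L : V →L[ℝ] V) (i : Fin (m + 1)) : Fin (m + 1) → ℝ :=
  fun j => ⟪frame V m i, L (frame V m j)⟫

variable (m) in
/-- The coefficient of `s ^ (m + 1 - k)` in `det (L + s (1 - L))`. For the derivative `L` of the
metric projection it is the density of the `k`-th curvature measure. -/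
def curvatureCoeff (k : ℕ) (L : V →L[ℝ] V) : ℝ :=
  ∑ I ∈ Finset.univ.filter (fun I : Finset (Fin (m + 1)) => I.card = k),
    (Matrix.of fun i => if i ∈ I then frameRow L i
      else frameRow (ContinuousLinearMap.id ℝ V - L) i).det

theorem continuous_curvatureCoeff (k : ℕ) :
    Continuous (curvatureCoeff m k : (V →L[ℝ] V) → ℝ) := by
  refine continuous_finsetSum _ fun I _ => Continuous.matrix_det (continuous_matrix fun i j => ?_)
  by_cases hi : i ∈ I
  · simp only [Matrix.of_apply, hi, if_true, frameRow]
    fun_prop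
  · simp only [Matrix.of_apply, hi, if_false, frameRow]
    fun_prop

/-- Expansion of the determinant, as a multilinear function of the rows, in powers of `s`. -/
theorem det_add_smul_eq_sum (L : V →L[ℝ] V) (s : ℝ) :
    LinearMap.det ((L + s • (ContinuousLinearMap.id ℝ V - L) : V →L[ℝ] V) : V →ₗ[ℝ] V) =
      ∑ k ∈ Finset.range (m + 2), s ^ (m + 1 - k) * curvatureCoeff m k L := by
  rw [← LinearMap.det_toMatrix (frame V m).toBasis]
  have e1 : LinearMap.toMatrix (frame V m).toBasis (frame V m).toBasis
      ((L + s • (ContinuousLinearMap.id ℝ V - L) : V →L[ℝ] V) : V →ₗ[ℝ] V) =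
      Matrix.of ((frameRow L : Fin (m + 1) → Fin (m + 1) → ℝ) +
        fun i => s • frameRow (ContinuousLinearMap.id ℝ V - L) i) := by
    ext i j
    rw [LinearMap.toMatrix_apply]
    simp only [OrthonormalBasis.coe_toBasis, OrthonormalBasis.coe_toBasis_repr_apply,
      OrthonormalBasis.repr_apply_apply, Matrix.of_apply, Pi.add_apply, Pi.smul_apply, frameRow,
      smul_eq_mul, ContinuousLinearMap.coe_coe, add_apply, smul_apply, inner_add_right,
      inner_smul_right]
  have e0 : ∀ A : Fin (m + 1) → Fin (m + 1) → ℝ, (Matrix.of A).det =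
      (Matrix.detRowAlternating (R := ℝ) (n := Fin (m + 1))).toMultilinearMap A := fun _ => rfl
  rw [e1, e0, MultilinearMap.map_add_univ]
  have e2 : ∀ I : Finset (Fin (m + 1)),
      (Matrix.detRowAlternating (R := ℝ) (n := Fin (m + 1))).toMultilinearMap
        (I.piecewise (frameRow L) fun i => s • frameRow (ContinuousLinearMap.id ℝ V - L) i) =
      s ^ (m + 1 - I.card) * (Matrix.of fun i => if i ∈ I then frameRow L i
        else frameRow (ContinuousLinearMap.id ℝ V - L) i).det := by
    intro I
    have e3 : (I.piecewise (frameRow L) fun i =>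
        s • frameRow (ContinuousLinearMap.id ℝ V - L) i) =
        fun i => (if i ∈ I then 1 else s) • (if i ∈ I then frameRow L i
          else frameRow (ContinuousLinearMap.id ℝ V - L) i) := by
      funext i
      by_cases hi : i ∈ I <;> simp [hi]
    rw [e3, MultilinearMap.map_smul_univ, Finset.prod_ite]
    have e4 : (Finset.univ.filter fun j => j ∉ I) = Iᶜ := by ext; simp
    rw [e4, Finset.prod_const_one, one_mul, Finset.prod_const, Finset.card_compl, Fintype.card_fin,
      e0, smul_eq_mul]
  simp only [e2]
  rw [← Finset.sum_fiberwise_of_maps_to (g := Finset.card) (t := Finset.range (m + 2))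
    (fun I _ => Finset.mem_range.2 (Nat.lt_succ_of_le (by simpa using Finset.card_le_univ I)))]
  refine Finset.sum_congr rfl fun k _ => ?_
  rw [curvatureCoeff, Finset.mul_sum]
  refine Finset.sum_congr rfl fun I hI => ?_
  rw [(Finset.mem_filter.1 hI).2]

/-- In terms of eigenvalues, the coefficients of `det (L + s (1 - L))` are sums over the sets of `k`
directions of `∏ l j ∏ (1 - l j)`. -/
theorem curvatureCoeff_eq {L : V →L[ℝ] V} (b : OrthonormalBasis (Fin (m + 1)) ℝ V)
    (l : Fin m → ℝ) (h0 : L (b 0) = 0) (hl : ∀ j, L (b j.succ) = l j • b j.succ) {k : ℕ}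
    (hk : k ≤ m + 1) :
    curvatureCoeff m k L = ∑ I ∈ Finset.univ.filter (fun I : Finset (Fin m) => I.card = k),
      (∏ j ∈ I, l j) * ∏ j ∈ Iᶜ, (1 - l j) := by
  refine eq_of_forall_sum_pow_mul_eq (N := m + 1) (a := fun k => curvatureCoeff m k L)
    (b := fun k => ∑ I ∈ Finset.univ.filter (fun I : Finset (Fin m) => I.card = k),
      (∏ j ∈ I, l j) * ∏ j ∈ Iᶜ, (1 - l j)) (fun s _ => ?_) hk
  rw [← det_add_smul_eq_sum, det_add_smul_eq_prod b l h0 hl, Finset.prod_add, Finset.mul_sum,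
    Finset.powerset_univ]
  rw [← Finset.sum_fiberwise_of_maps_to (g := Finset.card) (t := Finset.range (m + 1 + 1))
    (fun I _ => Finset.mem_range.2 (by
      have := Finset.card_le_univ I
      rw [Fintype.card_fin] at this; omega))]
  refine Finset.sum_congr rfl fun k _ => ?_
  rw [Finset.mul_sum]
  refine Finset.sum_congr rfl fun I hI => ?_
  have hc := Finset.card_le_univ I
  rw [Fintype.card_fin] at hc
  rw [Finset.prod_mul_distrib, Finset.prod_const, ← (Finset.mem_filter.1 hI).2,
    ← Finset.compl_eq_univ_sdiff, Finset.card_compl, Fintype.card_fin, Nat.sub_add_comm hc,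
    pow_succ]
  ring

theorem curvatureCoeff_nonneg {L : V →L[ℝ] V} (b : OrthonormalBasis (Fin (m + 1)) ℝ V)
    (l : Fin m → ℝ) (h0 : L (b 0) = 0) (hl : ∀ j, L (b j.succ) = l j • b j.succ)
    (h01 : ∀ j, 0 ≤ l j ∧ l j ≤ 1) {k : ℕ} (hk : k ≤ m + 1) : 0 ≤ curvatureCoeff m k L := by
  rw [curvatureCoeff_eq b l h0 hl hk]
  exact Finset.sum_nonneg fun I _ => mul_nonneg (Finset.prod_nonneg fun j _ => (h01 j).1)
    (Finset.prod_nonneg fun j _ => sub_nonneg.2 (h01 j).2)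

theorem curvatureCoeff_top {L : V →L[ℝ] V} (b : OrthonormalBasis (Fin (m + 1)) ℝ V)
    (l : Fin m → ℝ) (h0 : L (b 0) = 0) (hl : ∀ j, L (b j.succ) = l j • b j.succ) :
    curvatureCoeff m (m + 1) L = 0 := by
  rw [curvatureCoeff_eq b l h0 hl le_rfl]
  refine Finset.sum_eq_zero fun I hI => ?_
  have h1 := Finset.card_le_univ I
  have h2 := (Finset.mem_filter.1 hI).2
  rw [Fintype.card_fin] at h1
  omega

end Curvature

/-! ### Scaling of the distance and the area formula -/

theorem _root_.LipschitzOnWith.euclideanHausdorffMeasure_image_le {X Y : Type*} [EMetricSpace X]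
    [EMetricSpace Y] [MeasurableSpace X] [BorelSpace X] [MeasurableSpace Y] [BorelSpace Y]
    {C : ℝ≥0} {f : X → Y} {s : Set X} (h : LipschitzOnWith C f s) (d : ℕ) :
    μHE[d] (f '' s) ≤ (C : ℝ≥0∞) ^ d * μHE[d] s := by
  have h1 := h.hausdorffMeasure_image_le (d := d) (by positivity)
  rw [ENNReal.rpow_natCast] at h1
  simp only [Measure.euclideanHausdorffMeasure_def, Measure.smul_apply, ENNReal.smul_def,
    smul_eq_mul]
  rw [mul_left_comm]
  gcongr

/-- The scaling of the distance from `K` by the factor `s`. -/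
def rayScaling (K : ConvexBody V) (s : ℝ) (y : V) : V :=
  footPoint K y + s • (y - footPoint K y)

theorem rayScaling_rayScaling (K : ConvexBody V) {s : ℝ} (hs : 0 ≤ s) (r : ℝ) (y : V) :
    rayScaling K r (rayScaling K s y) = rayScaling K (r * s) y := by
  rw [rayScaling, rayScaling, footPoint_ray K y hs, add_sub_cancel_left, smul_smul, rayScaling]

theorem rayScaling_one (K : ConvexBody V) (y : V) : rayScaling K 1 y = y := by
  simp [rayScaling]

theorem rayScaling_image_localParallelSet (K : ConvexBody V) {s : ℝ} (ε : ℝ) (hs : 0 < s)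
    (A : Set (sphere (0 : V) 1)) :
    rayScaling K s '' localParallelSet K ε A = localParallelSet K (s * ε) A := by
  have key : ∀ {s ε : ℝ}, 0 < s → MapsTo (rayScaling K s) (localParallelSet K ε A)
      (localParallelSet K (s * ε) A) := by
    intro s ε hs y hy
    change _ ∧ _ ∧ _
    rw [rayScaling, outerNormal_ray K y hs, infDist_ray K y hs.le]
    exact ⟨mul_pos hs hy.1, mul_le_mul_of_nonneg_left hy.2.1 hs.le, hy.2.2⟩
  refine Subset.antisymm (key hs).image_subset fun y hy => ?_
  refine ⟨rayScaling K s⁻¹ y, ?_, ?_⟩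
  · have := key (inv_pos.2 hs) hy
    rwa [inv_mul_cancel_left₀ hs.ne'] at this
  · rw [rayScaling_rayScaling K (inv_nonneg.2 hs.le), mul_inv_cancel₀ hs.ne', rayScaling_one]

theorem injective_rayScaling (K : ConvexBody V) {s : ℝ} (hs : 0 < s) :
    Function.Injective (rayScaling K s) :=
  Function.LeftInverse.injective (g := rayScaling K s⁻¹) fun y => by
    rw [rayScaling_rayScaling K hs.le, inv_mul_cancel₀ hs.ne', rayScaling_one]

theorem hasFDerivAt_rayScaling {K : ConvexBody V} {y : V} {L : V →L[ℝ] V}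
    (hL : HasFDerivAt (footPoint K) L y) (s : ℝ) :
    HasFDerivAt (rayScaling K s) (L + s • (ContinuousLinearMap.id ℝ V - L)) y :=
  hL.add (((hasFDerivAt_id y).sub hL).const_smul s)

theorem lipschitzWith_rayScaling (K : ConvexBody V) (s : ℝ) :
    LipschitzWith (1 + ‖s‖₊ * (1 + 1)) (rayScaling K s) :=
  (lipschitzWith_footPoint K).add
    ((lipschitzWith_smul s).comp (LipschitzWith.id.sub (lipschitzWith_footPoint K)))

section Measurability

variable [MeasurableSpace V] [BorelSpace V]

theorem measurable_footPoint (K : ConvexBody V) : Measurable (footPoint K) :=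
  (lipschitzWith_footPoint K).continuous.measurable

variable [FiniteDimensional ℝ V]

theorem measurable_outerNormal (K : ConvexBody V) : Measurable (outerNormal K) :=
  (measurable_infDist.inv).smul (measurable_id.sub (measurable_footPoint K))

theorem measurableSet_localParallelSet (K : ConvexBody V) (ε : ℝ) {A : Set (sphere (0 : V) 1)}
    (hA : MeasurableSet A) : MeasurableSet (localParallelSet K ε A) :=
  (measurableSet_lt measurable_const measurable_infDist).inter
    ((measurableSet_le measurable_infDist measurable_const).inter (measurable_outerNormal K
      ((MeasurableEmbedding.subtype_coe isClosed_sphere.measurableSet).measurableSet_image.2 hA)))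

theorem volume_infDist_le_lt_top (K : ConvexBody V) (ε : ℝ) :
    volume {y | infDist y (K : Set V) ≤ ε} < ⊤ := by
  obtain ⟨R, hR⟩ := K.isBounded.subset_closedBall 0
  refine ((isBounded_closedBall (x := (0 : V)) (r := R + ε)).subset fun y hy => ?_).measure_lt_top
  have h1 : ‖footPoint K y‖ ≤ R := by simpa using hR (footPoint_mem K y)
  have h2 : ‖y - footPoint K y‖ ≤ ε := (infDist_eq_norm K y).ge.trans hy
  rw [mem_closedBall_zero_iff]
  calc ‖y‖ = ‖footPoint K y + (y - footPoint K y)‖ := by rw [add_sub_cancel]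
    _ ≤ R + ε := (norm_add_le _ _).trans (add_le_add h1 h2)

theorem volume_localParallelSet_lt_top (K : ConvexBody V) (ε : ℝ) (A : Set (sphere (0 : V) 1)) :
    volume (localParallelSet K ε A) < ⊤ :=
  (measure_mono fun _ hy => hy.2.1).trans_lt (volume_infDist_le_lt_top K ε)

theorem ae_differentiableAt_footPoint (K : ConvexBody V) :
    ∀ᵐ y : V, DifferentiableAt ℝ (footPoint K) y :=
  (lipschitzWith_footPoint K).ae_differentiableAt

end Measurability

section Steiner

variable [FiniteDimensional ℝ V] {m : ℕ} [hm : Fact (finrank ℝ V = m + 1)]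

variable (m) in
/-- The outer normal as a map to the unit sphere, with an arbitrary value on the points of the
body itself. -/
def normalDirection (K : ConvexBody V) (y : V) : sphere (0 : V) 1 :=
  ⟨if 0 < infDist y (K : Set V) then outerNormal K y else frame V m 0, by
    split_ifs with h
    · exact outerNormal_mem_sphere K h
    · simp [(frame V m).norm_eq_one]⟩

theorem coe_normalDirection {K : ConvexBody V} {y : V} (hy : 0 < infDist y (K : Set V)) :
    (normalDirection m K y : V) = outerNormal K y := if_pos hy

theorem mem_localParallelSet {K : ConvexBody V} {ε : ℝ} {A : Set (sphere (0 : V) 1)} {y : V} :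
    y ∈ localParallelSet K ε A ↔
      0 < infDist y (K : Set V) ∧ infDist y (K : Set V) ≤ ε ∧ normalDirection m K y ∈ A := by
  refine and_congr_right fun hy => and_congr_right fun _ => ?_
  rw [← coe_normalDirection (m := m) hy]
  exact Subtype.val_injective.mem_set_image

variable (m) in
/-- The density of the `k`-th curvature measure; it is `curvatureCoeff` at the derivative of the
metric projection, and a value without meaning on the null set where this derivative does not
exist. -/
def curvatureDensity (K : ConvexBody V) (k : ℕ) (y : V) : ℝ :=
  curvatureCoeff m k (fderiv ℝ (footPoint K) y)

theorem exists_abs_curvatureDensity_le (K : ConvexBody V) (k : ℕ) :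
    ∃ C, ∀ y, |curvatureDensity m K k y| ≤ C := by
  obtain ⟨C, hC⟩ := (isCompact_closedBall (0 : V →L[ℝ] V) 1).exists_bound_of_continuousOn
    (continuous_curvatureCoeff (m := m) k).continuousOn
  refine ⟨C, fun y => hC _ ?_⟩
  simpa using norm_fderiv_le_of_lipschitz ℝ (x₀ := y) (lipschitzWith_footPoint K)

variable [MeasurableSpace V] [BorelSpace V]

theorem measurable_normalDirection (K : ConvexBody V) : Measurable (normalDirection m K) := by
  refine Measurable.subtype_mk (Measurable.ite ?_ (measurable_outerNormal K) measurable_const)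
  exact measurableSet_lt measurable_const measurable_infDist

theorem measurable_curvatureDensity (K : ConvexBody V) (k : ℕ) :
    Measurable (curvatureDensity m K k) :=
  (continuous_curvatureCoeff k).measurable.comp (measurable_fderiv ℝ _)

theorem integrableOn_curvatureDensity (K : ConvexBody V) (k : ℕ) {s : Set V}
    (hs : volume s ≠ ⊤) : IntegrableOn (curvatureDensity m K k) s := by
  obtain ⟨C, hC⟩ := exists_abs_curvatureDensity_le (m := m) K k
  have : IsFiniteMeasure (volume.restrict s) := isFiniteMeasure_restrict.2 hs
  exact Integrable.of_bound (measurable_curvatureDensity K k).aestronglyMeasurable C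
    (Eventually.of_forall hC)

theorem ae_curvatureDensity_nonneg (K : ConvexBody V) {k : ℕ} (hk : k ≤ m + 1) :
    ∀ᵐ y : V, 0 < infDist y (K : Set V) → 0 ≤ curvatureDensity m K k y := by
  filter_upwards [ae_differentiableAt_footPoint K] with y hy hd
  obtain ⟨b, l, hb, hl, h01⟩ := exists_eigenframe (m := m) hd hy.hasFDerivAt
  exact curvatureCoeff_nonneg b l
    (hb ▸ fderiv_footPoint_outerNormal hy.hasFDerivAt) hl h01 hk

theorem ae_curvatureDensity_top (K : ConvexBody V) :
    ∀ᵐ y : V, 0 < infDist y (K : Set V) → curvatureDensity m K (m + 1) y = 0 := by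
  filter_upwards [ae_differentiableAt_footPoint K] with y hy hd
  obtain ⟨b, l, hb, hl, h01⟩ := exists_eigenframe (m := m) hd hy.hasFDerivAt
  exact curvatureCoeff_top b l (hb ▸ fderiv_footPoint_outerNormal hy.hasFDerivAt) hl

/-- The area formula for the scaling of the distance from `K`. -/
theorem volume_localParallelSet_mul (K : ConvexBody V) {s ε : ℝ} (hs : 0 < s)
    {A : Set (sphere (0 : V) 1)} (hA : MeasurableSet A) :
    volume.real (localParallelSet K (s * ε) A) = ∑ k ∈ Finset.range (m + 1 + 1),
      s ^ (m + 1 - k) * ∫ y in localParallelSet K ε A, curvatureDensity m K k y := by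
  set M := localParallelSet K ε A with hMdef
  have hM : MeasurableSet M := measurableSet_localParallelSet K ε hA
  -- The points of nondifferentiability are a null set, and so is its image under a Lipschitz map.
  set D := {y : V | DifferentiableAt ℝ (footPoint K) y}
  have hD : MeasurableSet D := measurableSet_of_differentiableAt ℝ (footPoint K)
  have hDc : volume Dᶜ = 0 := ae_differentiableAt_footPoint K
  have hnull : volume (rayScaling K s '' (M \ D)) = 0 := by
    have h1 := (lipschitzWith_rayScaling K s).lipschitzOnWith.euclideanHausdorffMeasure_image_le
      (s := M \ D) (finrank ℝ V)
    have h2 : volume (M \ D) = 0 := measure_mono_null (fun y hy => hy.2) hDc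
    rw [InnerProductSpace.euclideanHausdorffMeasure_eq_volume, h2, mul_zero] at h1
    exact le_antisymm h1 (by positivity)
  have himg : volume (localParallelSet K (s * ε) A) =
      ∫⁻ y in M ∩ D, ENNReal.ofReal |(fderiv ℝ (footPoint K) y +
        s • (ContinuousLinearMap.id ℝ V - fderiv ℝ (footPoint K) y)).det| := by
    rw [lintegral_abs_det_fderiv_eq_addHaar_image volume (hM.inter hD) (f := rayScaling K s)
      (fun y hy => (hasFDerivAt_rayScaling hy.2.hasFDerivAt s).hasFDerivWithinAt)
      (injective_rayScaling K hs).injOn, ← rayScaling_image_localParallelSet K ε hs A,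
      ← hMdef]
    conv_lhs => rw [← inter_union_sdiff M D, image_union]
    refine le_antisymm ((measure_union_le _ _).trans ?_) (measure_mono subset_union_left)
    rw [hnull, add_zero]
  have hpos : ∀ᵐ y ∂volume.restrict (M ∩ D), 0 ≤ ∑ k ∈ Finset.range (m + 1 + 1),
      s ^ (m + 1 - k) * curvatureDensity m K k y := by
    refine (ae_restrict_iff' (hM.inter hD)).2 ?_
    have h1 : ∀ k ∈ Finset.range (m + 1 + 1), ∀ᵐ y : V, 0 < infDist y (K : Set V) →
        0 ≤ curvatureDensity m K k y := fun k hk =>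
      ae_curvatureDensity_nonneg K (Nat.lt_succ_iff.1 (Finset.mem_range.1 hk))
    filter_upwards [(Finset.eventually_all _).2 h1] with y hy hyM
    exact Finset.sum_nonneg fun k hk => mul_nonneg (by positivity) (hy k hk hyM.1.1)
  have hint : ∀ k, IntegrableOn (curvatureDensity m K k) M := fun k =>
    integrableOn_curvatureDensity K k (volume_localParallelSet_lt_top K ε A).ne
  have hMD : (M ∩ D : Set V) =ᵐ[volume] M := by
    filter_upwards [ae_differentiableAt_footPoint K] with y hy
    exact propext ⟨fun h => h.1, fun h => ⟨h, hy⟩⟩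
  have hsum : Integrable (fun y => ∑ k ∈ Finset.range (m + 1 + 1),
      s ^ (m + 1 - k) * curvatureDensity m K k y) (volume.restrict (M ∩ D)) :=
    integrable_finsetSum _ fun k _ => ((hint k).mono_set inter_subset_left).const_mul _
  calc volume.real (localParallelSet K (s * ε) A)
      = (∫⁻ y in M ∩ D, ENNReal.ofReal (∑ k ∈ Finset.range (m + 1 + 1),
          s ^ (m + 1 - k) * curvatureDensity m K k y)).toReal := by
        rw [measureReal_def, himg]
        congr 1
        refine lintegral_congr_ae ?_
        filter_upwards [hpos] with y hy
        rw [← abs_of_nonneg hy]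
        congr 2
        exact det_add_smul_eq_sum (fderiv ℝ (footPoint K) y) s
    _ = ∫ y in M ∩ D, ∑ k ∈ Finset.range (m + 1 + 1),
          s ^ (m + 1 - k) * curvatureDensity m K k y :=
        (integral_eq_lintegral_of_nonneg_ae hpos hsum.aestronglyMeasurable).symm
    _ = ∫ y in M, ∑ k ∈ Finset.range (m + 1 + 1),
          s ^ (m + 1 - k) * curvatureDensity m K k y := setIntegral_congr_set hMD
    _ = _ := by
        rw [integral_finsetSum _ fun k _ => (hint k).const_mul _]
        simp_rw [integral_const_mul]

end Steiner

/-! ### Curvature measures and classical area measures -/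

section CurvatureMeasure

variable [FiniteDimensional ℝ V] {m : ℕ} [hm : Fact (finrank ℝ V = m + 1)]
  [MeasurableSpace V] [BorelSpace V]

/-- Homogeneity in the radius `ε`: the scalings by `s` of the local parallel set of radius `ε` and
by `s ε` of the one of radius `1` have the same image, and the two area formulas agree for
all `s`. -/
theorem setIntegral_curvatureDensity_localParallelSet (K : ConvexBody V) {ε : ℝ} (hε : 0 < ε)
    {A : Set (sphere (0 : V) 1)} (hA : MeasurableSet A) {k : ℕ} (hk : k ≤ m + 1) :
    ∫ y in localParallelSet K ε A, curvatureDensity m K k y =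
      ε ^ (m + 1 - k) * ∫ y in localParallelSet K 1 A, curvatureDensity m K k y := by
  refine eq_of_forall_sum_pow_mul_eq (N := m + 1)
    (a := fun k => ∫ y in localParallelSet K ε A, curvatureDensity m K k y)
    (b := fun k => ε ^ (m + 1 - k) * ∫ y in localParallelSet K 1 A, curvatureDensity m K k y)
    (fun s hs => ?_) hk
  have h1 := volume_localParallelSet_mul (m := m) K (ε := ε) hs hA
  have h2 := volume_localParallelSet_mul (m := m) K (ε := 1) (mul_pos hs hε) hA
  rw [mul_one] at h2
  rw [← h1, h2]
  exact Finset.sum_congr rfl fun k _ => by rw [mul_pow, mul_assoc]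

theorem volume_localParallelSet_eq_sum (K : ConvexBody V) {ε : ℝ} (hε : 0 < ε)
    {A : Set (sphere (0 : V) 1)} (hA : MeasurableSet A) :
    volume.real (localParallelSet K ε A) = ∑ k ∈ Finset.range (m + 1),
      ε ^ (m + 1 - k) * ∫ y in localParallelSet K 1 A, curvatureDensity m K k y := by
  have h := volume_localParallelSet_mul (m := m) K (ε := 1) hε hA
  rw [mul_one, Finset.sum_range_succ] at h
  have h0 : ∫ y in localParallelSet K 1 A, curvatureDensity m K (m + 1) y = 0 := by
    refine setIntegral_eq_zero_of_ae_eq_zero ?_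
    filter_upwards [ae_curvatureDensity_top (m := m) K] with y hy hyM using hy hyM.1
  rw [h, h0, mul_zero, add_zero]

variable (m) in
/-- The `k`-th curvature measure: the push-forward under the outer normal of the curvature density
on the parallel set of radius `1`. It is the coefficient of `ε ^ (m + 1 - k)` in the volume of the
local parallel set of radius `ε`. -/
def curvatureMeasure (K : ConvexBody V) (k : ℕ) : SignedMeasure (sphere (0 : V) 1) :=
  ((volume.restrict (localParallelSet K 1 univ)).withDensityᵥ (curvatureDensity m K k)).map
    (normalDirection m K)

theorem curvatureMeasure_apply (K : ConvexBody V) (k : ℕ) {A : Set (sphere (0 : V) 1)}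
    (hA : MeasurableSet A) :
    curvatureMeasure m K k A = ∫ y in localParallelSet K 1 A, curvatureDensity m K k y := by
  rw [curvatureMeasure, VectorMeasure.map_apply _ (measurable_normalDirection K) hA,
    withDensityᵥ_apply (integrableOn_curvatureDensity K k
      (volume_localParallelSet_lt_top K 1 univ).ne) (measurable_normalDirection K hA),
    Measure.restrict_restrict (measurable_normalDirection K hA)]
  congr 2
  ext y
  simp only [mem_inter_iff, mem_preimage, mem_localParallelSet (m := m), mem_univ]
  tauto

theorem localSteinerFormula_curvatureMeasure (K : ConvexBody V) :
    LocalSteinerFormula K fun k : Fin (finrank ℝ V) =>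
      ((finrank ℝ V : ℝ) / (finrank ℝ V).choose k) • curvatureMeasure m K k := by
  intro ε hε A hA
  have hn := hm.out
  rw [volume_localParallelSet_eq_sum (m := m) K hε hA, Finset.mul_sum,
    ← Fin.sum_univ_eq_sum_range (fun k => ε ^ (m + 1 - k) *
      ∫ y in localParallelSet K 1 A, curvatureDensity m K k y) (m + 1)]
  refine Fintype.sum_equiv (finCongr hn.symm) _ _ fun k => ?_
  have hc : ((finrank ℝ V).choose (k : ℕ) : ℝ) ≠ 0 := by
    rw [hn]
    exact_mod_cast (Nat.choose_pos k.2.le).ne'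
  have hn0 : (finrank ℝ V : ℝ) ≠ 0 := by rw [hn]; positivity
  simp only [finCongr_apply, Fin.val_cast, smul_apply, smul_eq_mul]
  rw [curvatureMeasure_apply K k hA, show m + 1 - (k : ℕ) = finrank ℝ V - k by rw [hn]]
  field_simp

/-- The local Steiner formula determines the classical area measures, so any measures that satisfy
it are the classical ones. -/
theorem classicalAreaMeasure_eq (k : Fin (finrank ℝ V)) (K : ConvexBody V) :
    classicalAreaMeasure k K =
      ((finrank ℝ V : ℝ) / (finrank ℝ V).choose k) • curvatureMeasure m K k := by
  have hn := hm.out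
  set S : Fin (finrank ℝ V) → SignedMeasure (sphere (0 : V) 1) :=
    Classical.epsilon (LocalSteinerFormula K) with hS
  have hspec : LocalSteinerFormula K S :=
    Classical.epsilon_spec ⟨_, localSteinerFormula_curvatureMeasure (m := m) K⟩
  have hn0 : (finrank ℝ V : ℝ) ≠ 0 := by rw [hn]; positivity
  have hc : ((finrank ℝ V).choose (k : ℕ) : ℝ) ≠ 0 := by
    exact_mod_cast (Nat.choose_pos k.2.le).ne'
  refine VectorMeasure.ext fun A hA => ?_
  change S k A = _
  set a : ℕ → ℝ := fun j => if h : j < finrank ℝ V then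
    (1 / (finrank ℝ V : ℝ)) * ((finrank ℝ V).choose j * S ⟨j, h⟩ A) else 0 with ha
  set c : ℕ → ℝ := fun j => if j < m + 1 then
    ∫ y in localParallelSet K 1 A, curvatureDensity m K j y else 0 with hcdef
  have key := eq_of_forall_sum_pow_mul_eq (N := m + 1) (a := a) (b := c) (fun s hs => ?_)
    (k := k) (by rw [← hn]; exact k.2.le)
  · have hk : (k : ℕ) < m + 1 := by rw [← hn]; exact k.2
    simp only [ha, hcdef, k.2, hk, dif_pos, if_pos, Fin.eta] at key
    rw [smul_apply, smul_eq_mul, curvatureMeasure_apply K k hA, ← key]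
    field_simp
  · have h1 := hspec s hs A hA
    rw [volume_localParallelSet_eq_sum (m := m) K hs hA, Finset.mul_sum] at h1
    rw [Finset.sum_range_succ, Finset.sum_range_succ _ (m + 1)]
    have e1 : a (m + 1) = 0 := by simp [ha, hn]
    have e2 : c (m + 1) = 0 := by simp [hcdef]
    rw [e1, e2, mul_zero, add_zero, add_zero]
    have e3 : ∑ j ∈ Finset.range (m + 1), s ^ (m + 1 - j) * c j = ∑ j ∈ Finset.range (m + 1),
        s ^ (m + 1 - j) * ∫ y in localParallelSet K 1 A, curvatureDensity m K j y :=
      Finset.sum_congr rfl fun j hj => by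
        simp only [hcdef, if_pos (Finset.mem_range.1 hj)]
    rw [e3, h1, ← Fin.sum_univ_eq_sum_range (fun j => s ^ (m + 1 - j) * a j) (m + 1)]
    refine Fintype.sum_equiv (finCongr hn.symm) _ _ fun j => ?_
    have hj : (j : ℕ) < finrank ℝ V := by rw [hn]; exact j.2
    simp only [ha, hj, dif_pos, finCongr_apply, Fin.val_cast, ← hn]
    have : finCongr hn.symm j = ⟨(j : ℕ), hj⟩ := rfl
    simp only [finCongr_apply] at this
    rw [this]
    ring

theorem unitBallVolume_pos (d : ℕ) : 0 < unitBallVolume d :=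
  div_pos (Real.rpow_pos_of_pos Real.pi_pos _) (Real.Gamma_pos_of_pos (by positivity))

theorem Δ_eq (k : Fin (finrank ℝ V)) (K : ConvexBody V) :
    Δ k K = (unitBallVolume (finrank ℝ V - k))⁻¹ • curvatureMeasure m K k := by
  have hn0 : (finrank ℝ V : ℝ) ≠ 0 := by rw [hm.out]; positivity
  have hc : ((finrank ℝ V).choose (k : ℕ) : ℝ) ≠ 0 := by
    exact_mod_cast (Nat.choose_pos k.2.le).ne'
  have := (unitBallVolume_pos (finrank ℝ V - k)).ne'
  rw [Δ, classicalAreaMeasure_eq (m := m), smul_smul]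
  congr 1
  field_simp

/-- The integral of a curvature density against a power of the distance over a shell. By
homogeneity the push-forward of the curvature density by the distance has density
`(m + 1 - k) κ t ^ (m - k)`. -/
theorem setIntegral_shell_inv_pow_mul_curvatureDensity (K : ConvexBody V)
    {A : Set (sphere (0 : V) 1)} (hA : MeasurableSet A) {k : ℕ} (hk : k ≤ m) :
    ∫ y in shell K ∩ normalDirection m K ⁻¹' A,
      (infDist y (K : Set V))⁻¹ ^ (m - k) * curvatureDensity m K k y =
      (m + 1 - k : ℕ) * curvatureMeasure m K k A := by
  set q := curvatureDensity m K k with hq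
  set κ := ∫ y in localParallelSet K 1 A, q y with hκ
  have hM : ∀ ε, MeasurableSet (localParallelSet K ε A) := fun ε =>
    measurableSet_localParallelSet K ε hA
  have hq0 : ∀ ε, ∀ᵐ y ∂volume.restrict (localParallelSet K ε A), 0 ≤ q y := fun ε => by
    refine (ae_restrict_iff' (hM ε)).2 ?_
    filter_upwards [ae_curvatureDensity_nonneg (m := m) K (k := k) (by omega)] with y hy hyM
      using hy hyM.1
  have hκ0 : 0 ≤ κ := integral_nonneg_of_ae (hq0 1)
  have hF : ∀ ε, 0 < ε → ∫⁻ y in localParallelSet K ε A, ENNReal.ofReal (q y) =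
      ENNReal.ofReal (ε ^ (m + 1 - k) * κ) := by
    intro ε hε
    rw [← setIntegral_curvatureDensity_localParallelSet K hε hA (by omega),
      ofReal_integral_eq_lintegral_ofReal (integrableOn_curvatureDensity K k
        (volume_localParallelSet_lt_top K ε A).ne) (hq0 ε)]
  -- Both measures on `(0, 2]` give `(0, a]` the mass `κ a ^ (m + 1 - k)`.
  set μ : Measure ℝ := ((volume.restrict (localParallelSet K 2 A)).withDensity
    fun y => ENNReal.ofReal (q y)).map fun y => infDist y (K : Set V) with hμ
  set ν : Measure ℝ := (volume.restrict (Ioc 0 2)).withDensity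
    fun t => ENNReal.ofReal ((m + 1 - k : ℕ) * κ * t ^ (m - k)) with hν
  have hdm : Measurable fun y : V => infDist y (K : Set V) := measurable_infDist
  have hqm : Measurable fun y => ENNReal.ofReal (q y) :=
    (measurable_curvatureDensity K k).ennreal_ofReal
  have hμν : μ = ν := by
    have hfin : IsFiniteMeasure ((volume.restrict (localParallelSet K 2 A)).withDensity
        fun y => ENNReal.ofReal (q y)) := isFiniteMeasure_withDensity (by
      rw [hF 2 two_pos]; exact ENNReal.ofReal_ne_top)
    have hfin' : IsFiniteMeasure μ := by rw [hμ]; infer_instance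
    refine Measure.ext_of_Iic μ ν fun a => ?_
    have e1 : μ (Iic a) = ∫⁻ y in localParallelSet K (min a 2) A, ENNReal.ofReal (q y) := by
      rw [hμ, Measure.map_apply hdm measurableSet_Iic, withDensity_apply _ (hdm measurableSet_Iic),
        Measure.restrict_restrict (hdm measurableSet_Iic)]
      congr 2
      ext y
      simp only [localParallelSet, mem_inter_iff, mem_preimage, mem_Iic, mem_ofPred_eq, le_min_iff]
      tauto
    have e2 : ν (Iic a) = ∫⁻ t in Ioc 0 (min a 2),
        ENNReal.ofReal ((m + 1 - k : ℕ) * κ * t ^ (m - k)) := by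
      rw [hν, withDensity_apply _ measurableSet_Iic, Measure.restrict_restrict measurableSet_Iic]
      congr 2
      ext t
      simp only [mem_inter_iff, mem_Iic, mem_Ioc, le_min_iff]
      tauto
    rw [e1, e2]
    rcases le_or_gt (min a 2) 0 with h | h
    · have : localParallelSet K (min a 2) A = ∅ := by
        ext y
        simp only [localParallelSet, mem_ofPred_eq, mem_empty_iff_false, iff_false]
        rintro ⟨h1, h2, -⟩
        linarith
      rw [this, Ioc_eq_empty (not_lt.2 h)]
      simp
    · rw [hF _ h, ← ofReal_integral_eq_lintegral_ofReal]
      · rw [← intervalIntegral.integral_of_le h.le, intervalIntegral.integral_const_mul,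
          integral_pow]
        have : m + 1 - k = m - k + 1 := by omega
        congr 1
        rw [this]
        push_cast
        field_simp
        simp [mul_comm]
      · exact (Continuous.integrableOn_Ioc (by fun_prop))
      · refine (ae_restrict_iff' measurableSet_Ioc).2 (Eventually.of_forall fun t ht => ?_)
        have := ht.1.le
        positivity
  have hset : shell K ∩ normalDirection m K ⁻¹' A =
      localParallelSet K 2 A ∩ (fun y => infDist y (K : Set V)) ⁻¹' Ioo 1 2 := by
    ext y
    simp only [shell, mem_inter_iff, mem_preimage, mem_ofPred_eq, mem_localParallelSet (m := m),
      mem_Ioo]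
    constructor
    · rintro ⟨⟨h1, h2⟩, h3⟩
      exact ⟨⟨by linarith, h2.le, h3⟩, h1, h2⟩
    · rintro ⟨⟨_, _, h3⟩, h1, h2⟩
      exact ⟨⟨h1, h2⟩, h3⟩
  have e1 : ∫ t in Ioo 1 2, t⁻¹ ^ (m - k) ∂μ = ∫ y in shell K ∩ normalDirection m K ⁻¹' A,
      (infDist y (K : Set V))⁻¹ ^ (m - k) * q y := by
    rw [hset, hμ, setIntegral_map measurableSet_Ioo (by fun_prop) hdm.aemeasurable,
      inter_comm, ← Measure.restrict_restrict (hdm measurableSet_Ioo)]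
    have := setIntegral_withDensity_eq_setIntegral_toReal_smul
      (μ := volume.restrict (localParallelSet K 2 A)) hqm
      (Eventually.of_forall fun y => ENNReal.ofReal_lt_top)
      (fun y => (infDist y (K : Set V))⁻¹ ^ (m - k)) (hdm (measurableSet_Ioo (a := 1) (b := 2)))
    rw [this]
    refine setIntegral_congr_ae (hdm measurableSet_Ioo) ?_
    filter_upwards [hq0 2] with y hy _
    rw [ENNReal.toReal_ofReal hy, smul_eq_mul, mul_comm]
  have e2 : ∫ t in Ioo 1 2, t⁻¹ ^ (m - k) ∂ν = (m + 1 - k : ℕ) * κ := by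
    have hm' : Measurable fun t : ℝ => ENNReal.ofReal ((m + 1 - k : ℕ) * κ * t ^ (m - k)) := by
      fun_prop
    rw [hν, setIntegral_withDensity_eq_setIntegral_toReal_smul
      (μ := volume.restrict (Ioc (0 : ℝ) 2)) hm'
      (Eventually.of_forall fun y => ENNReal.ofReal_lt_top) _ measurableSet_Ioo,
      Measure.restrict_restrict measurableSet_Ioo,
      inter_eq_left.2 (show Ioo (1 : ℝ) 2 ⊆ Ioc 0 2 from
        fun t ht => ⟨by linarith [ht.1], ht.2.le⟩)]
    rw [setIntegral_congr_fun (g := fun _ => (m + 1 - k : ℕ) * κ) measurableSet_Ioo]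
    · norm_num
    · intro t ht
      have : 0 < t := by linarith [ht.1]
      simp only
      rw [ENNReal.toReal_ofReal (by positivity), smul_eq_mul, inv_pow]
      field_simp
  rw [curvatureMeasure_apply K k hA, ← hκ, ← e1, hμν, e2]

end CurvatureMeasure

/-! ### Normal cycles in terms of flat densities -/

theorem finrank_span_image_succ {m : ℕ} (b : OrthonormalBasis (Fin (m + 1)) ℝ V)
    (I : Finset (Fin m)) :
    finrank ℝ (Submodule.span ℝ ((fun j : Fin m => b j.succ) '' I)) = I.card := by
  have hli : LinearIndependent ℝ fun j : Fin m => b j.succ :=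
    b.orthonormal.linearIndependent.comp _ (Fin.succ_injective m)
  rw [image_eq_range, ← Fintype.card_coe I]
  exact finrank_span_eq_card (hli.comp ((↑) : I → Fin m) Subtype.val_injective)

theorem zero_mem_orthogonal_span_image_succ {m : ℕ} (b : OrthonormalBasis (Fin (m + 1)) ℝ V)
    (I : Finset (Fin m)) : b 0 ∈ (Submodule.span ℝ ((fun j : Fin m => b j.succ) '' I))ᗮ := by
  have h : Submodule.span ℝ ((fun j : Fin m => b j.succ) '' I) ≤ (ℝ ∙ b 0)ᗮ := by
    rw [Submodule.span_le]
    rintro _ ⟨j, -, rfl⟩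
    exact Submodule.mem_orthogonal_singleton_iff_inner_left.2
      (b.inner_eq_zero (Fin.succ_ne_zero j))
  exact (Submodule.mem_orthogonal _ _).2 fun v hv =>
    Submodule.mem_orthogonal_singleton_iff_inner_left.1 (h hv)

theorem measurableSet_shell [MeasurableSpace V] [BorelSpace V] (K : ConvexBody V) :
    MeasurableSet (shell K) :=
  (measurableSet_lt measurable_const measurable_infDist).inter
    (measurableSet_lt measurable_infDist measurable_const)

section NormalCycle

variable [FiniteDimensional ℝ V] {m : ℕ} [hm : Fact (finrank ℝ V = m + 1)]

theorem continuous_formDensity (η : InvariantForm V m) :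
    Continuous fun p : sphere (0 : V) 1 × (V →L[ℝ] V × V) => formDensity η p.1 p.2 := by
  have hη : Continuous η.toFun := η.smooth.continuous
  refine continuous_finsetSum _ fun i _ => ?_
  refine (by fun_prop : Continuous fun p : sphere (0 : V) 1 × (V →L[ℝ] V × V) =>
    (-1 : ℝ) ^ (i : ℕ) * ⟪(p.1 : V), frame V m i⟫).mul ?_
  exact (hη.comp continuous_fst).eval (by fun_prop)

theorem continuous_flatDensity (η : InvariantForm V m) (E : Submodule ℝ V) :
    Continuous (flatDensity η E) := by
  refine (continuous_formDensity η).comp (continuous_id.prodMk (continuous_clm_apply.2 fun w => ?_))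
  change Continuous fun u : sphere (0 : V) 1 =>
    (E.starProjection w, w - E.starProjection w - ⟪(u : V), w⟫ • (u : V))
  fun_prop

/-- The total extension to `V` of the density of a form over the shell. -/
def normalCycleDensity (η : InvariantForm V m) (K : ConvexBody V) (y : V) : ℝ :=
  formDensity η (normalDirection m K y) (fderiv ℝ (fun z => (footPoint K z, outerNormal K z)) y)

theorem normalDirection_eq_shellToBundle {K : ConvexBody V} (y : shell K) :
    normalDirection m K y = (shellToBundle K y).2 :=
  Subtype.ext (coe_normalDirection (one_pos.trans y.2.1))

theorem normalCycleDensity_coe (η : InvariantForm V m) {K : ConvexBody V} (y : shell K) :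
    normalCycleDensity η K y = shellDensity η K y := by
  rw [normalCycleDensity, normalDirection_eq_shellToBundle, shellDensity_eq_formDensity]

theorem exists_abs_formDensity_le (η : InvariantForm V m) (R : ℝ) :
    ∃ C, ∀ (u : sphere (0 : V) 1) (L : V →L[ℝ] V × V), ‖L‖ ≤ R → |formDensity η u L| ≤ C := by
  have : ProperSpace (V →L[ℝ] V × V) := FiniteDimensional.proper ℝ (V →L[ℝ] V × V)
  have hc : IsCompact ((univ : Set (sphere (0 : V) 1)) ×ˢ closedBall (0 : V →L[ℝ] V × V) R) :=
    isCompact_univ.prod (isCompact_closedBall _ _)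
  obtain ⟨C, hC⟩ := hc.exists_bound_of_continuousOn (continuous_formDensity η).continuousOn
  exact ⟨C, fun u L hL => hC (u, L) ⟨mem_univ _,
    (dist_zero_right (E := V →L[ℝ] V × V) L).trans_le hL⟩⟩

theorem exists_abs_normalCycleDensity_le (η : InvariantForm V m) (K : ConvexBody V) :
    ∃ C, ∀ y ∈ shell K, |normalCycleDensity η K y| ≤ C := by
  obtain ⟨C, hC⟩ := exists_abs_formDensity_le η 3
  refine ⟨C, fun y hy => ?_⟩
  suffices h : ‖fderiv ℝ (fun z => (footPoint K z, outerNormal K z)) y‖ ≤ 3 from hC _ _ h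
  by_cases h : DifferentiableAt ℝ (fun z => (footPoint K z, outerNormal K z)) y
  · have hd : 0 < infDist y (K : Set V) := one_pos.trans hy.1
    have hL := h.fst.hasFDerivAt
    simp only at hL
    set L := fderiv ℝ (footPoint K) y
    have hL1 : ‖L‖ ≤ 1 := by
      simpa using norm_fderiv_le_of_lipschitz ℝ (x₀ := y) (lipschitzWith_footPoint K)
    rw [(hasFDerivAt_footPoint_prod_outerNormal hd hL).fderiv, ContinuousLinearMap.opNorm_prod,
      Prod.norm_mk]
    refine max_le (hL1.trans (by norm_num)) ?_
    have h1 : ‖(infDist y (K : Set V))⁻¹‖ ≤ 1 := by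
      rw [norm_inv, Real.norm_of_nonneg hd.le]
      exact inv_le_one_of_one_le₀ hy.1.le
    have h2 : ‖(innerSL ℝ (outerNormal K y)).smulRight (outerNormal K y)‖ ≤ 1 := by
      rw [ContinuousLinearMap.norm_smulRight_apply, innerSL_apply_norm, norm_outerNormal K hd,
        one_mul]
    have h3 : ‖ContinuousLinearMap.id ℝ V - L -
        (innerSL ℝ (outerNormal K y)).smulRight (outerNormal K y)‖ ≤ 1 + 1 + 1 :=
      (norm_sub_le _ _).trans (add_le_add ((norm_sub_le _ _).trans
        (add_le_add ContinuousLinearMap.norm_id_le hL1)) h2)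
    rw [norm_smul]
    nlinarith [norm_nonneg (infDist y (K : Set V))⁻¹]
  · rw [fderiv_zero_of_not_differentiableAt h]
    exact (norm_zero (E := V →L[ℝ] V × V)).trans_le zero_le_three

variable [MeasurableSpace V] [BorelSpace V]

theorem volume_shell_lt_top (K : ConvexBody V) : volume (shell K) < ⊤ :=
  (measure_mono fun _ hy => hy.2.le).trans_lt (volume_infDist_le_lt_top K 2)

theorem measurable_normalCycleDensity (η : InvariantForm V m) (K : ConvexBody V) :
    Measurable (normalCycleDensity η K) :=
  (continuous_formDensity η).measurable.comp
    ((measurable_normalDirection K).prodMk (measurable_fderiv ℝ _))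

theorem integrableOn_normalCycleDensity (η : InvariantForm V m) (K : ConvexBody V) :
    IntegrableOn (normalCycleDensity η K) (shell K) := by
  obtain ⟨C, hC⟩ := exists_abs_normalCycleDensity_le η K
  have : IsFiniteMeasure (volume.restrict (shell K)) :=
    isFiniteMeasure_restrict.2 (volume_shell_lt_top K).ne
  exact Integrable.of_bound (measurable_normalCycleDensity η K).aestronglyMeasurable C
    ((ae_restrict_iff' (measurableSet_shell K)).2 (Eventually.of_forall hC))

/-- The measure of directions induced by the normal cycle, as an integral over a subset of `V`. -/
theorem normalCycle_apply (η : InvariantForm V m) (K : ConvexBody V)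
    {A : Set (sphere (0 : V) 1)} (hA : MeasurableSet A) :
    normalCycle η K (Prod.snd ⁻¹' A) =
      ∫ y in shell K ∩ normalDirection m K ⁻¹' A, normalCycleDensity η K y := by
  have hs := measurableSet_shell K
  have e1 : shellDensity η K = fun y : shell K => normalCycleDensity η K y :=
    funext fun y => (normalCycleDensity_coe η y).symm
  have hmeas : Measurable (shellToBundle K) := by
    refine ((measurable_footPoint K).comp measurable_subtype_coe).prodMk ?_
    have : (fun y : shell K => (shellToBundle K y).2) = fun y : shell K => normalDirection m K y :=
      funext fun y => (normalDirection_eq_shellToBundle y).symm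
    exact this ▸ (measurable_normalDirection K).comp measurable_subtype_coe
  have hint : Integrable (shellDensity η K) ((volume : Measure V).comap ((↑) : shell K → V)) := by
    rw [e1]
    exact (integrableOn_iff_comap_subtypeVal hs).1 (integrableOn_normalCycleDensity η K)
  have hA' : MeasurableSet (Prod.snd ⁻¹' A : Set (V × sphere (0 : V) 1)) := measurable_snd hA
  have hpre : shellToBundle K ⁻¹' (Prod.snd ⁻¹' A) =
      ((↑) : shell K → V) ⁻¹' (normalDirection m K ⁻¹' A) := by
    ext y
    simp only [mem_preimage, normalDirection_eq_shellToBundle]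
  rw [normalCycle, VectorMeasure.map_apply _ hmeas hA', withDensityᵥ_apply hint (hmeas hA'), e1,
    hpre, ← integral_indicator (measurable_subtype_coe (measurable_normalDirection K hA))]
  have := integral_subtype_comap (μ := (volume : Measure V)) hs
    ((normalDirection m K ⁻¹' A).indicator (normalCycleDensity η K))
  rw [setIntegral_indicator (measurable_normalDirection K hA)] at this
  rw [← this]
  rfl

/-- If the flat densities of a form depend on the dimension of the subspace alone, then the density
of the form over every normal cycle is a combination of curvature densities. -/
theorem ae_normalCycleDensity_eq_sum (η : InvariantForm V m) {γ : ℕ → ℝ}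
    (hγ : ∀ (E : Submodule ℝ V) (u : sphere (0 : V) 1), finrank ℝ E ≤ m → (u : V) ∈ Eᗮ →
      flatDensity η E u = γ (finrank ℝ E)) (K : ConvexBody V) :
    ∀ᵐ y : V, y ∈ shell K → normalCycleDensity η K y = ∑ k ∈ Finset.range (m + 1),
      γ k * ((infDist y (K : Set V))⁻¹ ^ (m - k) * curvatureDensity m K k y) := by
  filter_upwards [ae_differentiableAt_footPoint K] with y hy hs
  have hd : 0 < infDist y (K : Set V) := one_pos.trans hs.1
  have hL := hy.hasFDerivAt
  obtain ⟨b, l, hb, hl, -⟩ := exists_eigenframe (m := m) hd hL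
  have h0 : fderiv ℝ (footPoint K) y (b 0) = 0 := hb ▸ fderiv_footPoint_outerNormal hL
  have e1 := normalCycleDensity_coe η (⟨y, hs⟩ : shell K)
  rw [shellDensity_eq_sum η ⟨y, hs⟩ hL b l hb hl] at e1
  simp only at e1
  rw [e1, ← Finset.sum_fiberwise_of_maps_to (g := Finset.card) (t := Finset.range (m + 1))
    (fun I _ => Finset.mem_range.2 (Nat.lt_succ_of_le (by simpa using Finset.card_le_univ I)))]
  refine Finset.sum_congr rfl fun k hk => ?_
  have hk' : k ≤ m := Nat.lt_succ_iff.1 (Finset.mem_range.1 hk)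
  rw [curvatureDensity, curvatureCoeff_eq b l h0 hl (by omega), Finset.mul_sum, Finset.mul_sum]
  refine Finset.sum_congr rfl fun I hI => ?_
  have hcard : I.card = k := (Finset.mem_filter.1 hI).2
  have hrank := (finrank_span_image_succ b I).trans hcard
  have horth : ((shellToBundle K ⟨y, hs⟩).2 : V) ∈
      (Submodule.span ℝ ((fun j : Fin m => b j.succ) '' I))ᗮ :=
    (congrArg (· ∈ (Submodule.span ℝ ((fun j : Fin m => b j.succ) '' I))ᗮ) hb).mp
      (zero_mem_orthogonal_span_image_succ b I)
  rw [hγ _ _ (hrank.trans_le hk') horth, hrank, Finset.prod_mul_distrib, Finset.prod_const,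
    Finset.card_compl, Fintype.card_fin, hcard]
  ring

theorem normalCycle_eq_sum (η : InvariantForm V m) {γ : ℕ → ℝ}
    (hγ : ∀ (E : Submodule ℝ V) (u : sphere (0 : V) 1), finrank ℝ E ≤ m → (u : V) ∈ Eᗮ →
      flatDensity η E u = γ (finrank ℝ E)) (K : ConvexBody V) {A : Set (sphere (0 : V) 1)}
    (hA : MeasurableSet A) :
    normalCycle η K (Prod.snd ⁻¹' A) = ∑ k ∈ Finset.range (m + 1),
      γ k * ((m + 1 - k : ℕ) * curvatureMeasure m K k A) := by
  rw [normalCycle_apply η K hA, setIntegral_congr_ae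
    ((measurableSet_shell K).inter (measurable_normalDirection K hA))
    (g := fun y => ∑ k ∈ Finset.range (m + 1),
      γ k * ((infDist y (K : Set V))⁻¹ ^ (m - k) * curvatureDensity m K k y))]
  · rw [integral_finsetSum]
    · refine Finset.sum_congr rfl fun k hk => ?_
      rw [integral_const_mul, setIntegral_shell_inv_pow_mul_curvatureDensity K hA
        (Nat.lt_succ_iff.1 (Finset.mem_range.1 hk))]
    · intro k _
      refine Integrable.const_mul ?_ _
      have hint : IntegrableOn (curvatureDensity m K k) (shell K ∩ normalDirection m K ⁻¹' A) :=
        (integrableOn_curvatureDensity K k (volume_shell_lt_top K).ne).mono_set inter_subset_left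
      refine hint.bdd_mul (c := 1) ?_ ?_
      · exact (measurable_infDist.inv.pow_const _).aestronglyMeasurable
      · refine (ae_restrict_iff' ((measurableSet_shell K).inter
          (measurable_normalDirection K hA))).2 (Eventually.of_forall fun y hy => ?_)
        have hd : 0 < infDist y (K : Set V) := one_pos.trans hy.1.1
        rw [norm_pow, norm_inv, Real.norm_of_nonneg hd.le]
        exact pow_le_one₀ (inv_nonneg.2 hd.le) (inv_le_one_of_one_le₀ hy.1.1.le)
  · filter_upwards [ae_normalCycleDensity_eq_sum η hγ K] with y hy hyA using hy hyA.1

/-- An area measure whose form has flat densities `γ (dim E)` is a combination of the `Δ k`, with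
the coefficients `γ k (m + 1 - k) ω_(m + 1 - k)`, where `ω_d` is the volume of the
`d`-dimensional unit ball. -/
theorem mem_span_Δ_of_flatDensity_eq {Ψ : ConvexBody V → SignedMeasure (sphere (0 : V) 1)}
    {η : InvariantForm V m} (hΨ : ∀ (K : ConvexBody V) (A : Set (sphere (0 : V) 1)),
      MeasurableSet A → Ψ K A = normalCycle η K (Prod.snd ⁻¹' A)) {γ : ℕ → ℝ}
    (hγ : ∀ (E : Submodule ℝ V) (u : sphere (0 : V) 1), finrank ℝ E ≤ m → (u : V) ∈ Eᗮ →
      flatDensity η E u = γ (finrank ℝ E)) :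
    Ψ ∈ Submodule.span ℝ (range (Δ (V := V))) := by
  have hn := hm.out
  have : Ψ = ∑ k : Fin (finrank ℝ V),
      (γ k * ((m + 1 - k : ℕ) * unitBallVolume (finrank ℝ V - k))) • Δ k := by
    funext K
    refine VectorMeasure.ext fun A hA => ?_
    rw [hΨ K A hA, normalCycle_eq_sum η hγ K hA, ← Fin.sum_univ_eq_sum_range (fun k =>
      γ k * ((m + 1 - k : ℕ) * curvatureMeasure m K k A)) (m + 1), Finset.sum_apply,
      FunLike.coe_sum, Finset.sum_apply]
    refine Fintype.sum_equiv (finCongr hn.symm) _ _ fun k => ?_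
    have := (unitBallVolume_pos (finrank ℝ V - k)).ne'
    simp only [finCongr_apply, Fin.val_cast, Pi.smul_apply, smul_apply, smul_eq_mul, Δ_eq (m := m)]
    field_simp
  rw [this]
  exact Submodule.sum_mem _ fun k _ => Submodule.smul_mem _ _ (Submodule.subset_span ⟨k, rfl⟩)

end NormalCycle

/-! ### Centroids of curvature measures -/

section Centroid

theorem _root_.MeasureTheory.SignedMeasure.isFiniteMeasure_variation {X : Type*}
    [MeasurableSpace X] (μ : SignedMeasure X) : IsFiniteMeasure μ.variation := by
  rw [← μ.totalVariation_eq_variation, SignedMeasure.totalVariation]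
  infer_instance

variable [FiniteDimensional ℝ V] [MeasurableSpace V] [BorelSpace V]

theorem integrable_coe_sphere (μ : SignedMeasure (sphere (0 : V) 1)) :
    μ.Integrable fun u : sphere (0 : V) 1 => (u : V) := by
  have := μ.isFiniteMeasure_variation
  refine Integrable.of_bound (C := 1) continuous_subtype_val.aestronglyMeasurable ?_
  exact Eventually.of_forall fun u => (norm_eq_of_mem_sphere u).le

theorem volume_infDist_eq (K : ConvexBody V) {ε : ℝ} (hε : 0 < ε) :
    volume {y | infDist y (K : Set V) = ε} = 0 := by
  refine measure_mono_null (fun y hy => ?_) ((K.convex.cthickening ε).addHaar_frontier volume)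
  have hy : infDist y (K : Set V) = ε := hy
  have hmem : ∀ z, z ∈ cthickening ε (K : Set V) ↔ infDist z (K : Set V) ≤ ε := fun z =>
    mem_cthickening_iff.trans
      (ENNReal.le_ofReal_iff_toReal_le (infEDist_ne_top K.nonempty) hε.le)
  refine ⟨subset_closure ((hmem y).2 hy.le), fun hint => ?_⟩
  -- A point on the outer ray through `y` would still be at distance at most `ε`.
  have hc : Tendsto (fun s : ℝ => rayScaling K s y) (𝓝[>] 1) (𝓝 y) := by
    have : Continuous fun s : ℝ => rayScaling K s y := by unfold rayScaling; fun_prop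
    have h := this.tendsto 1
    rw [rayScaling_one] at h
    exact h.mono_left nhdsWithin_le_nhds
  obtain ⟨s, hs, hs1⟩ := ((hc.eventually (mem_interior_iff_mem_nhds.1 hint)).and
    self_mem_nhdsWithin).exists
  have hs1 : 1 < s := hs1
  have := (hmem _).1 hs
  rw [rayScaling, infDist_ray K y (by linarith), hy] at this
  nlinarith

/-- The integral of the gradient of the compactly supported function `max 0 (ε - d)` vanishes. -/
theorem setIntegral_inner_outerNormal (K : ConvexBody V) {ε : ℝ} (hε : 0 < ε) (v : V) :
    ∫ y in localParallelSet K ε univ, ⟪v, outerNormal K y⟫ = 0 := by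
  set g : V → ℝ := fun y => max 0 (ε - infDist y (K : Set V)) with hg
  have hgL : LipschitzWith 1 g := LipschitzWith.const_max
    (by simpa using (LipschitzWith.const ε).sub (lipschitz_infDist_pt (K : Set V))) 0
  have hgc : HasCompactSupport g := by
    refine HasCompactSupport.intro (K.isCompact.cthickening (r := ε)) fun y hy => ?_
    have : ε < infDist y (K : Set V) := by
      by_contra! h
      exact hy (mem_cthickening_iff.2
        ((ENNReal.le_ofReal_iff_toReal_le (infEDist_ne_top K.nonempty) hε.le).2 h))
    exact max_eq_left (by linarith)
  have h0 := LipschitzWith.integral_lineDeriv_mul_eq (μ := (volume : Measure V))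
    (LipschitzWith.const (1 : ℝ)) hgL hgc v
  have h1 : ∫ y, lineDeriv ℝ g y (-v) = 0 := by
    simpa [lineDeriv] using h0.symm
  rw [← integral_indicator (measurableSet_localParallelSet K ε .univ), ← h1]
  refine integral_congr_ae ?_
  have hnull : ∀ᵐ y : V, infDist y (K : Set V) ≠ ε := by
    rw [ae_iff]; simpa using volume_infDist_eq K hε
  have hmem : ∀ y, y ∈ localParallelSet K ε univ ↔
      0 < infDist y (K : Set V) ∧ infDist y (K : Set V) ≤ ε := fun y => by
    refine and_congr_right fun hy => and_iff_left ?_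
    exact ⟨⟨_, outerNormal_mem_sphere K hy⟩, trivial, rfl⟩
  have hc : ∀ y, Tendsto (fun t : ℝ => y + t • -v) (𝓝 0) (𝓝 y) := fun y => by
    have : Continuous fun t : ℝ => y + t • -v := by fun_prop
    simpa using this.tendsto 0
  filter_upwards [hnull] with y hy
  -- Outside the parallel set `g` attains its maximum (on `K`) or its minimum.
  by_cases hyM : y ∈ localParallelSet K ε univ
  · obtain ⟨h1, h2⟩ := (hmem y).1 hyM
    rw [indicator_of_mem hyM]
    have hd := ((hasFDerivAt_infDist K h1).const_sub ε)
    have he : g =ᶠ[𝓝 y] fun z => ε - infDist z (K : Set V) := by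
      have : ∀ᶠ z in 𝓝 y, infDist z (K : Set V) < ε :=
        (continuous_infDist_pt (K : Set V)).continuousAt.eventually_lt_const
          (lt_of_le_of_ne h2 hy)
      filter_upwards [this] with z hz using max_eq_right (by linarith)
    rw [((hd.congr_of_eventuallyEq he).hasLineDerivAt (-v)).lineDeriv]
    simp [real_inner_comm]
  · rw [indicator_of_notMem hyM]
    symm
    rcases eq_or_lt_of_le (infDist_nonneg (x := y) (s := (K : Set V))) with h | h
    · refine IsExtrFilter.lineDeriv_eq_zero (l := 𝓝 y) (Or.inr ?_) (hc y)
      refine Eventually.of_forall fun z => ?_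
      simp only [hg, ← h, sub_zero, max_eq_right hε.le]
      have := infDist_nonneg (x := z) (s := (K : Set V))
      exact max_le hε.le (by linarith)
    · have h2 : ε < infDist y (K : Set V) := by
        by_contra! h3
        exact hyM ((hmem y).2 ⟨h, h3⟩)
      refine IsExtrFilter.lineDeriv_eq_zero (l := 𝓝 y) (Or.inl ?_) (hc y)
      refine Eventually.of_forall fun z => ?_
      have : g y = 0 := max_eq_left (by linarith)
      rw [this]
      exact le_max_left _ _

variable {m : ℕ} [hm : Fact (finrank ℝ V = m + 1)]

/-- The centroids of the curvature measures are the coefficients in `ε` of the integral of the outer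
normal over the parallel set of radius `ε`, which vanishes. -/
theorem integral_curvatureMeasure (K : ConvexBody V) {k : ℕ} (hk : k ≤ m) :
    ∫ᵛ u, (u : V) ∂<•(curvatureMeasure m K k) = 0 := by
  have key : ∀ ε : ℝ, 0 < ε → ∑ k ∈ Finset.range (m + 1),
      ε ^ (m + 1 - k) • ∫ᵛ u, (u : V) ∂<•(curvatureMeasure m K k) = 0 := by
    intro ε hε
    -- The measure of the local parallel sets of radius `ε`, as a polynomial in `ε`.
    have hfin : IsFiniteMeasure (volume.restrict (localParallelSet K ε univ)) :=
      ⟨by simpa using volume_localParallelSet_lt_top K ε univ⟩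
    set μ := (volume.restrict (localParallelSet K ε univ)).map (normalDirection m K) with hμ
    have e : μ.toSignedMeasure = ∑ k ∈ Finset.range (m + 1),
        ε ^ (m + 1 - k) • curvatureMeasure m K k := by
      refine VectorMeasure.ext fun A hA => ?_
      rw [Measure.toSignedMeasure_apply_measurable hA, FunLike.coe_sum, Finset.sum_apply, hμ,
        measureReal_def, Measure.map_apply (measurable_normalDirection K) hA,
        Measure.restrict_apply (measurable_normalDirection K hA), ← measureReal_def]
      have : normalDirection m K ⁻¹' A ∩ localParallelSet K ε univ = localParallelSet K ε A := by
        ext y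
        simp only [mem_inter_iff, mem_preimage, mem_localParallelSet (m := m), mem_univ]
        tauto
      rw [this, volume_localParallelSet_eq_sum (m := m) K hε hA]
      exact Finset.sum_congr rfl fun k _ => by
        rw [FunLike.coe_smul, Pi.smul_apply, curvatureMeasure_apply K k hA, smul_eq_mul]
    have h1 : ∫ᵛ u, (u : V) ∂<•μ.toSignedMeasure = 0 := by
      rw [VectorMeasure.integral_toSignedMeasure, hμ,
        integral_map (measurable_normalDirection K).aemeasurable
        continuous_subtype_val.aestronglyMeasurable]
      have hi : Integrable (fun y => (normalDirection m K y : V))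
          (volume.restrict (localParallelSet K ε univ)) :=
        Integrable.of_bound (C := 1)
          (measurable_normalDirection K).subtype_val.aestronglyMeasurable
          (Eventually.of_forall fun y => (norm_eq_of_mem_sphere _).le)
      refine ext_inner_left ℝ fun v => ?_
      rw [← integral_inner hi v, inner_zero_right, ← setIntegral_inner_outerNormal K hε v]
      refine setIntegral_congr_fun (measurableSet_localParallelSet K ε .univ) fun y hy => ?_
      simp only [coe_normalDirection hy.1]
    rw [e, VectorMeasure.integral_finsetSum_vectorMeasure fun k _ => integrable_coe_sphere _] at h1
    simpa only [VectorMeasure.integral_smul_vectorMeasure] using h1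
  refine ext_inner_left ℝ fun v => ?_
  rw [inner_zero_right]
  refine eq_of_forall_sum_pow_mul_eq (N := m + 1) (k := k)
    (a := fun k => if k ≤ m then ⟪v, ∫ᵛ u, (u : V) ∂<•(curvatureMeasure m K k)⟫ else 0)
    (b := fun _ => 0) (fun s hs => ?_) (by omega) |> fun h => by simpa [hk] using h
  have h := congrArg (fun w => ⟪v, w⟫) (key s hs)
  simp only [inner_sum, inner_smul_right, inner_zero_right] at h
  rw [Finset.sum_range_succ]
  simp only [mul_zero, Finset.sum_const_zero]
  rw [if_neg (by omega), mul_zero, add_zero, ← h]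
  exact Finset.sum_congr rfl fun k hk => by
    rw [if_pos (by have := Finset.mem_range.1 hk; omega)]

/-- The centroid map vanishes on linear combinations of the `Δ_k`. -/
theorem centroidMap_eq_zero_of_mem_span (m : ℕ) [hm : Fact (finrank ℝ V = m + 1)]
    {Ψ : ConvexBody V → SignedMeasure (sphere (0 : V) 1)}
    (hΨ : Ψ ∈ Submodule.span ℝ (range (Δ (V := V)))) : centroidMap Ψ = 0 := by
  funext K
  refine Submodule.span_induction (p := fun Ψ _ => centroidMap Ψ K = 0) ?_ ?_ ?_ ?_ hΨ
  · rintro _ ⟨k, rfl⟩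
    have hk : (k : ℕ) ≤ m := by have := k.2; have := hm.out; omega
    rw [centroidMap, Δ_eq (m := m), VectorMeasure.integral_smul_vectorMeasure,
      integral_curvatureMeasure K hk, smul_zero]
  · simp [centroidMap]
  · intro Ψ Φ _ _ h1 h2
    rw [centroidMap] at h1 h2 ⊢
    rw [Pi.add_apply, VectorMeasure.integral_add_vectorMeasure (integrable_coe_sphere _)
      (integrable_coe_sphere _), h1, h2, add_zero]
  · intro a Ψ _ h
    rw [centroidMap] at h ⊢
    rw [Pi.smul_apply, VectorMeasure.integral_smul_vectorMeasure, h, smul_zero]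

end Centroid

/-! ### Hausdorff measure of great subspheres -/

section GreatSphere

theorem euclideanHausdorffMeasure_subspace_inter_closedBall_lt_top [FiniteDimensional ℝ V]
    [MeasurableSpace V] [BorelSpace V] (W : Submodule ℝ V) (r : ℝ) :
    (μHE[finrank ℝ W] : Measure V) (W ∩ closedBall 0 r) < ⊤ := by
  have e : (W ∩ closedBall 0 r : Set V) = W.subtypeₗᵢ '' closedBall 0 r := by
    ext x
    simp only [mem_inter_iff, SetLike.mem_coe, mem_image, mem_closedBall_zero_iff]
    exact ⟨fun h => ⟨⟨x, h.1⟩, h.2, rfl⟩, by rintro ⟨y, hy, rfl⟩; exact ⟨y.2, hy⟩⟩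
  rw [e, W.subtypeₗᵢ.isometry.euclideanHausdorffMeasure_image,
    InnerProductSpace.euclideanHausdorffMeasure_eq_volume]
  exact (isCompact_closedBall _ _).measure_lt_top

/-- The closed hemisphere opposite to `v` is the image of a ball of radius `2` under the inverse of
the stereographic projection from `v`, which is Lipschitz on this ball. -/
theorem euclideanHausdorffMeasure_hemisphere_lt_top [FiniteDimensional ℝ V]
    [MeasurableSpace V] [BorelSpace V] {v : V} (hv : ‖v‖ = 1) :
    (μHE[finrank ℝ (ℝ ∙ v)ᗮ] : Measure V) {u | ‖u‖ = 1 ∧ ⟪v, u⟫ ≤ 0} < ⊤ := by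
  obtain ⟨C, hC⟩ := (contDiff_stereoInvFunAux (m := 1) (v := v)).contDiffOn.exists_lipschitzOnWith
    one_ne_zero (convex_closedBall (0 : V) 2) (isCompact_closedBall _ _)
  have h1 := (hC.mono (inter_subset_right (s := ((ℝ ∙ v)ᗮ : Set V)))
    ).euclideanHausdorffMeasure_image_le
    (finrank ℝ (ℝ ∙ v)ᗮ)
  refine lt_of_le_of_lt (measure_mono fun u hu => ?_) (h1.trans_lt (ENNReal.mul_lt_top (by simp)
    (euclideanHausdorffMeasure_subspace_inter_closedBall_lt_top _ 2)))
  obtain ⟨hu1, hu2⟩ := hu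
  have hne : (⟨u, by simpa using hu1⟩ : sphere (0 : V) 1) ≠ ⟨v, by simpa using hv⟩ := by
    intro h
    rw [show u = v from congrArg Subtype.val h, real_inner_self_eq_norm_sq, hv] at hu2
    norm_num at hu2
  have hinv := stereo_left_inv hv (x := ⟨u, by simpa using hu1⟩) fun h => hne (Subtype.ext h)
  refine ⟨stereoToFun v u, ⟨(stereoToFun v u).2, ?_⟩, congrArg Subtype.val hinv⟩
  rw [mem_closedBall_zero_iff, stereoToFun_apply, Submodule.norm_coe, norm_smul]
  have h2 : ‖(ℝ ∙ v)ᗮ.orthogonalProjectionOnto u‖ ≤ 1 :=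
    ((ℝ ∙ v)ᗮ.norm_orthogonalProjectionOnto_apply_le u).trans hu1.le
  have h3 : ‖(2 : ℝ) / ((1 : ℝ) - innerSL ℝ v u)‖ ≤ 2 := by
    rw [innerSL_apply_apply, Real.norm_of_nonneg (div_nonneg zero_le_two (by linarith))]
    exact div_le_self zero_le_two (by linarith)
  calc _ ≤ (2 : ℝ) * 1 := mul_le_mul h3 h2 (norm_nonneg _) zero_le_two
    _ = 2 := mul_one 2

theorem euclideanHausdorffMeasure_sphere_lt_top [FiniteDimensional ℝ V]
    [MeasurableSpace V] [BorelSpace V] {d : ℕ} (hd : finrank ℝ V = d + 1) :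
    (μHE[d] : Measure V) (sphere 0 1) < ⊤ := by
  have hnt : Nontrivial V := nontrivial_of_finrank_pos (R := ℝ) (by omega)
  obtain ⟨v, hv⟩ := exists_norm_eq V zero_le_one
  have hrank : ∀ w : V, ‖w‖ = 1 → finrank ℝ (ℝ ∙ w)ᗮ = d := fun w hw => by
    have : Fact (finrank ℝ V = d + 1) := ⟨hd⟩
    exact Submodule.finrank_orthogonal_span_singleton (by rintro rfl; simp at hw)
  have h1 := euclideanHausdorffMeasure_hemisphere_lt_top hv
  have h2 := euclideanHausdorffMeasure_hemisphere_lt_top (v := -v) (by rwa [norm_neg])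
  rw [hrank _ hv] at h1
  rw [hrank _ (by rwa [norm_neg])] at h2
  refine lt_of_le_of_lt (measure_mono fun u hu => ?_)
    ((measure_union_le _ _).trans_lt (ENNReal.add_lt_top.2 ⟨h1, h2⟩))
  have hu : ‖u‖ = 1 := by simpa using hu
  rcases le_total ⟪v, u⟫ 0 with h | h
  · exact Or.inl ⟨hu, h⟩
  · exact Or.inr ⟨hu, by rw [inner_neg_left]; linarith⟩

variable [MeasurableSpace V] [BorelSpace V]

theorem euclideanHausdorffMeasure_coe_sphere {X : Type*} [NormedAddCommGroup X]
    [MeasurableSpace X] [BorelSpace X] (d : ℕ) (A : Set (sphere (0 : X) 1)) :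
    (μHE[d] : Measure X) ((↑) '' A) = (μHE[d] : Measure (sphere (0 : X) 1)) A :=
  isometry_subtype_coe.euclideanHausdorffMeasure_image A

variable [FiniteDimensional ℝ V]

theorem euclideanHausdorffMeasure_greatSphere_lt_top {W : Submodule ℝ V} {d : ℕ}
    (hW : finrank ℝ W = d + 1) :
    (μHE[d] : Measure (sphere (0 : V) 1)) {u | (u : V) ∈ W} < ⊤ := by
  rw [← euclideanHausdorffMeasure_coe_sphere]
  have e : ((↑) '' {u : sphere (0 : V) 1 | (u : V) ∈ W} : Set V) =
      W.subtypeₗᵢ '' sphere (0 : W) 1 := by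
    ext x
    simp only [mem_image, mem_ofPred_eq, mem_sphere_zero_iff_norm]
    constructor
    · rintro ⟨u, hu, rfl⟩
      exact ⟨⟨u, hu⟩, norm_eq_of_mem_sphere u, rfl⟩
    · rintro ⟨w, hw, rfl⟩
      exact ⟨⟨w, by simpa using hw⟩, w.2, rfl⟩
  rw [e, W.subtypeₗᵢ.isometry.euclideanHausdorffMeasure_image]
  exact euclideanHausdorffMeasure_sphere_lt_top hW

/-- An open hemisphere projects orthogonally onto an open ball in the equatorial hyperplane. -/
theorem euclideanHausdorffMeasure_openHemisphere_pos {W : Submodule ℝ V} {v : V} (hv : ‖v‖ = 1)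
    (hW : W ≤ (ℝ ∙ v)ᗮ) :
    0 < (μHE[finrank ℝ W] : Measure (sphere (0 : V) 1))
      {u | (u : V) ∈ W ⊔ (ℝ ∙ v) ∧ 0 < ⟪v, (u : V)⟫} := by
  have hl : LipschitzWith 1 fun u : sphere (0 : V) 1 => W.orthogonalProjectionOnto (u : V) :=
    LipschitzWith.of_dist_le_mul fun x y => by
      rw [dist_eq_norm, ← map_sub, NNReal.coe_one, one_mul, Subtype.dist_eq, dist_eq_norm]
      exact W.norm_orthogonalProjectionOnto_apply_le _
  have h1 := LipschitzOnWith.euclideanHausdorffMeasure_image_le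
    (s := {u : sphere (0 : V) 1 | (u : V) ∈ W ⊔ (ℝ ∙ v) ∧ 0 < ⟪v, (u : V)⟫})
    (fun x _ y _ => hl x y) (finrank ℝ W)
  rw [ENNReal.coe_one, one_pow, one_mul] at h1
  refine lt_of_lt_of_le ?_ h1
  rw [InnerProductSpace.euclideanHausdorffMeasure_eq_volume]
  refine lt_of_lt_of_le (measure_ball_pos volume (0 : W) one_pos) (measure_mono fun w hw => ?_)
  have hw : ‖w‖ < 1 := by simpa using hw
  have hwv : ⟪v, (w : V)⟫ = 0 := Submodule.mem_orthogonal_singleton_iff_inner_right.1 (hW w.2)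
  have hpos : 0 < 1 - ‖w‖ ^ 2 := by nlinarith [norm_nonneg w]
  have hvW : W.orthogonalProjectionOnto v = 0 :=
    Submodule.orthogonalProjectionOnto_apply_of_mem_orthogonal ((Submodule.mem_orthogonal _ _).2
      fun x hx => Submodule.mem_orthogonal_singleton_iff_inner_left.1 (hW hx))
  refine ⟨⟨(w : V) + √(1 - ‖w‖ ^ 2) • v, ?_⟩, ⟨?_, ?_⟩, ?_⟩
  · rw [mem_sphere_zero_iff_norm, ← sq_eq_sq₀ (norm_nonneg _) zero_le_one, norm_add_sq_real,
      inner_smul_right, real_inner_comm, hwv, norm_smul, hv,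
      Real.norm_of_nonneg (Real.sqrt_nonneg _), mul_one, Real.sq_sqrt hpos.le, Submodule.coe_norm]
    ring
  · exact Submodule.add_mem_sup w.2 (Submodule.smul_mem _ _ (Submodule.mem_span_singleton_self v))
  · simp only
    rw [inner_add_right, hwv, inner_smul_right, real_inner_self_eq_norm_sq, hv]
    have := Real.sqrt_pos.2 hpos
    linarith
  · simp [hvW]

end GreatSphere

/-! ### Faces of polytopes and linear isometries -/

section Faces

/-- The convex hull of a nonempty finite set, as a convex body. -/
def polytope (s : Set V) (hs : s.Finite) (hne : s.Nonempty) : ConvexBody V where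
  carrier := convexHull ℝ s
  convex' := convex_convexHull ℝ s
  isCompact' := hs.isCompact_convexHull ℝ
  nonempty' := hne.convexHull

theorem isPolytope_polytope {s : Set V} (hs : s.Finite) (hne : s.Nonempty) :
    IsPolytope (polytope s hs hne) := ⟨s, hs, rfl⟩

/-- Every exposed face is the convex hull of its vertices, which are among those of the polytope. -/
theorem _root_.IsExposed.eq_convexHull_inter {s F : Set V} (hs : s.Finite)
    (hF : IsExposed ℝ (convexHull ℝ s) F) : F = convexHull ℝ (s ∩ F) := by
  have hc : IsCompact F := hF.isCompact (hs.isCompact_convexHull ℝ)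
  have hconv : Convex ℝ F := hF.convex (convex_convexHull ℝ s)
  have hsub : F.extremePoints ℝ ⊆ s ∩ F := fun x hx =>
    ⟨extremePoints_convexHull_subset (hF.isExtreme.extremePoints_subset_extremePoints hx), hx.1⟩
  refine Subset.antisymm ?_ (convexHull_min inter_subset_right hconv)
  calc F = closure (convexHull ℝ (F.extremePoints ℝ)) :=
        (closure_convexHull_extremePoints hc hconv).symm
    _ ⊆ closure (convexHull ℝ (s ∩ F)) := closure_mono (convexHull_mono hsub)
    _ = convexHull ℝ (s ∩ F) := (hs.subset inter_subset_left).isClosed_convexHull ℝ |>.closure_eq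

/-- A face is determined by the points of a finite generating set that it contains. -/
theorem finite_faces {P : ConvexBody V} (hP : IsPolytope P) (k : ℕ) : (faces P k).Finite := by
  obtain ⟨s, hs, hPs⟩ := hP
  refine (hs.finite_subsets.image (convexHull ℝ)).subset fun F hF => ?_
  have hF1 := hF.1
  rw [hPs] at hF1
  exact ⟨s ∩ F, inter_subset_left, (hF1.eq_convexHull_inter hs).symm⟩

theorem directionSpace_eq_span (F : Set V) : directionSpace F = Submodule.span ℝ (F -ᵥ F) := by
  rw [directionSpace, direction_affineSpan, vectorSpan_def]

theorem sub_mem_directionSpace {F : Set V} {x y : V} (hx : x ∈ F) (hy : y ∈ F) :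
    x - y ∈ directionSpace F := by
  rw [directionSpace_eq_span]
  exact Submodule.subset_span ⟨x, hx, y, hy, rfl⟩

theorem directionSpace_le {F : Set V} {E : Submodule ℝ V} (hF : F ⊆ E) : directionSpace F ≤ E := by
  rw [directionSpace_eq_span, Submodule.span_le]
  rintro _ ⟨x, hx, y, hy, rfl⟩
  exact E.sub_mem (hF hx) (hF hy)

/-- An exposed face contains all points of `P` in its affine span. -/
theorem mem_of_sub_mem_directionSpace {P F : Set V} (hF : IsExposed ℝ P F) {x y : V} (hx : x ∈ F)
    (hy : y ∈ P) (hyx : y - x ∈ directionSpace F) : y ∈ F := by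
  obtain ⟨l, rfl⟩ := hF ⟨x, hx⟩
  have hl : directionSpace {x ∈ P | ∀ y ∈ P, l y ≤ l x} ≤ l.toLinearMap.ker := by
    rw [directionSpace_eq_span, Submodule.span_le]
    rintro _ ⟨a, ha, b, hb, rfl⟩
    change l (a - b) = 0
    rw [map_sub, sub_eq_zero]
    exact le_antisymm (hb.2 a ha.1) (ha.2 b hb.1)
  have h : l (y - x) = 0 := hl hyx
  rw [map_sub, sub_eq_zero] at h
  exact ⟨hy, fun z hz => h ▸ hx.2 z hz⟩

theorem mem_orthogonal_of_mem_normalCone {P : ConvexBody V} {F : Set V} (hFP : F ⊆ P) {u : V}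
    (hu : u ∈ normalCone F P) : u ∈ (directionSpace F)ᗮ := by
  have h : directionSpace F ≤ (ℝ ∙ u)ᗮ := by
    rw [directionSpace_eq_span, Submodule.span_le]
    rintro _ ⟨x, hx, y, hy, rfl⟩
    refine Submodule.mem_orthogonal_singleton_iff_inner_left.2 (le_antisymm (hu y hy x (hFP hx)) ?_)
    have := hu x hx y (hFP hy)
    rw [← neg_sub, inner_neg_left] at this
    exact neg_nonpos.1 this
  exact (Submodule.mem_orthogonal _ _).2 fun v hv =>
    Submodule.mem_orthogonal_singleton_iff_inner_left.1 (h hv)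

theorem isClosed_setOf_mem_normalCone (F : Set V) (P : ConvexBody V) :
    IsClosed {u : sphere (0 : V) 1 | (u : V) ∈ normalCone F P} := by
  have e : {u : sphere (0 : V) 1 | (u : V) ∈ normalCone F P} =
      ⋂ x ∈ F, ⋂ z ∈ (P : Set V), {u : sphere (0 : V) 1 | ⟪z - x, (u : V)⟫ ≤ 0} := by
    ext u
    simp [normalCone]
  rw [e]
  exact isClosed_biInter fun x _ => isClosed_biInter fun z _ =>
    isClosed_le (by fun_prop) continuous_const

/-- The restriction of a linear isometry to the unit sphere. -/
def sphereIsometry (T : V ≃ₗᵢ[ℝ] V) : sphere (0 : V) 1 ≃ᵢ sphere (0 : V) 1 where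
  toFun u := ⟨T u, by simp⟩
  invFun u := ⟨T.symm u, by simp⟩
  left_inv u := Subtype.ext (T.symm_apply_apply _)
  right_inv u := Subtype.ext (T.apply_symm_apply _)
  isometry_toFun u v := T.isometry u v

theorem coe_sphereIsometry (T : V ≃ₗᵢ[ℝ] V) (u : sphere (0 : V) 1) :
    (sphereIsometry T u : V) = T u := rfl

theorem directionSpace_image (T : V ≃ₗᵢ[ℝ] V) (F : Set V) :
    directionSpace (T '' F) = (directionSpace F).map (T.toLinearEquiv : V →ₗ[ℝ] V) := by
  rw [directionSpace_eq_span, directionSpace_eq_span, Submodule.map_span]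
  congr 1
  ext v
  constructor
  · rintro ⟨_, ⟨x, hx, rfl⟩, _, ⟨y, hy, rfl⟩, rfl⟩
    exact ⟨x - y, ⟨x, hx, y, hy, rfl⟩, map_sub T x y⟩
  · rintro ⟨_, ⟨x, hx, y, hy, rfl⟩, rfl⟩
    exact ⟨T x, ⟨x, hx, rfl⟩, T y, ⟨y, hy, rfl⟩, (map_sub T x y).symm⟩

theorem finrank_directionSpace_image (T : V ≃ₗᵢ[ℝ] V) (F : Set V) :
    finrank ℝ (directionSpace (T '' F)) = finrank ℝ (directionSpace F) := by
  rw [directionSpace_image]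
  exact LinearEquiv.finrank_map_eq T.toLinearEquiv _

theorem _root_.IsExposed.image_linearIsometryEquiv (T : V ≃ₗᵢ[ℝ] V) {P F : Set V}
    (hF : IsExposed ℝ P F) : IsExposed ℝ (T '' P) (T '' F) := by
  rintro ⟨_, x, hx, rfl⟩
  obtain ⟨l, rfl⟩ := hF ⟨x, hx⟩
  refine ⟨l.comp (T.symm : V →L[ℝ] V), ?_⟩
  ext z
  constructor
  · rintro ⟨y, hy, rfl⟩
    refine ⟨⟨y, hy.1, rfl⟩, ?_⟩
    rintro _ ⟨w, hw, rfl⟩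
    simpa using hy.2 w hw
  · rintro ⟨⟨y, hy, rfl⟩, h⟩
    exact ⟨y, ⟨hy, fun w hw => by simpa using h (T w) ⟨w, hw, rfl⟩⟩, rfl⟩

theorem faces_eq_image {P Q : ConvexBody V} (T : V ≃ₗᵢ[ℝ] V) (h : (Q : Set V) = T '' P) (k : ℕ) :
    faces Q k = (fun F => T '' F) '' faces P k := by
  ext F
  constructor
  · rintro ⟨h1, h2, h3⟩
    have hP : (P : Set V) = T.symm '' Q := by
      rw [h, image_image]; simp
    have e : T '' (T.symm '' F) = F := by rw [image_image]; simp
    refine ⟨T.symm '' F, ⟨hP ▸ h1.image_linearIsometryEquiv T.symm, h2.image _, ?_⟩, e⟩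
    rw [finrank_directionSpace_image, h3]
  · rintro ⟨G, ⟨h1, h2, h3⟩, rfl⟩
    exact ⟨h ▸ h1.image_linearIsometryEquiv T, h2.image _, by rw [finrank_directionSpace_image, h3]⟩

theorem finsum_mem_faces_eq {P Q : ConvexBody V} (T : V ≃ₗᵢ[ℝ] V) (h : (Q : Set V) = T '' P)
    (k : ℕ) (f : Set V → ℝ) :
    ∑ᶠ F ∈ faces Q k, f F = ∑ᶠ F ∈ faces P k, f (T '' F) := by
  rw [faces_eq_image T h, finsum_mem_image T.injective.image_injective.injOn]

theorem mem_normalCone_image {P Q : ConvexBody V} (T : V ≃ₗᵢ[ℝ] V) (h : (Q : Set V) = T '' P)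
    (F : Set V) (v : V) : T v ∈ normalCone (T '' F) Q ↔ v ∈ normalCone F P := by
  simp only [normalCone, h, mem_ofPred_eq, forall_mem_image, ← map_sub, T.inner_map_map]

variable [MeasurableSpace V] [BorelSpace V]

theorem measureReal_normalCone_image {P Q : ConvexBody V} (T : V ≃ₗᵢ[ℝ] V)
    (h : (Q : Set V) = T '' P) (F : Set V) (d : ℕ) (A : Set (sphere (0 : V) 1)) :
    (μHE[d] : Measure (sphere (0 : V) 1)).real
        {u | (u : V) ∈ normalCone (T '' F) Q ∧ u ∈ sphereIsometry T '' A} =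
      (μHE[d] : Measure (sphere (0 : V) 1)).real {u | (u : V) ∈ normalCone F P ∧ u ∈ A} := by
  rw [measureReal_def, measureReal_def,
    ← (sphereIsometry T).isometry.euclideanHausdorffMeasure_image
    {u : sphere (0 : V) 1 | (u : V) ∈ normalCone F P ∧ u ∈ A}]
  congr 2
  ext u
  constructor
  · rintro ⟨h1, v, hv, rfl⟩
    exact ⟨v, ⟨(mem_normalCone_image T h F v).1 h1, hv⟩, rfl⟩
  · rintro ⟨v, ⟨hv1, hv2⟩, rfl⟩
    exact ⟨(mem_normalCone_image T h F v).2 hv1, v, hv2, rfl⟩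

theorem measureReal_image (T : V ≃ₗᵢ[ℝ] V) (F : Set V) (k : ℕ) :
    (μHE[k] : Measure V).real (T '' F) = (μHE[k] : Measure V).real F := by
  rw [measureReal_def, T.isometry.euclideanHausdorffMeasure_image, measureReal_def]

end Faces

/-! ### Centroids of angular area measures -/

section AngularCentroid

theorem finrank_orthogonal_eq [FiniteDimensional ℝ V] {m : ℕ}
    [hm : Fact (finrank ℝ V = m + 1)] {E : Submodule ℝ V} {k : ℕ} (hE : finrank ℝ E = k)
    (hk : k ≤ m) :
    finrank ℝ Eᗮ = m - k + 1 := by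
  have h1 := E.finrank_add_finrank_orthogonal
  have h2 := hm.out
  omega

variable [MeasurableSpace V] [BorelSpace V]

/-- The formula of an angular area measure, for given coefficients `c`. -/
def IsAngularWith (Ψ : ConvexBody V → SignedMeasure (sphere (0 : V) 1))
    (c : Submodule ℝ V → ℝ) : Prop :=
  ∀ P : ConvexBody V, IsPolytope P → ∀ A : Set (sphere (0 : V) 1), MeasurableSet A →
    Ψ P A = ∑ k ∈ Finset.range (finrank ℝ V), ∑ᶠ F ∈ faces P k,
      c (directionSpace F) *
        ((μHE[finrank ℝ V - 1 - k] : Measure (sphere (0 : V) 1)).real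
            {u | (u : V) ∈ normalCone F P ∧ u ∈ A} /
          (((finrank ℝ V - k : ℕ) : ℝ) * unitBallVolume (finrank ℝ V - k))) *
        (μHE[k] : Measure V).real F

/-- The contribution of the face `F` to the component in direction `e` of the centroid, up to the
coefficient that depends on the direction of `F`. -/
def faceMoment (m k : ℕ) (e : V) (P : ConvexBody V) (F : Set V) : ℝ :=
  (μHE[k] : Measure V).real F *
    ∫ u in {u : sphere (0 : V) 1 | (u : V) ∈ normalCone F P}, ⟪e, (u : V)⟫ ∂μHE[m - k]

theorem faceMoment_image (m k : ℕ) (e : V) {P Q : ConvexBody V} (T : V ≃ₗᵢ[ℝ] V)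
    (h : (Q : Set V) = T '' P) (F : Set V) :
    faceMoment m k (T e) Q (T '' F) = faceMoment m k e P F := by
  rw [faceMoment, faceMoment, measureReal_image]
  congr 1
  rw [← ((sphereIsometry T).measurePreserving_euclideanHausdorffMeasure
    (m - k)).setIntegral_preimage_emb (sphereIsometry T).toHomeomorph.measurableEmbedding]
  have : sphereIsometry T ⁻¹' {u : sphere (0 : V) 1 | (u : V) ∈ normalCone (T '' F) Q} =
      {u : sphere (0 : V) 1 | (u : V) ∈ normalCone F P} :=
    ext fun u => mem_normalCone_image T h F u
  rw [this]
  simp only [coe_sphereIsometry, T.inner_map_map]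

/-- A symmetry `T` of the polytope that reverses `e` makes the contributions of `F` and
`T F` cancel. -/
theorem finsum_faceMoment_eq_zero (m k : ℕ) {e : V} {P : ConvexBody V} (hP : IsPolytope P)
    (T : V ≃ₗᵢ[ℝ] V) (hT : (P : Set V) = T '' P) (he : T e = -e) :
    ∑ᶠ F ∈ faces P k, faceMoment m k e P F = 0 := by
  have h1 : ∀ F, faceMoment m k e P (T '' F) = -faceMoment m k e P F := fun F => by
    have h := faceMoment_image m k e T hT F
    rw [he] at h
    rw [← h, faceMoment, faceMoment]
    simp only [inner_neg_left, integral_neg, mul_neg, neg_neg]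
  have h2 := finsum_mem_faces_eq T hT k (faceMoment m k e P)
  simp only [h1] at h2
  rw [finsum_mem_congr rfl fun F _ => neg_eq_neg_one_mul (faceMoment m k e P F),
    ← mul_finsum_mem' _ _ (finite_faces hP k)] at h2
  linarith

/-- The normal cone of `F` is orthogonal to `F`. -/
theorem faceMoment_eq_zero (m k : ℕ) {e : V} {P : ConvexBody V} {F : Set V} (hFP : F ⊆ P)
    (he : e ∈ directionSpace F) : faceMoment m k e P F = 0 := by
  rw [faceMoment, setIntegral_eq_zero_of_forall_eq_zero, mul_zero]
  exact fun u hu => (Submodule.mem_orthogonal _ _).1 (mem_orthogonal_of_mem_normalCone hFP hu) e he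

theorem inner_integral_eq_sum {ι : Type*} [Fintype ι] [FiniteDimensional ℝ V]
    {μ : SignedMeasure (sphere (0 : V) 1)}
    (ρ : ι → Measure (sphere (0 : V) 1)) [∀ i, IsFiniteMeasure (ρ i)] (a : ι → ℝ)
    (h : ∀ A, MeasurableSet A → μ A = ∑ i, a i * (ρ i).real A) (e : V) :
    ⟪e, ∫ᵛ u, (u : V) ∂<•μ⟫ = ∑ i, a i * ∫ u, ⟪e, (u : V)⟫ ∂ρ i := by
  have hμ : μ = ∑ i, a i • (ρ i).toSignedMeasure := by
    refine VectorMeasure.ext fun A hA => ?_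
    rw [h A hA, FunLike.coe_sum, Finset.sum_apply]
    exact Finset.sum_congr rfl fun i _ => by
      rw [FunLike.coe_smul, Pi.smul_apply, Measure.toSignedMeasure_apply_measurable hA, smul_eq_mul]
  rw [hμ, VectorMeasure.integral_finsetSum_vectorMeasure fun i _ => integrable_coe_sphere _,
    inner_sum]
  refine Finset.sum_congr rfl fun i _ => ?_
  have hi : Integrable (fun u : sphere (0 : V) 1 => (u : V)) (ρ i) :=
    Integrable.of_bound (C := 1) continuous_subtype_val.aestronglyMeasurable
      (Eventually.of_forall fun u => (norm_eq_of_mem_sphere u).le)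
  rw [VectorMeasure.integral_smul_vectorMeasure, VectorMeasure.integral_toSignedMeasure,
    inner_smul_right, integral_inner hi]

variable [FiniteDimensional ℝ V] {m : ℕ} [hm : Fact (finrank ℝ V = m + 1)]

theorem euclideanHausdorffMeasure_normalCone_lt_top {P : ConvexBody V} {F : Set V} {k : ℕ}
    (hF : F ∈ faces P k) (hk : k ≤ m) :
    (μHE[m - k] : Measure (sphere (0 : V) 1)) {u | (u : V) ∈ normalCone F P} < ⊤ := by
  have hsub : {u : sphere (0 : V) 1 | (u : V) ∈ normalCone F P} ⊆
      {u | (u : V) ∈ (directionSpace F)ᗮ} :=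
    fun u hu => mem_orthogonal_of_mem_normalCone hF.1.subset hu
  exact (measure_mono hsub).trans_lt
    (euclideanHausdorffMeasure_greatSphere_lt_top (finrank_orthogonal_eq hF.2.2 hk))

/-- The centroid of the area measure of a polytope as a sum over its faces. -/
theorem inner_centroidMap_eq_sum {Ψ : ConvexBody V → SignedMeasure (sphere (0 : V) 1)}
    {c : Submodule ℝ V → ℝ} (hc : IsAngularWith Ψ c) {P : ConvexBody V} (hP : IsPolytope P)
    (e : V) :
    ⟪e, centroidMap Ψ P⟫ = ∑ k ∈ Finset.range (m + 1), (((m + 1 - k : ℕ) : ℝ) *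
      unitBallVolume (m + 1 - k))⁻¹ *
        ∑ᶠ F ∈ faces P k, c (directionSpace F) * faceMoment m k e P F := by
  have hn := hm.out
  let : ∀ k, Fintype (faces P k) := fun k => (finite_faces hP k).fintype
  set ρ : (Σ k : Fin (m + 1), faces P k) → Measure (sphere (0 : V) 1) := fun i =>
    (μHE[m - i.1]).restrict {u | (u : V) ∈ normalCone (i.2 : Set V) P} with hρ
  have : ∀ i, IsFiniteMeasure (ρ i) := fun i => isFiniteMeasure_restrict.2
    (euclideanHausdorffMeasure_normalCone_lt_top i.2.2 (Nat.lt_succ_iff.1 i.1.2)).ne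
  rw [centroidMap, inner_integral_eq_sum ρ (fun i => (((m + 1 - i.1 : ℕ) : ℝ) *
    unitBallVolume (m + 1 - i.1))⁻¹ * (c (directionSpace (i.2 : Set V)) *
      (μHE[i.1] : Measure V).real i.2)) (fun A hA => ?_) e]
  · rw [Fintype.sum_sigma, ← Fin.sum_univ_eq_sum_range (fun k => (((m + 1 - k : ℕ) : ℝ) *
      unitBallVolume (m + 1 - k))⁻¹ *
        ∑ᶠ F ∈ faces P k, c (directionSpace F) * faceMoment m k e P F)]
    refine Finset.sum_congr rfl fun k _ => ?_
    rw [← finsum_set_coe_eq_finsum_mem, finsum_eq_sum_of_fintype, Finset.mul_sum]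
    refine Finset.sum_congr rfl fun F _ => ?_
    simp only [faceMoment, hρ]
    ring
  · rw [hc P hP A hA, hn, Fintype.sum_sigma, ← Fin.sum_univ_eq_sum_range]
    refine Finset.sum_congr rfl fun k _ => ?_
    rw [← finsum_set_coe_eq_finsum_mem, finsum_eq_sum_of_fintype]
    refine Finset.sum_congr rfl fun F _ => ?_
    simp only [hρ]
    rw [measureReal_restrict_apply hA, add_tsub_cancel_right]
    have : {u : sphere (0 : V) 1 | (u : V) ∈ normalCone (F : Set V) P ∧ u ∈ A} =
        A ∩ {u | (u : V) ∈ normalCone (F : Set V) P} := inter_comm _ _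
    rw [this]
    ring

end AngularCentroid

/-! ### Constancy of the coefficients -/

section Coefficients

theorem euclideanHausdorffMeasure_pos_of_convex [FiniteDimensional ℝ V] [MeasurableSpace V]
    [BorelSpace V] {F : Set V} (hF : Convex ℝ F) (h0 : (0 : V) ∈ F) :
    0 < (μHE[finrank ℝ (Submodule.span ℝ F)] : Measure V) F := by
  set E := Submodule.span ℝ F with hE
  set F' : Set E := E.subtypeₗᵢ ⁻¹' F with hF'
  have himg : E.subtypeₗᵢ '' F' = F :=
    image_preimage_eq_of_subset fun x hx => ⟨⟨x, Submodule.subset_span hx⟩, rfl⟩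
  have h0' : (0 : E) ∈ F' := h0
  have hconv : Convex ℝ F' := hF.linear_preimage E.subtype
  have hspan : vectorSpan ℝ F' = ⊤ := by
    refine top_unique ?_
    rw [← Submodule.span_span_coe_preimage (R := ℝ) (s := F), Submodule.span_le, vectorSpan_def]
    exact fun x hx => Submodule.subset_span ⟨x, hx, 0, h0', sub_zero x⟩
  have hint : (interior F').Nonempty := hconv.interior_nonempty_iff_affineSpan_eq_top.2
    ((AffineSubspace.affineSpan_eq_top_iff_vectorSpan_eq_top_of_nonempty ℝ E E ⟨0, h0'⟩).2 hspan)
  rw [← himg, E.subtypeₗᵢ.isometry.euclideanHausdorffMeasure_image,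
    InnerProductSpace.euclideanHausdorffMeasure_eq_volume]
  exact (isOpen_interior.measure_pos volume hint).trans_le (measure_mono interior_subset)

theorem sup_span_singleton_eq_of_mem [FiniteDimensional ℝ V] {D : Submodule ℝ V} {x y : V}
    (hx : x ∉ D) (hy : y ∉ D) (h : y ∈ D ⊔ (ℝ ∙ x)) : D ⊔ (ℝ ∙ y) = D ⊔ (ℝ ∙ x) := by
  refine Submodule.eq_of_le_of_finrank_eq (sup_le le_sup_left ?_) ?_
  · rwa [Submodule.span_singleton_le_iff_mem]
  · rw [Submodule.finrank_sup_span_singleton hx, Submodule.finrank_sup_span_singleton hy]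

/-- A function on the subspaces of dimension `k + 1` is constant if it does not change when a
single spanning vector is exchanged. -/
theorem eq_of_forall_sup_span_singleton_eq [FiniteDimensional ℝ V] {k : ℕ} {c : Submodule ℝ V → ℝ}
    (h : ∀ (D : Submodule ℝ V) (x y : V), finrank ℝ D = k → x ∉ D → y ∉ D →
      c (D ⊔ (ℝ ∙ x)) = c (D ⊔ (ℝ ∙ y))) {E E' : Submodule ℝ V} (hE : finrank ℝ E = k + 1)
    (hE' : finrank ℝ E' = k + 1) : c E = c E' := by
  induction hd : k + 1 - finrank ℝ (E ⊓ E' : Submodule ℝ V) using Nat.strong_induction_on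
    generalizing E with
  | _ d ih =>
    by_cases hEE : E' ≤ E
    · rw [Submodule.eq_of_le_of_finrank_eq hEE (hE'.trans hE.symm)]
    obtain ⟨y, hy', hy⟩ := SetLike.not_le_iff_exists.1 hEE
    have hlt : E ⊓ E' < E := by
      refine lt_of_le_of_ne inf_le_left fun heq => hEE ?_
      exact (Submodule.eq_of_le_of_finrank_eq (inf_eq_left.1 heq) (hE.trans hE'.symm)).ge
    obtain ⟨D, hD, hDE⟩ := exists_le_covBy_of_lt hlt
    obtain ⟨x, hxE, hxD⟩ := SetLike.exists_of_lt hDE.lt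
    have hyD : y ∉ D := fun h => hy (hDE.le h)
    have hDx : D ⊔ (ℝ ∙ x) = E := by
      refine (hDE.wcovBy.eq_or_eq le_sup_left (sup_le hDE.le ?_)).resolve_left fun heq => hxD ?_
      · rwa [Submodule.span_singleton_le_iff_mem]
      · rw [← heq]
        exact Submodule.mem_sup_right (Submodule.mem_span_singleton_self x)
    have hDk : finrank ℝ D = k := by
      have := Submodule.finrank_sup_span_singleton hxD
      rw [hDx, hE] at this
      omega
    have hlt' : E ⊓ E' < (D ⊔ (ℝ ∙ y)) ⊓ E' := by
      refine lt_of_le_of_ne (le_inf (hD.trans le_sup_left) inf_le_right) fun heq => hy ?_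
      have : y ∈ (D ⊔ (ℝ ∙ y)) ⊓ E' :=
        ⟨Submodule.mem_sup_right (Submodule.mem_span_singleton_self y), hy'⟩
      exact (heq ▸ this).1
    have hfr := Submodule.finrank_lt_finrank_of_lt hlt'
    have hle : finrank ℝ ((D ⊔ (ℝ ∙ y)) ⊓ E' : Submodule ℝ V) ≤ k + 1 :=
      (Submodule.finrank_mono inf_le_right).trans hE'.le
    rw [← hDx, h D x y hDk hxD hyD]
    exact ih _ (by omega) (by rw [Submodule.finrank_sup_span_singleton hyD, hDk]) rfl

theorem directionSpace_eq_span_of_zero_mem {F : Set V} (h0 : (0 : V) ∈ F) :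
    directionSpace F = Submodule.span ℝ F :=
  le_antisymm (directionSpace_le Submodule.subset_span)
    (Submodule.span_le.2 fun x hx => by simpa using sub_mem_directionSpace hx h0)

variable [MeasurableSpace V] [BorelSpace V] [FiniteDimensional ℝ V]

theorem measureReal_face_pos {P : ConvexBody V} {F : Set V} {k : ℕ} (hF : F ∈ faces P k)
    (h0 : (0 : V) ∈ F) : 0 < (μHE[k] : Measure V).real F := by
  obtain ⟨r, hr⟩ := P.isBounded.subset_closedBall 0
  have hspan := directionSpace_eq_span_of_zero_mem h0
  have h1 := euclideanHausdorffMeasure_pos_of_convex (hF.1.convex P.convex) h0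
  rw [← hspan, hF.2.2] at h1
  have h2 := euclideanHausdorffMeasure_subspace_inter_closedBall_lt_top (directionSpace F) r
  rw [hF.2.2] at h2
  have hsub : F ⊆ (directionSpace F : Set V) ∩ closedBall 0 r := fun x hx =>
    ⟨hspan ▸ Submodule.subset_span hx, hr (hF.1.subset hx)⟩
  exact ENNReal.toReal_pos h1.ne' ((measure_mono hsub).trans_lt h2).ne

/-- If the normal cone of `F` is a half space of the orthogonal complement of `F`, and `e` is an
inner normal of this half space, then the contribution of `F` to the centroid has positive
component in direction `e`. -/
theorem faceMoment_pos {m : ℕ} [hm : Fact (finrank ℝ V = m + 1)] {P : ConvexBody V}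
    {F : Set V} {k : ℕ} (hF : F ∈ faces P k) (hk : k ≤ m) (h0 : (0 : V) ∈ F) {e w : V}
    (hw : w ∈ (directionSpace F)ᗮ) (hw0 : w ≠ 0)
    (he : ∀ u ∈ (directionSpace F)ᗮ, ⟪e, u⟫ = -⟪w, u⟫)
    (hP : ∀ u ∈ (directionSpace F)ᗮ, u ∈ normalCone F P ↔ ⟪w, u⟫ ≤ 0) :
    0 < faceMoment m k e P F := by
  refine mul_pos (measureReal_face_pos hF h0) ?_
  set E := directionSpace F with hE
  have hfin := euclideanHausdorffMeasure_normalCone_lt_top hF hk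
  set N : Set (sphere (0 : V) 1) := {u | (u : V) ∈ normalCone F P} with hN
  have hNE : ∀ u ∈ N, (u : V) ∈ Eᗮ := fun u hu => mem_orthogonal_of_mem_normalCone hF.1.subset hu
  have hNm : MeasurableSet N := (isClosed_setOf_mem_normalCone F P).measurableSet
  have hfinm : IsFiniteMeasure ((μHE[m - k] : Measure (sphere (0 : V) 1)).restrict N) :=
    isFiniteMeasure_restrict.2 hfin.ne
  have hint : IntegrableOn (fun u : sphere (0 : V) 1 => ⟪e, (u : V)⟫) N μHE[m - k] := by
    refine Integrable.of_bound (C := ‖e‖) (by fun_prop) (Eventually.of_forall fun u => ?_)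
    simpa using norm_inner_le_norm (𝕜 := ℝ) e (u : V)
  have hnn : 0 ≤ᵐ[(μHE[m - k] : Measure (sphere (0 : V) 1)).restrict N]
      fun u => ⟪e, (u : V)⟫ := by
    refine (ae_restrict_iff' hNm).2 (Eventually.of_forall fun u hu => ?_)
    have := (hP u (hNE u hu)).1 hu
    simp only [Pi.zero_apply, he u (hNE u hu)]
    linarith
  rw [setIntegral_pos_iff_support_of_nonneg_ae hnn hint]
  have hwE : w ∉ E := fun h => hw0 (Submodule.disjoint_def.1 E.orthogonal_disjoint w h hw)
  have hrank : finrank ℝ (E ⊔ (ℝ ∙ w) : Submodule ℝ V)ᗮ = m - k := by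
    have h1 := Submodule.finrank_sup_span_singleton hwE
    have h2 := (E ⊔ (ℝ ∙ w)).finrank_add_finrank_orthogonal
    have h3 := hm.out
    have h4 : finrank ℝ E = k := hF.2.2
    omega
  have hnw : 0 < ‖w‖ := norm_pos_iff.2 hw0
  set v : V := -(‖w‖⁻¹ • w) with hv
  have hv1 : ‖v‖ = 1 := by
    rw [hv, norm_neg, norm_smul, norm_inv, norm_norm, inv_mul_cancel₀ hnw.ne']
  have hvw : v ∈ (ℝ ∙ w) :=
    Submodule.neg_mem _ (Submodule.smul_mem _ _ (Submodule.mem_span_singleton_self w))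
  have hpos := euclideanHausdorffMeasure_openHemisphere_pos hv1 (W := (E ⊔ (ℝ ∙ w))ᗮ)
    (Submodule.orthogonal_le ((Submodule.span_singleton_le_iff_mem _ _).2
      (Submodule.mem_sup_right hvw)))
  rw [hrank] at hpos
  refine hpos.trans_le (measure_mono fun u hu => ?_)
  obtain ⟨hu1, hu2⟩ := hu
  have hle : (E ⊔ (ℝ ∙ w))ᗮ ⊔ (ℝ ∙ v) ≤ Eᗮ :=
    sup_le (Submodule.orthogonal_le le_sup_left) ((Submodule.span_singleton_le_iff_mem _ _).2
      (Submodule.neg_mem _ (Submodule.smul_mem _ _ hw)))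
  have huE : (u : V) ∈ Eᗮ := hle hu1
  have hwu : ⟪w, (u : V)⟫ < 0 := by
    rw [hv, inner_neg_left, real_inner_smul_left, neg_pos] at hu2
    exact neg_of_mul_neg_right hu2 (inv_nonneg.2 hnw.le)
  refine ⟨?_, (hP u huE).2 hwu.le⟩
  rw [Function.mem_support, he u huE]
  linarith

end Coefficients

/-! ### Exchange of a spanning vector -/

section Exchange

variable [MeasurableSpace V] [BorelSpace V] [FiniteDimensional ℝ V]
  {m : ℕ} [hm : Fact (finrank ℝ V = m + 1)]

/-- The vanishing of the centroid of the convex hull of `0`, `a`, `b` and vectors spanning `D`,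
which is symmetric under the reflection that exchanges `a` and `b`. -/
theorem coeff_eq_of_centroidMap_eq_zero {Ψ : ConvexBody V → SignedMeasure (sphere (0 : V) 1)}
    {c : Submodule ℝ V → ℝ} (hc : IsAngularWith Ψ c) (hC : centroidMap Ψ = 0) {k : ℕ}
    (hk : k + 1 ≤ m) {γ : ℕ → ℝ} (hγ : ∀ E : Submodule ℝ V, finrank ℝ E ≤ k → c E = γ (finrank ℝ E))
    {D : Submodule ℝ V} (hD : finrank ℝ D = k) {a b : V} (ha : a ∈ Dᗮ) (hb : b ∈ Dᗮ)
    (ha1 : ‖a‖ = 1) (hb1 : ‖b‖ = 1) (hab : b ∉ D ⊔ (ℝ ∙ a)) :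
    c (D ⊔ (ℝ ∙ a)) = c (D ⊔ (ℝ ∙ b)) := by
  have hnotD : ∀ x ∈ Dᗮ, ‖x‖ = 1 → x ∉ D := fun x hx hx1 h => by
    rw [Submodule.disjoint_def.1 D.orthogonal_disjoint x h hx, norm_zero] at hx1
    exact zero_ne_one hx1
  have haD := hnotD a ha ha1
  have hbD := hnotD b hb hb1
  set E₁ : Submodule ℝ V := D ⊔ (ℝ ∙ a) with hE₁
  set E₂ : Submodule ℝ V := D ⊔ (ℝ ∙ b) with hE₂
  have hr₁ : finrank ℝ E₁ = k + 1 := by rw [hE₁, Submodule.finrank_sup_span_singleton haD, hD]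
  have hr₂ : finrank ℝ E₂ = k + 1 := by rw [hE₂, Submodule.finrank_sup_span_singleton hbD, hD]
  have haE₁ : a ∈ E₁ := Submodule.mem_sup_right (Submodule.mem_span_singleton_self a)
  have hbE₂ : b ∈ E₂ := Submodule.mem_sup_right (Submodule.mem_span_singleton_self b)
  set e := a - b with he
  -- The body, and its symmetry.
  obtain ⟨S, hS⟩ := (IsNoetherian.noetherian D : D.FG)
  have hSD : ∀ x ∈ S, x ∈ D := fun x hx => hS ▸ Submodule.subset_span hx
  set s : Set V := insert 0 (insert a (insert b (S : Set V))) with hs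
  have hsf : s.Finite := ((S.finite_toSet.insert b).insert a).insert 0
  set P := polytope s hsf ⟨0, mem_insert _ _⟩ with hP
  have hPp : IsPolytope P := isPolytope_polytope hsf _
  have hsP : s ⊆ (P : Set V) := subset_convexHull ℝ s
  have ha_mem : a ∈ s := by simp [hs]
  have hb_mem : b ∈ s := by simp [hs]
  have h0_mem : (0 : V) ∈ s := by simp [hs]
  set R : V ≃ₗᵢ[ℝ] V := (ℝ ∙ e)ᗮ.reflection with hR
  have hRe : R e = -e := Submodule.reflection_orthogonalComplement_singleton_eq_neg e
  have hRa : R a = b := Submodule.reflection_sub (ha1.trans hb1.symm)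
  have hRb : R b = a := by rw [← hRa, hR, Submodule.reflection_reflection]
  have hRD : ∀ x ∈ D, R x = x := fun x hx => Submodule.reflection_mem_subspace_eq_self
    (Submodule.mem_orthogonal_singleton_iff_inner_left.2
      ((Submodule.mem_orthogonal _ _).1 (Submodule.sub_mem _ ha hb) x hx))
  have hRs : R '' s = s := by
    rw [hs, image_insert_eq, image_insert_eq, image_insert_eq, map_zero, hRa, hRb,
      image_congr (fun x hx => hRD x (hSD x hx)), image_id', insert_comm b a]
  have hRP : (P : Set V) = R '' P := by
    change convexHull ℝ s = R.toLinearEquiv.toLinearMap '' convexHull ℝ s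
    rw [LinearMap.image_convexHull]
    exact congrArg (convexHull ℝ) hRs.symm
  -- The subspace spanned by the body.
  have hface : ∀ {F : Set V}, IsExposed ℝ (P : Set V) F → F = convexHull ℝ (s ∩ F) :=
    fun hF => hF.eq_convexHull_inter hsf
  set E' : Submodule ℝ V := E₁ ⊔ (ℝ ∙ b) with hE'
  have hr' : finrank ℝ E' = k + 2 := by rw [hE', Submodule.finrank_sup_span_singleton hab, hr₁]
  have hPE' : (P : Set V) ⊆ E' := by
    refine convexHull_min ?_ E'.convex
    have haE' : a ∈ E' := Submodule.mem_sup_left haE₁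
    have hbE' : b ∈ E' := Submodule.mem_sup_right (Submodule.mem_span_singleton_self b)
    simp only [hs, insert_subset_iff, SetLike.mem_coe]
    exact ⟨E'.zero_mem, haE', hbE', fun x hx =>
      Submodule.mem_sup_left (Submodule.mem_sup_left (hSD x hx))⟩
  have heE' : e ∈ E' := E'.sub_mem (hPE' (hsP ha_mem)) (hPE' (hsP hb_mem))
  -- Only the faces of dimension `k + 1` contribute to the component of the centroid along `e`.
  have hsum : ∑ᶠ F ∈ faces P (k + 1), c (directionSpace F) * faceMoment m (k + 1) e P F = 0 := by
    have h := inner_centroidMap_eq_sum (m := m) hc hPp e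
    rw [hC, Pi.zero_apply, inner_zero_right, Finset.sum_eq_single (k + 1)] at h
    · have hpos : (0 : ℝ) < (((m + 1 - (k + 1) : ℕ) : ℝ) *
          unitBallVolume (m + 1 - (k + 1)))⁻¹ :=
        inv_pos.2 (mul_pos (Nat.cast_pos.2 (by omega)) (unitBallVolume_pos _))
      exact (mul_eq_zero.1 h.symm).resolve_left hpos.ne'
    · intro j _ hj
      refine mul_eq_zero_of_right _ ?_
      rcases lt_or_gt_of_ne hj with hj | hj
      · rw [finsum_mem_congr rfl (g := fun F => γ j * faceMoment m j e P F) fun F hF => by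
          rw [hγ _ (by rw [hF.2.2]; omega), hF.2.2], ← mul_finsum_mem' _ _ (finite_faces hPp j),
          finsum_faceMoment_eq_zero m j hPp R hRP hRe, mul_zero]
      · refine finsum_mem_eq_zero_of_forall_eq_zero fun F hF => mul_eq_zero_of_right _
          (faceMoment_eq_zero m j hF.1.subset ?_)
        rwa [Submodule.eq_of_le_of_finrank_le (directionSpace_le (hF.1.subset.trans hPE'))
          (by rw [hF.2.2, hr']; omega)]
    · intro h
      exact absurd (Finset.mem_range.2 (by omega)) h
  -- By symmetry, subtracting a constant from all coefficients does not change the sum.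
  have hsum' : ∑ᶠ F ∈ faces P (k + 1),
      (c (directionSpace F) - c E₂) * faceMoment m (k + 1) e P F = 0 := by
    simp only [sub_mul]
    rw [finsum_mem_sub_distrib _ _ (finite_faces hPp _), hsum,
      ← mul_finsum_mem' _ _ (finite_faces hPp _), finsum_faceMoment_eq_zero m _ hPp R hRP hRe,
      mul_zero, sub_zero]
  -- The face opposite to `b`.
  set w := b - E₁.starProjection b with hw
  have hwE : w ∈ E₁ᗮ := E₁.sub_starProjection_mem_orthogonal b
  have hw0 : w ≠ 0 := fun h => hab (by
    rw [sub_eq_zero.1 (hw ▸ h : b - E₁.starProjection b = 0)]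
    exact E₁.starProjection_apply_mem b)
  have hbu : ∀ u ∈ E₁ᗮ, ⟪b, u⟫ = ⟪w, u⟫ := fun u hu => by
    rw [hw, inner_sub_left, (Submodule.mem_orthogonal _ _).1 hu _ (E₁.starProjection_apply_mem b),
      sub_zero]
  have hsE₁ : ∀ x ∈ s, x ≠ b → x ∈ E₁ := by
    rintro x (rfl | rfl | rfl | hx) hxb
    · exact E₁.zero_mem
    · exact haE₁
    · exact absurd rfl hxb
    · exact Submodule.mem_sup_left (hSD x hx)
  have hsE₂ : ∀ x ∈ s, x ≠ a → x ∈ E₂ := by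
    rintro x (rfl | rfl | rfl | hx) hxa
    · exact E₂.zero_mem
    · exact absurd rfl hxa
    · exact hbE₂
    · exact Submodule.mem_sup_left (hSD x hx)
  have hle : ∀ u ∈ E₁ᗮ, ⟪w, u⟫ ≤ 0 → ∀ z ∈ (P : Set V), ⟪z, u⟫ ≤ 0 := by
    intro u hu hwu z hz
    have hconv : Convex ℝ {z : V | ⟪z, u⟫ ≤ 0} := by
      simp only [real_inner_comm u]
      exact convex_halfSpace_le (innerSL ℝ u).isLinear 0
    refine convexHull_min (fun x hx => ?_) hconv hz
    by_cases hxb : x = b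
    · rw [mem_ofPred_eq, hxb, hbu u hu]
      exact hwu
    · exact ((Submodule.mem_orthogonal _ _).1 hu x (hsE₁ x hx hxb)).le
  set F₁ : Set V := (-(innerSL ℝ w)).toExposed (P : Set V) with hF₁
  have hF₁e : IsExposed ℝ (P : Set V) F₁ := ContinuousLinearMap.toExposed.isExposed
  have hwz : ∀ z ∈ (P : Set V), 0 ≤ ⟪w, z⟫ := fun z hz => by
    have := hle (-w) (Submodule.neg_mem _ hwE) (by
      rw [inner_neg_right, neg_nonpos]
      exact real_inner_self_nonneg) z hz
    rwa [inner_neg_right, neg_nonpos, real_inner_comm] at this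
  have hmemF₁ : ∀ x, x ∈ F₁ ↔ x ∈ (P : Set V) ∧ ⟪w, x⟫ ≤ 0 := by
    intro x
    refine and_congr_right fun hx => ⟨fun h => ?_, fun h y hy => ?_⟩
    · simpa using h 0 (hsP h0_mem)
    · have := hwz y hy
      simp only [neg_apply, innerSL_apply_apply]
      linarith
  have hbF₁ : b ∉ F₁ := fun h => by
    have h1 := ((hmemF₁ b).1 h).2
    rw [real_inner_comm, hbu w hwE] at h1
    exact hw0 (real_inner_self_nonpos.1 h1)
  have hsubE₁ : ∀ {F : Set V}, IsExposed ℝ (P : Set V) F → b ∉ F → F ⊆ E₁ := fun hF hbF => by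
    rw [hface hF]
    exact convexHull_min (fun x hx => hsE₁ x hx.1 fun h => hbF (h ▸ hx.2)) E₁.convex
  have hF₁E := hsubE₁ hF₁e hbF₁
  have hE₁F : ∀ x ∈ s, x ∈ E₁ → x ∈ F₁ := fun x hx hxE => (hmemF₁ x).2
    ⟨hsP hx, (Submodule.inner_left_of_mem_orthogonal hxE hwE).le⟩
  have h0F₁ : (0 : V) ∈ F₁ := hE₁F 0 h0_mem E₁.zero_mem
  have hdirF₁ : directionSpace F₁ = E₁ := by
    refine le_antisymm (directionSpace_le hF₁E) ?_
    rw [directionSpace_eq_span_of_zero_mem h0F₁, hE₁, ← hS]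
    refine sup_le (Submodule.span_mono fun x hx => ?_) ?_
    · exact hE₁F x (by simp [hs, Finset.mem_coe.1 hx]) (Submodule.mem_sup_left (hSD x hx))
    · exact (Submodule.span_singleton_le_iff_mem _ _).2
        (Submodule.subset_span (hE₁F a ha_mem haE₁))
  have hF₁f : F₁ ∈ faces P (k + 1) := ⟨hF₁e, ⟨0, h0F₁⟩, by rw [hdirF₁, hr₁]⟩
  have hpos : 0 < faceMoment m (k + 1) e P F₁ := by
    refine faceMoment_pos hF₁f hk h0F₁ (w := w) (hdirF₁ ▸ hwE) hw0 ?_ ?_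
    · intro u hu
      rw [hdirF₁] at hu
      rw [he, inner_sub_left, hbu u hu, (Submodule.mem_orthogonal _ _).1 hu a haE₁, zero_sub]
    · intro u hu
      rw [hdirF₁] at hu
      refine ⟨fun h => ?_, fun h x hx z hz => ?_⟩
      · simpa [hbu u hu] using h 0 h0F₁ b (hsP hb_mem)
      · rw [inner_sub_left, (Submodule.mem_orthogonal _ _).1 hu x (hF₁E hx), sub_zero]
        exact hle u hu h z hz
  -- A face that contains `a` and `b` contributes nothing along `a - b`, and one without `a` is
  -- parallel to `E₂`.
  have hother : ∀ F ∈ faces P (k + 1), F ≠ F₁ →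
      (c (directionSpace F) - c E₂) * faceMoment m (k + 1) e P F = 0 := by
    intro F hF hne
    by_cases haF : a ∈ F
    · by_cases hbF : b ∈ F
      · exact mul_eq_zero_of_right _ (faceMoment_eq_zero m _ hF.1.subset
          (sub_mem_directionSpace haF hbF))
      · have hFE := hsubE₁ hF.1 hbF
        have hdir : directionSpace F = E₁ :=
          Submodule.eq_of_le_of_finrank_eq (directionSpace_le hFE) (hF.2.2.trans hr₁.symm)
        refine absurd (Subset.antisymm (fun x hx => ?_) fun x hx => ?_) hne
        · exact mem_of_sub_mem_directionSpace hF₁e h0F₁ (hF.1.subset hx)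
            (by rw [sub_zero, hdirF₁]; exact hFE hx)
        · exact mem_of_sub_mem_directionSpace hF.1 haF (hF₁e.subset hx)
            (by rw [hdir]; exact E₁.sub_mem (hF₁E hx) haE₁)
    · have hFE : F ⊆ E₂ := by
        rw [hface hF.1]
        exact convexHull_min (fun x hx => hsE₂ x hx.1 fun h => haF (h ▸ hx.2)) E₂.convex
      rw [Submodule.eq_of_le_of_finrank_eq (directionSpace_le hFE) (hF.2.2.trans hr₂.symm),
        sub_self, zero_mul]
  rw [finsum_eq_single (fun F => ∑ᶠ _ : F ∈ faces P (k + 1),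
    (c (directionSpace F) - c E₂) * faceMoment m (k + 1) e P F) F₁ fun F hne =>
      (finsum_congr fun hF : F ∈ faces P (k + 1) => hother F hF hne).trans finsum_zero] at hsum'
  simp only [hF₁f, finsum_true, hdirF₁] at hsum'
  exact sub_eq_zero.1 ((mul_eq_zero.1 hsum').resolve_right hpos.ne')

/-- Reduction of the exchange of arbitrary vectors `x`, `y` to that of unit vectors orthogonal
to `D`. -/
theorem coeff_sup_span_singleton_eq {Ψ : ConvexBody V → SignedMeasure (sphere (0 : V) 1)}
    {c : Submodule ℝ V → ℝ} (hc : IsAngularWith Ψ c) (hC : centroidMap Ψ = 0) {k : ℕ}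
    (hk : k + 1 ≤ m) {γ : ℕ → ℝ} (hγ : ∀ E : Submodule ℝ V, finrank ℝ E ≤ k → c E = γ (finrank ℝ E))
    {D : Submodule ℝ V} {x y : V} (hD : finrank ℝ D = k) (hx : x ∉ D) (hy : y ∉ D) :
    c (D ⊔ (ℝ ∙ x)) = c (D ⊔ (ℝ ∙ y)) := by
  have key : ∀ x ∉ D, ∃ a ∈ Dᗮ, ‖a‖ = 1 ∧ D ⊔ (ℝ ∙ a) = D ⊔ (ℝ ∙ x) := by
    intro x hx
    set z := x - D.starProjection x with hz
    have hz0 : z ≠ 0 := fun h => hx (by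
      rw [sub_eq_zero.1 (hz ▸ h : x - D.starProjection x = 0)]
      exact D.starProjection_apply_mem x)
    have hzD : z ∈ Dᗮ := D.sub_starProjection_mem_orthogonal x
    have ha : ‖z‖⁻¹ • z ∈ Dᗮ := Submodule.smul_mem _ _ hzD
    have ha1 : ‖‖z‖⁻¹ • z‖ = 1 := by
      rw [norm_smul, norm_inv, norm_norm, inv_mul_cancel₀ (norm_ne_zero_iff.2 hz0)]
    refine ⟨_, ha, ha1, sup_span_singleton_eq_of_mem hx (fun h => ?_) ?_⟩
    · rw [Submodule.disjoint_def.1 D.orthogonal_disjoint _ h ha, norm_zero] at ha1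
      exact zero_ne_one ha1
    · exact Submodule.smul_mem _ _ (Submodule.sub_mem _
        (Submodule.mem_sup_right (Submodule.mem_span_singleton_self x))
        (Submodule.mem_sup_left (D.starProjection_apply_mem x)))
  obtain ⟨a, ha, ha1, hax⟩ := key x hx
  obtain ⟨b, hb, hb1, hby⟩ := key y hy
  rw [← hax, ← hby]
  by_cases hab : b ∈ D ⊔ (ℝ ∙ a)
  · rw [hax, hby, sup_span_singleton_eq_of_mem hx hy]
    rw [← hax]
    have : y ∈ D ⊔ (ℝ ∙ b) := by
      rw [hby]
      exact Submodule.mem_sup_right (Submodule.mem_span_singleton_self y)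
    exact sup_le le_sup_left ((Submodule.span_singleton_le_iff_mem _ _).2 hab) this
  · exact coeff_eq_of_centroidMap_eq_zero hc hC hk hγ hD ha hb ha1 hb1 hab

/-- If the centroid map vanishes, the coefficients of an angular area measure depend on the
dimension of the subspace alone. -/
theorem exists_coeff_eq {Ψ : ConvexBody V → SignedMeasure (sphere (0 : V) 1)}
    {c : Submodule ℝ V → ℝ} (hc : IsAngularWith Ψ c) (hC : centroidMap Ψ = 0) {k : ℕ}
    (hk : k ≤ m) : ∃ γ : ℕ → ℝ, ∀ E : Submodule ℝ V, finrank ℝ E ≤ k → c E = γ (finrank ℝ E) := by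
  induction k with
  | zero =>
    refine ⟨fun _ => c ⊥, fun E hE => ?_⟩
    rw [Submodule.finrank_eq_zero.1 (Nat.le_zero.1 hE)]
  | succ k ih =>
    obtain ⟨γ, hγ⟩ := ih (by omega)
    by_cases h₀ : ∃ E₀ : Submodule ℝ V, finrank ℝ E₀ = k + 1
    · obtain ⟨E₀, hE₀⟩ := h₀
      refine ⟨fun j => if j ≤ k then γ j else c E₀, fun E hE => ?_⟩
      by_cases h : finrank ℝ E ≤ k
      · simp only [h, if_true, hγ E h]
      · simp only [h, if_false]
        exact eq_of_forall_sup_span_singleton_eq (fun D x y hD hx hy =>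
          coeff_sup_span_singleton_eq hc hC hk hγ hD hx hy) (by omega) hE₀
    · refine ⟨γ, fun E hE => hγ E (Nat.lt_succ_iff.1 (lt_of_le_of_ne hE fun h => h₀ ⟨E, h⟩))⟩

end Exchange

/-! ### Flat densities of angular area measures -/

section FlatDensity

theorem footPoint_image {P Q : ConvexBody V} (T : V ≃ₗᵢ[ℝ] V) (h : (Q : Set V) = T '' P) (y : V) :
    footPoint Q (T y) = T (footPoint P y) := by
  refine eq_footPoint Q (h ▸ mem_image_of_mem T (footPoint_mem P y)) fun z hz => ?_
  rw [h] at hz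
  obtain ⟨z, hz, rfl⟩ := hz
  rw [← map_sub, ← map_sub, T.inner_map_map, real_inner_comm]
  exact footPoint_inner_le P y hz

theorem infDist_image_linearIsometryEquiv {P Q : ConvexBody V} (T : V ≃ₗᵢ[ℝ] V)
    (h : (Q : Set V) = T '' P) (y : V) : infDist (T y) (Q : Set V) = infDist y (P : Set V) := by
  rw [infDist_eq_norm, footPoint_image T h, ← map_sub, T.norm_map, infDist_eq_norm]

theorem preimage_shell {P Q : ConvexBody V} (T : V ≃ₗᵢ[ℝ] V) (h : (Q : Set V) = T '' P) :
    T ⁻¹' shell Q = shell P := by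
  ext y
  simp only [shell, mem_preimage, mem_ofPred_eq, infDist_image_linearIsometryEquiv T h]

/-- Over points that project into a flat convex body, the metric projection is linear. -/
theorem footPoint_eq_starProjection {E : Submodule ℝ V} [E.HasOrthogonalProjection]
    {P : ConvexBody V} (hPE : (P : Set V) ⊆ E) {y : V} (hy : E.starProjection y ∈ (P : Set V)) :
    footPoint P y = E.starProjection y :=
  eq_footPoint P hy fun _ hz => ((Submodule.mem_orthogonal _ _).1
    (E.sub_starProjection_mem_orthogonal y) _ (E.sub_mem (hPE hz) (hPE hy))).le

theorem starProjection_eq_footPoint {E : Submodule ℝ V} [E.HasOrthogonalProjection]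
    {P : ConvexBody V} (hPE : (P : Set V) ⊆ E) {y : V} (hy : 0 < infDist y (P : Set V))
    (hu : outerNormal P y ∈ Eᗮ) : E.starProjection y = footPoint P y := by
  have h : y - footPoint P y ∈ Eᗮ := by
    rw [← infDist_smul_outerNormal P hy]
    exact Submodule.smul_mem _ _ hu
  have h1 := congrArg E.starProjection (sub_add_cancel y (footPoint P y))
  rw [map_add, (E.starProjection_apply_eq_zero_iff).2 h, zero_add,
    Submodule.starProjection_eq_self_iff.2 (hPE (footPoint_mem P y))] at h1
  exact h1.symm

variable [FiniteDimensional ℝ V] {m : ℕ} [hm : Fact (finrank ℝ V = m + 1)]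

theorem normalDirection_image {P Q : ConvexBody V} (T : V ≃ₗᵢ[ℝ] V) (h : (Q : Set V) = T '' P)
    {y : V} (hy : 0 < infDist y (P : Set V)) :
    normalDirection m Q (T y) = sphereIsometry T (normalDirection m P y) := by
  refine Subtype.ext ?_
  rw [coe_sphereIsometry, coe_normalDirection hy,
    coe_normalDirection (by rwa [infDist_image_linearIsometryEquiv T h]), outerNormal, outerNormal,
    infDist_image_linearIsometryEquiv T h, footPoint_image T h, map_smul, map_sub]

/-- A unit vector `u` orthogonal to `E` extends to an orthonormal basis whose `0`-th vector is `u`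
and whose next vectors form a basis of `E`. -/
theorem exists_adapted_orthonormalBasis {E : Submodule ℝ V} {k : ℕ} (hE : finrank ℝ E = k)
    (hk : k ≤ m) {u : V} (hu : ‖u‖ = 1) (huE : u ∈ Eᗮ) :
    ∃ b : OrthonormalBasis (Fin (m + 1)) ℝ V, b 0 = u ∧
      Submodule.span ℝ ((fun j : Fin m => b j.succ) ''
        (Finset.univ.filter fun j : Fin m => (j : ℕ) < k)) = E := by
  set e := (stdOrthonormalBasis ℝ E).reindex (finCongr hE) with he
  set v : Fin (m + 1) → V := Fin.cons u fun j : Fin m =>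
    if h : (j : ℕ) < k then (e ⟨j, h⟩ : V) else 0 with hv
  have horth : Orthonormal ℝ
      (({i : Fin (m + 1) | (i : ℕ) ≤ k} : Set (Fin (m + 1))).domRestrict v) := by
    have hue : ∀ j, ⟪u, (e j : V)⟫ = 0 := fun j =>
      Submodule.inner_left_of_mem_orthogonal (e j).2 huE
    rw [orthonormal_iff_ite]
    rintro ⟨i, hi⟩ ⟨j, hj⟩
    simp only [domRestrict_apply, Subtype.mk.injEq]
    revert hi hj
    refine Fin.cases ?_ (fun i => ?_) i <;> refine Fin.cases ?_ (fun j => ?_) j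
    · intro _ _
      simp [hv, hu]
    · intro _ hj
      have hj : (j : ℕ) < k := by simpa using hj
      simp [hv, hj, hue, (Fin.succ_ne_zero j).symm]
    · intro hi _
      have hi : (i : ℕ) < k := by simpa using hi
      simp [hv, hi, real_inner_comm u, hue]
    · intro hi hj
      have hi : (i : ℕ) < k := by simpa using hi
      have hj : (j : ℕ) < k := by simpa using hj
      have := orthonormal_iff_ite.1 e.orthonormal ⟨i, hi⟩ ⟨j, hj⟩
      simp only [hv, Fin.cons_succ, hi, hj, dif_pos, Fin.succ_inj]
      rw [← Submodule.coe_inner, this]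
      simp [Fin.ext_iff]
  obtain ⟨b, hb⟩ := horth.exists_orthonormalBasis_extension_of_card_eq
    (by rw [hm.out, Fintype.card_fin])
  refine ⟨b, (hb 0 (Nat.zero_le _)).trans rfl, Submodule.eq_of_le_of_finrank_eq ?_ ?_⟩
  · rw [Submodule.span_le]
    rintro _ ⟨j, hj, rfl⟩
    have hj : (j : ℕ) < k := by simpa using hj
    change b j.succ ∈ E
    rw [hb j.succ (by simpa using hj)]
    simp [hv, hj]
  · rw [finrank_span_image_succ, hE, Fin.card_filter_val_lt, min_eq_right hk]

theorem exists_linearIsometryEquiv_map_eq {E₁ E₂ : Submodule ℝ V} {k : ℕ} (h₁ : finrank ℝ E₁ = k)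
    (h₂ : finrank ℝ E₂ = k) (hk : k ≤ m) {u₁ u₂ : V} (hu₁ : ‖u₁‖ = 1) (hu₂ : ‖u₂‖ = 1)
    (huE₁ : u₁ ∈ E₁ᗮ) (huE₂ : u₂ ∈ E₂ᗮ) :
    ∃ T : V ≃ₗᵢ[ℝ] V, T u₁ = u₂ ∧ E₁.map (T.toLinearEquiv : V →ₗ[ℝ] V) = E₂ := by
  obtain ⟨b₁, hb₁, hs₁⟩ := exists_adapted_orthonormalBasis h₁ hk hu₁ huE₁
  obtain ⟨b₂, hb₂, hs₂⟩ := exists_adapted_orthonormalBasis h₂ hk hu₂ huE₂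
  have hT : ∀ i, b₁.equiv b₂ (Equiv.refl _) (b₁ i) = b₂ i := fun i => by simp
  refine ⟨b₁.equiv b₂ (Equiv.refl _), by rw [← hb₁, ← hb₂, hT], ?_⟩
  rw [← hs₁, ← hs₂, Submodule.map_span, image_image]
  congr 1
  exact image_congr fun j _ => hT j.succ

variable [MeasurableSpace V] [BorelSpace V]

/-- Over a convex body `P` in `E`, the points whose outer normal is orthogonal to `E` project
orthogonally into `P`. Outside the frontier of the convex set of points that project into `P`,
which is a null set, the metric projection is locally the orthogonal projection onto `E`. -/
theorem ae_normalCycleDensity_eq_flatDensity (η : InvariantForm V m) {E : Submodule ℝ V} {k : ℕ}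
    (hE : finrank ℝ E = k) (hk : k ≤ m) {P : ConvexBody V} (hPE : (P : Set V) ⊆ E) :
    ∀ᵐ y : V, y ∈ shell P → (normalDirection m P y : V) ∈ Eᗮ → normalCycleDensity η P y =
      (infDist y (P : Set V))⁻¹ ^ (m - k) * flatDensity η E (normalDirection m P y) := by
  set C : Set V := E.starProjection ⁻¹' (P : Set V) with hC
  have hCconv : Convex ℝ C := P.convex.linear_preimage E.starProjection.toLinearMap
  have hfr : ∀ᵐ y : V, y ∉ frontier C := measure_eq_zero_iff_ae_notMem.1
    (hCconv.addHaar_frontier volume)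
  filter_upwards [hfr] with y hy hs hu
  have hd : 0 < infDist y (P : Set V) := one_pos.trans hs.1
  rw [coe_normalDirection hd] at hu
  have hyC : y ∈ C := by
    rw [hC, mem_preimage, starProjection_eq_footPoint hPE hd hu]
    exact footPoint_mem P y
  have hint : y ∈ interior C := by
    by_contra h
    exact hy ⟨subset_closure hyC, h⟩
  have hL : HasFDerivAt (footPoint P) E.starProjection y :=
    E.starProjection.hasFDerivAt.congr_of_eventuallyEq
      (Filter.mem_of_superset (mem_interior_iff_mem_nhds.1 hint)
        fun _ hz => footPoint_eq_starProjection hPE hz)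
  obtain ⟨b, hb, hspan⟩ := exists_adapted_orthonormalBasis hE hk (norm_outerNormal P hd) hu
  set I : Finset (Fin m) := Finset.univ.filter fun j : Fin m => (j : ℕ) < k with hI
  have hmem : ∀ j ∈ I, b j.succ ∈ E := fun j hj =>
    hspan ▸ Submodule.subset_span ⟨j, hj, rfl⟩
  have horth : ∀ j ∉ I, b j.succ ∈ Eᗮ := fun j hj => by
    have : E ≤ (ℝ ∙ b j.succ)ᗮ := by
      rw [← hspan, Submodule.span_le]
      rintro _ ⟨i, hi, rfl⟩
      exact Submodule.mem_orthogonal_singleton_iff_inner_left.2 (b.inner_eq_zero fun h =>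
        hj (Fin.succ_injective m h ▸ hi))
    exact (Submodule.mem_orthogonal _ _).2 fun v hv =>
      Submodule.mem_orthogonal_singleton_iff_inner_left.1 (this hv)
  have hl : ∀ j, E.starProjection (b j.succ) = (if j ∈ I then (1 : ℝ) else 0) • b j.succ := by
    intro j
    by_cases hj : j ∈ I
    · rw [if_pos hj, one_smul, Submodule.starProjection_eq_self_iff.2 (hmem j hj)]
    · rw [if_neg hj, zero_smul, (E.starProjection_apply_eq_zero_iff).2 (horth j hj)]
  -- With eigenvalues `1` on `E` and `0` on `Eᗮ`, only the summand of `E` is left.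
  have h := shellDensity_eq_sum η ⟨y, hs⟩ hL b (fun j => if j ∈ I then (1 : ℝ) else 0) hb hl
  rw [← normalCycleDensity_coe, ← normalDirection_eq_shellToBundle (m := m),
    Finset.sum_eq_single I] at h
  · rw [h, hspan, Finset.prod_congr rfl fun j hj => if_pos hj, Finset.prod_const_one, one_mul,
      Finset.prod_congr rfl (g := fun _ => (infDist y (P : Set V))⁻¹) fun j hj => by
        rw [if_neg (Finset.mem_compl.1 hj), sub_zero, mul_one], Finset.prod_const,
      Finset.card_compl, Fintype.card_fin, hI, Fin.card_filter_val_lt, min_eq_right hk]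
  · intro J _ hJ
    by_cases hJI : J ⊆ I
    · obtain ⟨j, hjI, hjJ⟩ := Finset.exists_of_ssubset (Finset.ssubset_iff_subset_ne.2 ⟨hJI, hJ⟩)
      rw [Finset.prod_eq_zero (Finset.mem_compl.2 hjJ) (by rw [if_pos hjI, sub_self, mul_zero]),
        mul_zero, zero_mul]
    · obtain ⟨j, hjJ, hjI⟩ := Finset.not_subset.1 hJI
      rw [Finset.prod_eq_zero hjJ (if_neg hjI), zero_mul, zero_mul]
  · exact fun h => absurd (Finset.mem_univ I) h

end FlatDensity

/-! ### Comparison of flat polytopes -/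

section FlatDensityConstant

/-- If the coefficients of an angular area measure depend on the dimension alone, then the measure
of polytopes is equivariant under linear isometries. -/
theorem apply_image_eq [MeasurableSpace V] [BorelSpace V] {m : ℕ}
    [hm : Fact (finrank ℝ V = m + 1)] {Ψ : ConvexBody V → SignedMeasure (sphere (0 : V) 1)}
    {c : Submodule ℝ V → ℝ} (hc : IsAngularWith Ψ c) {γ : ℕ → ℝ}
    (hγ : ∀ E : Submodule ℝ V, finrank ℝ E ≤ m → c E = γ (finrank ℝ E)) {P Q : ConvexBody V}
    (hP : IsPolytope P) (hQ : IsPolytope Q) (T : V ≃ₗᵢ[ℝ] V) (h : (Q : Set V) = T '' P)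
    {A : Set (sphere (0 : V) 1)} (hA : MeasurableSet A) :
    Ψ Q (sphereIsometry T '' A) = Ψ P A := by
  have hTA : MeasurableSet (sphereIsometry T '' A) :=
    (sphereIsometry T).toHomeomorph.measurableEmbedding.measurableSet_image.2 hA
  rw [hc P hP A hA, hc Q hQ _ hTA]
  refine Finset.sum_congr rfl fun k hk => ?_
  have hkm : k ≤ m := by have := hm.out; have := Finset.mem_range.1 hk; omega
  rw [finsum_mem_faces_eq T h]
  refine finsum_mem_congr rfl fun F hF => ?_
  have hr := finrank_directionSpace_image T F
  rw [measureReal_image, measureReal_normalCone_image T h, hγ _ (hr.trans_le (hF.2.2.trans_le hkm)),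
    hγ _ (hF.2.2.trans_le hkm), hr]

variable [FiniteDimensional ℝ V] {m : ℕ} [hm : Fact (finrank ℝ V = m + 1)]

/-- The points of the shell whose outer normal is orthogonal to `E` and close to `u` contain an open
set: `P` has interior points relative to `E`, and over them the shell looks like an orthogonal
product. -/
theorem exists_mem_nhds_shell {E : Submodule ℝ V} {P : ConvexBody V} (hPE : (P : Set V) ⊆ E)
    (h0 : (0 : V) ∈ (P : Set V)) (hspan : E ≤ Submodule.span ℝ (P : Set V))
    {u : sphere (0 : V) 1} (hu : (u : V) ∈ Eᗮ) {U : Set (sphere (0 : V) 1)} (hU : U ∈ 𝓝 u) :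
    ∃ y : V, shell P ∩ normalDirection m P ⁻¹' {v | (v : V) ∈ Eᗮ ∧ v ∈ U} ∈ 𝓝 y := by
  set C : Set V := E.starProjection ⁻¹' (P : Set V) with hC
  have hCconv : Convex ℝ C := P.convex.linear_preimage E.starProjection.toLinearMap
  have h0C : (0 : V) ∈ C := by simpa [hC] using h0
  have hCspan : affineSpan ℝ C = ⊤ := by
    rw [AffineSubspace.affineSpan_eq_top_iff_vectorSpan_eq_top_of_nonempty ℝ V V ⟨0, h0C⟩]
    have hC' : C ⊆ vectorSpan ℝ C := fun x hx => by
      rw [vectorSpan_def]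
      exact Submodule.subset_span ⟨x, hx, 0, h0C, sub_zero x⟩
    refine top_unique ?_
    rw [← E.sup_orthogonal_of_hasOrthogonalProjection]
    refine sup_le (hspan.trans (Submodule.span_le.2 fun x hx => hC' ?_)) fun x hx => hC' ?_
    · rwa [hC, mem_preimage, Submodule.starProjection_eq_self_iff.2 (hPE hx)]
    · rwa [hC, mem_preimage, E.starProjection_apply_eq_zero_iff.2 hx]
  obtain ⟨x, hx⟩ := hCconv.interior_nonempty_iff_affineSpan_eq_top.2 hCspan
  have hxC := interior_subset hx
  -- The point at distance `3 / 2` from the projection of `x`, in direction `u`.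
  set y : V := E.starProjection x + (3 / 2 : ℝ) • (u : V) with hy
  have hEy : E.starProjection y = E.starProjection x := by
    rw [hy, map_add, map_smul, E.starProjection_apply_eq_zero_iff.2 hu, smul_zero, add_zero]
    exact Submodule.starProjection_eq_self_iff.2 (E.starProjection_apply_mem x)
  have hCy : C ∈ 𝓝 y := by
    have hcont : Continuous fun z : V => z - y + x := by fun_prop
    have h1 : Tendsto (fun z : V => z - y + x) (𝓝 y) (𝓝 x) := by
      simpa using hcont.tendsto y
    filter_upwards [h1 (mem_interior_iff_mem_nhds.1 hx)] with z hz
    simpa [hC, map_add, map_sub, hEy] using hz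
  have hfoot : ∀ z ∈ C, footPoint P z = E.starProjection z := fun z hz =>
    footPoint_eq_starProjection hPE hz
  have hfy : footPoint P y = E.starProjection x := by rw [hfoot y (mem_of_mem_nhds hCy), hEy]
  have hdy : infDist y (P : Set V) = 3 / 2 := by
    rw [infDist_eq_norm, hfy, hy, add_sub_cancel_left, norm_smul, norm_eq_of_mem_sphere, mul_one]
    norm_num
  have hd0 : 0 < infDist y (P : Set V) := by rw [hdy]; norm_num
  have hny : normalDirection m P y = u := Subtype.ext (by
    rw [coe_normalDirection hd0, outerNormal, hdy, hfy, hy, add_sub_cancel_left, smul_smul]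
    norm_num)
  have hcd : ContinuousAt (fun z => infDist z (P : Set V)) y :=
    (continuous_infDist_pt (P : Set V)).continuousAt
  have hpos : ∀ᶠ z in 𝓝 y, 0 < infDist z (P : Set V) := hcd.eventually_const_lt hd0
  have hcn : ContinuousAt (normalDirection m P) y := by
    refine Topology.IsInducing.subtypeVal.continuousAt_iff.2 ?_
    have h1 : ContinuousAt (outerNormal P) y := (hcd.inv₀ hd0.ne').smul
      (continuousAt_id.sub (lipschitzWith_footPoint P).continuous.continuousAt)
    refine h1.congr ?_
    filter_upwards [hpos] with z hz using (coe_normalDirection hz).symm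
  refine ⟨y, ?_⟩
  filter_upwards [hCy, hpos,
    hcd.eventually_const_lt (by rw [hdy]; norm_num : 1 < infDist y (P : Set V)),
    hcd.eventually_lt_const (by rw [hdy]; norm_num : infDist y (P : Set V) < 2),
    hcn (by rw [hny]; exact hU)] with z hzC hz0 hz1 hz2 hzU
  refine ⟨⟨hz1, hz2⟩, ?_, hzU⟩
  rw [coe_normalDirection hz0, outerNormal, hfoot z hzC]
  exact Submodule.smul_mem _ _ (E.sub_starProjection_mem_orthogonal z)

variable [MeasurableSpace V] [BorelSpace V]

theorem normalCycle_flat_eq (η : InvariantForm V m) {E : Submodule ℝ V} {k : ℕ}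
    (hE : finrank ℝ E = k) (hk : k ≤ m) {P : ConvexBody V} (hPE : (P : Set V) ⊆ E)
    {A : Set (sphere (0 : V) 1)} (hA : MeasurableSet A) (hAE : ∀ u ∈ A, (u : V) ∈ Eᗮ) :
    IntegrableOn (fun y => (infDist y (P : Set V))⁻¹ ^ (m - k) *
        flatDensity η E (normalDirection m P y)) (shell P ∩ normalDirection m P ⁻¹' A) ∧
    normalCycle η P (Prod.snd ⁻¹' A) = ∫ y in shell P ∩ normalDirection m P ⁻¹' A,
      (infDist y (P : Set V))⁻¹ ^ (m - k) * flatDensity η E (normalDirection m P y) := by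
  have hm' : MeasurableSet (shell P ∩ normalDirection m P ⁻¹' A) :=
    (measurableSet_shell P).inter (measurable_normalDirection P hA)
  have hae : ∀ᵐ y : V, y ∈ shell P ∩ normalDirection m P ⁻¹' A → normalCycleDensity η P y =
      (infDist y (P : Set V))⁻¹ ^ (m - k) * flatDensity η E (normalDirection m P y) := by
    filter_upwards [ae_normalCycleDensity_eq_flatDensity η hE hk hPE] with y hy hyA
      using hy hyA.1 (hAE _ hyA.2)
  refine ⟨?_, ?_⟩
  · exact ((integrableOn_normalCycleDensity η P).mono_set inter_subset_left).congr
      ((ae_restrict_iff' hm').2 hae)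
  · rw [normalCycle_apply η P hA, setIntegral_congr_ae hm' hae]

/-- If the coefficients of an angular area measure depend on the dimension alone, then so do the
flat densities of its form. Were they different at two points, the linear isometry between the two
flat polytopes would show that the form integrates differently over neighborhoods of them. -/
theorem flatDensity_le_of_coeff_eq {Ψ : ConvexBody V → SignedMeasure (sphere (0 : V) 1)}
    {η : InvariantForm V m} (hΨ : ∀ (K : ConvexBody V) (A : Set (sphere (0 : V) 1)),
      MeasurableSet A → Ψ K A = normalCycle η K (Prod.snd ⁻¹' A)) {c : Submodule ℝ V → ℝ}
    (hc : IsAngularWith Ψ c) {γ : ℕ → ℝ}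
    (hγ : ∀ E : Submodule ℝ V, finrank ℝ E ≤ m → c E = γ (finrank ℝ E))
    {E₁ E₂ : Submodule ℝ V} {k : ℕ} (h₁ : finrank ℝ E₁ = k) (h₂ : finrank ℝ E₂ = k) (hk : k ≤ m)
    {u₁ u₂ : sphere (0 : V) 1} (hu₁ : (u₁ : V) ∈ E₁ᗮ) (hu₂ : (u₂ : V) ∈ E₂ᗮ) :
    flatDensity η E₁ u₁ ≤ flatDensity η E₂ u₂ := by
  by_contra! hlt
  obtain ⟨T, hT, hTE⟩ := exists_linearIsometryEquiv_map_eq h₁ h₂ hk (norm_eq_of_mem_sphere u₁)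
    (norm_eq_of_mem_sphere u₂) hu₁ hu₂
  obtain ⟨S, hS⟩ := (IsNoetherian.noetherian E₁ : E₁.FG)
  set s : Set V := insert 0 (S : Set V) with hs
  have hsf : s.Finite := S.finite_toSet.insert 0
  have hsne : s.Nonempty := ⟨0, mem_insert _ _⟩
  set P := polytope s hsf hsne with hP
  set Q := polytope (T '' s) (hsf.image T) (hsne.image T) with hQ
  have hQP : (Q : Set V) = T '' P := by
    change convexHull ℝ (T.toLinearEquiv.toLinearMap '' s) =
      T.toLinearEquiv.toLinearMap '' convexHull ℝ s
    rw [LinearMap.image_convexHull]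
  have hPE : (P : Set V) ⊆ E₁ := convexHull_min (insert_subset_iff.2 ⟨E₁.zero_mem, fun x hx =>
    hS ▸ Submodule.subset_span hx⟩) E₁.convex
  have hQE : (Q : Set V) ⊆ E₂ := by
    rw [hQP, ← hTE]
    rintro _ ⟨x, hx, rfl⟩
    exact ⟨x, hPE hx, rfl⟩
  have hsP : s ⊆ (P : Set V) := subset_convexHull ℝ s
  have hTorth : ∀ u ∈ E₁ᗮ, T u ∈ E₂ᗮ := fun u hu => (Submodule.mem_orthogonal _ _).2 fun x hx => by
    rw [← hTE] at hx
    obtain ⟨z, hz, rfl⟩ := hx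
    exact (T.inner_map_map z u).trans ((Submodule.mem_orthogonal _ _).1 hu z hz)
  -- The directions for which the first density is larger.
  set U : Set (sphere (0 : V) 1) :=
    {u | flatDensity η E₂ (sphereIsometry T u) < flatDensity η E₁ u} with hU
  have hUo : IsOpen U := isOpen_lt
    ((continuous_flatDensity η E₂).comp (sphereIsometry T).continuous) (continuous_flatDensity η E₁)
  set A : Set (sphere (0 : V) 1) := {u | (u : V) ∈ E₁ᗮ ∧ u ∈ U} with hA
  have hAm : MeasurableSet A := (E₁.isClosed_orthogonal.preimage
    continuous_subtype_val).measurableSet.inter hUo.measurableSet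
  have hTA : MeasurableSet (sphereIsometry T '' A) :=
    (sphereIsometry T).toHomeomorph.measurableEmbedding.measurableSet_image.2 hAm
  have hu₁U : U ∈ 𝓝 u₁ := hUo.mem_nhds (by
    rw [hU, mem_ofPred_eq, show sphereIsometry T u₁ = u₂ from Subtype.ext hT]
    exact hlt)
  obtain ⟨y, hy⟩ := exists_mem_nhds_shell (m := m) hPE (hsP (mem_insert _ _))
    (hS ▸ Submodule.span_mono ((subset_insert _ _).trans hsP)) hu₁ hu₁U
  set Ω : Set V := shell P ∩ normalDirection m P ⁻¹' A with hΩ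
  have hΩm : MeasurableSet Ω :=
    (measurableSet_shell P).inter (measurable_normalDirection P hAm)
  obtain ⟨hi₁, he₁⟩ := normalCycle_flat_eq η h₁ hk hPE hAm fun u hu => hu.1
  obtain ⟨hi₂, he₂⟩ := normalCycle_flat_eq η h₂ hk hQE hTA (by
    rintro _ ⟨u, hu, rfl⟩
    exact hTorth u hu.1)
  have hpre : T ⁻¹' (shell Q ∩ normalDirection m Q ⁻¹' (sphereIsometry T '' A)) = Ω := by
    rw [preimage_inter, preimage_shell T hQP]
    ext z
    refine and_congr_right fun hz => ?_
    rw [mem_preimage, mem_preimage, normalDirection_image T hQP (one_pos.trans hz.1)]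
    exact (sphereIsometry T).injective.mem_set_image
  have hTm : MeasurePreserving T volume volume := T.measurePreserving
  have hTe : MeasurableEmbedding T := T.toHomeomorph.measurableEmbedding
  have hcongr : ∀ z ∈ Ω, (infDist (T z) (Q : Set V))⁻¹ ^ (m - k) *
      flatDensity η E₂ (normalDirection m Q (T z)) = (infDist z (P : Set V))⁻¹ ^ (m - k) *
        flatDensity η E₂ (sphereIsometry T (normalDirection m P z)) := fun z hz => by
    rw [infDist_image_linearIsometryEquiv T hQP,
      normalDirection_image T hQP (one_pos.trans hz.1.1)]
  rw [← hTm.setIntegral_preimage_emb hTe, hpre, setIntegral_congr_fun hΩm hcongr, ← hΨ Q _ hTA,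
    apply_image_eq hc hγ (isPolytope_polytope hsf hsne) (isPolytope_polytope _ _) T hQP hAm,
    hΨ P A hAm, he₁] at he₂
  rw [← hTm.integrableOn_comp_preimage hTe, hpre] at hi₂
  have hi₂' := (integrableOn_congr_fun hcongr hΩm).1 hi₂
  have hzero := sub_eq_zero.2 he₂
  rw [← integral_sub hi₁ hi₂'] at hzero
  have hpos : ∀ z ∈ Ω, 0 < (infDist z (P : Set V))⁻¹ ^ (m - k) *
      flatDensity η E₁ (normalDirection m P z) - (infDist z (P : Set V))⁻¹ ^ (m - k) *
        flatDensity η E₂ (sphereIsometry T (normalDirection m P z)) := fun z hz => by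
    rw [← mul_sub]
    exact mul_pos (pow_pos (inv_pos.2 (one_pos.trans hz.1.1)) _) (sub_pos.2 hz.2.2)
  have hvol : 0 < volume Ω := Measure.measure_pos_of_mem_nhds volume hy
  have := (setIntegral_pos_iff_support_of_nonneg_ae ((ae_restrict_iff' hΩm).2
    (Eventually.of_forall fun z hz => (hpos z hz).le)) (hi₁.sub hi₂')).2
    (hvol.trans_le (measure_mono fun z hz => ⟨(hpos z hz).ne', hz⟩))
  exact this.ne' hzero

/-- An angular smooth area measure with vanishing centroid map is a combination of the `Δ_k`. -/
theorem mem_span_of_centroidMap_eq_zero {Ψ : ConvexBody V → SignedMeasure (sphere (0 : V) 1)}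
    (hΨ : IsSmoothAreaMeasure m Ψ) (hang : IsAngular Ψ) (hC : centroidMap Ψ = 0) :
    Ψ ∈ Submodule.span ℝ (range (Δ (V := V))) := by
  obtain ⟨η, hη⟩ := hΨ
  obtain ⟨c, hc⟩ := hang
  obtain ⟨γ, hγ⟩ := exists_coeff_eq (m := m) hc hC le_rfl
  have hflat : ∀ k : ℕ, ∃ g : ℝ, ∀ (E : Submodule ℝ V) (u : sphere (0 : V) 1), finrank ℝ E = k →
      k ≤ m → (u : V) ∈ Eᗮ → flatDensity η E u = g := by
    intro k
    by_cases h : ∃ (E : Submodule ℝ V) (u : sphere (0 : V) 1), finrank ℝ E = k ∧ (u : V) ∈ Eᗮ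
    · obtain ⟨E₀, u₀, hE₀, hu₀⟩ := h
      exact ⟨flatDensity η E₀ u₀, fun E u hE hk hu => le_antisymm
        (flatDensity_le_of_coeff_eq hη hc hγ hE hE₀ hk hu hu₀)
        (flatDensity_le_of_coeff_eq hη hc hγ hE₀ hE hk hu₀ hu)⟩
    · exact ⟨0, fun E u hE _ hu => absurd ⟨E, u, hE, hu⟩ h⟩
  choose g hg using hflat
  exact mem_span_Δ_of_flatDensity_eq hη fun E u hE hu => hg _ E u rfl hE hu

end FlatDensityConstant

end AreaMeasures

end

/-- Let `V` be a Euclidean vector space of dimension `m + 1 ≥ 1`. An angular smooth area measure on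
`V` has vanishing centroid map if and only if it is a linear combination of the `Δ_k`. -/
theorem mainTheorem8 {V : Type*} [NormedAddCommGroup V] [InnerProductSpace ℝ V]
    [FiniteDimensional ℝ V] [MeasurableSpace V] [BorelSpace V]
    (m : ℕ) [Fact (Module.finrank ℝ V = m + 1)]
    (Ψ : ConvexBody V → MeasureTheory.SignedMeasure (Metric.sphere (0 : V) 1))
    (hΨ : AreaMeasures.IsSmoothAreaMeasure m Ψ) (hang : AreaMeasures.IsAngular Ψ) :
    AreaMeasures.centroidMap Ψ = 0 ↔
      Ψ ∈ Submodule.span ℝ (Set.range (AreaMeasures.Δ (V := V))) :=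
  ⟨AreaMeasures.mem_span_of_centroidMap_eq_zero hΨ hang,
    AreaMeasures.centroidMap_eq_zero_of_mem_span m⟩
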